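/- **Setting.** Let $d\in\{2,3\}$, let $\Omega\subset\mathbb R^d$ be a bounded domain (open, connected, non-empty), $T>0$, and let $\eta:(0,\infty)\to(0,\infty)$ be Lipschitz. Let $(\rho,u,p)$ solve on $\Omega\times[0,T]$ $$\partial_t\rho+\nabla\cdot(\rho u)=0,\qquad \partial_t(\rho u)+\nabla\cdot(\rho u\otimes u)-2\nabla\cdot(\eta(\rho)\varepsilon(u))+\nabla p=f,\qquad \nabla\cdot u=0,\qquad u_{|\partial\Omega}=0,$$ where $\varepsilon(u)=\frac12(\nabla u+(\nabla u)^{T})$, $f$ is bounded on $[0,T]$ with values in $L^2(\Omega)^d$, and $\rho$ is bounded away from zero. Assume the regularity $$\rho\in W^{1,\infty}(0,T;L^\infty(\Omega)),\quad u\in L^\infty(0,T;W^{1,\infty}(\Omega)^d)\cap W^{2,\infty}(0,T;L^\infty(\Omega)^d),\quad p\in W^{1,\infty}(0,T;L^\infty(\Omega)).$$ Let $\rho_{\min},\rho_{\max}$ be the minimum and maximum of $\rho(0)$ on $\Omega$, let $\lambda>0$, and set $$\bar\nu=1.1\,\|\eta(\rho(0))/\rho(0)\|_{L^\infty},\qquad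 \bar\lambda=1.1\,\lambda\,\|1/\rho(0)\|_{L^\infty}.$$ **Scheme.** Let $N\tau=T$, $t_n=n\tau$, $\delta\phi^n=\phi^n-\phi^{n-1}$, $f^n=f(t_n)$, $\eta^n=\eta(\rho^n)$. Start from $\rho^0=\rho(0)$, $u^0=u(0)$, $p^0=p(0)$, $m^0=\rho^0u^0$. For $0\le n<N$ let $\rho^{n+1}$ satisfy $$\frac{\delta\rho^{n+1}}{\tau}+u^n\cdot\nabla\rho^n=R_\rho^{n+1}$$ (this defines the residual $R_\rho^{n+1}$; all $\rho^n$ are in $W^{1,\infty}(\Omega)$), let $m^{n+1},u^{n+1}\in H^1_0(\Omega)^d$ satisfy $u^{n+1}=m^{n+1}/\rho^{n+1}$ and $$\frac{\delta m^{n+1}}{\tau}-2\bar\nu\nabla\cdot\varepsilon(m^{n+1}-\rho^{n+1}u^n)-2\nabla\cdot(\eta^{n+1}\varepsilon(u^n))-\bar\lambda\nabla\nabla\cdot(m^{n+1}-\rho^{n+1}u^n)-\lambda\nabla\nabla\cdot u^n+\nabla p^n$$ $$+\nabla\cdot(\rho^nu^{n+1}\otimes u^n)-\tfrac12\rho^nu^{n+1}\nabla\cdot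 u^n-\tfrac12u^{n+1}R_\rho^{n+1}=f^{n+1}$$ in the variational sense, and let $p^{n+1}=p^n-\lambda\nabla\cdot u^{n+1}\in L^2(\Omega)$. **Assumptions on the discrete density.** Let $\gamma>0$ with $\gamma^2\le\min\left(\frac14,\frac1{64\bar\nu}\right)$. Assume $\rho_{\min}\le\rho^n\le\rho_{\max}$ for $0\le n\le N$ and, for $0\le n<N$, $$(\tau\bar\nu)^{1/2}\left\|\frac{\nabla\rho^{n+1}}{\sqrt{\rho^n\eta^{n+1}}}\right\|_{L^\infty}\le\gamma,\qquad \tau^{1/2}\left\|\frac{\sqrt2\,\bar\lambda\,\nabla\rho^{n+1}}{\sqrt{\rho^n\eta^{n+1}}}\right\|_{L^\infty}\le\gamma,$$ $$\left\|\frac{\bar\nu\,\delta\rho^{n+1}}{\eta^{n+1}}\right\|_{L^\infty}\le1,\qquad\left\|\frac{\bar\lambda\,\delta\rho^{n+1}}{\lambda}\right\|_{L^\infty}\le1.$$ **Conclusion.** Put $e_\rho^n=\rho(t_n)-\rho^n$, $e_u^n=u(t_n)-u^n$, $e_p^n=p(t_n)-p^n$ and $$A^n=\|\sqrt{\rho^n}e_u^n\|_{L^2}^2+\frac\tau\lambda\|e_p^n\|_{L^2}^2+2\tau\bar\nu\|\sqrt{\rho^n}\varepsilon(e_u^n)\|_{L^2}^2+\tau\bar\lambda\|\sqrt{\rho^n}\,\nabla\cdot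 e_u^n\|_{L^2}^2,\qquad B^n=\|\sqrt{\eta^n}\varepsilon(e_u^n)\|_{L^2}^2.$$ There is a constant $C>0$, independent of the time step $\tau$ and of the approximations $(\rho^n,m^n,u^n,p^n)$, such that for all $0\le n<N$ $$(1-C\tau)A^{n+1}+\tau B^{n+1}\le(1+C\tau)A^n+C\tau^2+C\tau\left(\|e_\rho^{n+1}\|_{L^2}^2+\|e_\rho^n\|_{L^2}^2+\|R_\rho^{n+1}\|_{L^2}^2\right).$$ -/

import Mathlib

open MeasureTheory Set Filter Topology
open scoped ENNReal NNReal ContDiff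

namespace VarDensityNS

noncomputable section

/-- The Euclidean space of dimension `d`. -/
abbrev E (d : ℕ) : Type := EuclideanSpace ℝ (Fin d)

/-- Lebesgue measure on `Ω`. -/
abbrev vol {d : ℕ} (Ω : Set (E d)) : Measure (E d) := volume.restrict Ω

/-! ### Weak derivatives and Sobolev spaces on an open set -/

/-- Classical partial derivative in the direction of the `j`-th basis vector. -/
def cd {d : ℕ} (j : Fin d) (φ : E d → ℝ) (x : E d) : ℝ :=
  fderiv ℝ φ x (EuclideanSpace.single j 1)

/-- Test functions: smooth, with compact support contained in `Ω`. -/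
def IsTest {d : ℕ} (Ω : Set (E d)) (φ : E d → ℝ) : Prop :=
  ContDiff ℝ ∞ φ ∧ HasCompactSupport φ ∧ tsupport φ ⊆ Ω

/-- `g` is the weak `j`-th partial derivative of `f` in `Ω`. -/
def HasWeakDeriv {d : ℕ} (Ω : Set (E d)) (j : Fin d) (f g : E d → ℝ) : Prop :=
  LocallyIntegrableOn f Ω ∧ LocallyIntegrableOn g Ω ∧
    ∀ φ : E d → ℝ, IsTest Ω φ →
      ∫ x in Ω, f x * cd j φ x = - ∫ x in Ω, g x * φ x

open Classical in
/-- The weak `j`-th partial derivative of `f` in `Ω` (almost everywhere unique; only used for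
functions that have one). -/
def wd {d : ℕ} (Ω : Set (E d)) (j : Fin d) (f : E d → ℝ) : E d → ℝ :=
  if h : ∃ g, HasWeakDeriv Ω j f g then h.choose else 0

/-- The Sobolev space `W^{1,q}(Ω)`. -/
def MemW1 {d : ℕ} (Ω : Set (E d)) (q : ℝ≥0∞) (f : E d → ℝ) : Prop :=
  MemLp f q (vol Ω) ∧
    ∀ j, (∃ g, HasWeakDeriv Ω j f g) ∧ MemLp (wd Ω j f) q (vol Ω)

/-- The space `H¹₀(Ω)`: the closure of the test functions in `H¹(Ω)`. -/
def MemH10 {d : ℕ} (Ω : Set (E d)) (f : E d → ℝ) : Prop :=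
  MemW1 Ω 2 f ∧ ∃ φ : ℕ → E d → ℝ, (∀ k, IsTest Ω (φ k)) ∧
    Tendsto (fun k => eLpNorm (fun x => φ k x - f x) 2 (vol Ω)) atTop (𝓝 0) ∧
    ∀ j, Tendsto (fun k => eLpNorm (fun x => cd j (φ k) x - wd Ω j f x) 2 (vol Ω)) atTop (𝓝 0)

/-- Vector fields in `H¹₀(Ω)`. -/
def MemH10v {d : ℕ} (Ω : Set (E d)) (v : E d → E d) : Prop :=
  ∀ i, MemH10 Ω (fun x => v x i)

/-- `∂_j v_i`, weakly. -/
def gradv {d : ℕ} (Ω : Set (E d)) (v : E d → E d) (i j : Fin d) (x : E d) : ℝ :=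
  wd Ω j (fun y => v y i) x

/-- The strain rate tensor `ε(v) = (∇v + (∇v)ᵀ) / 2`. -/
def strain {d : ℕ} (Ω : Set (E d)) (v : E d → E d) (i j : Fin d) (x : E d) : ℝ :=
  (gradv Ω v i j x + gradv Ω v j i x) / 2

/-- The divergence of `v`. -/
def dv {d : ℕ} (Ω : Set (E d)) (v : E d → E d) (x : E d) : ℝ :=
  ∑ i, gradv Ω v i i x

/-- The Euclidean norm of the weak gradient of a scalar function. -/
def gradNorm {d : ℕ} (Ω : Set (E d)) (f : E d → ℝ) (x : E d) : ℝ :=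
  √(∑ j, (wd Ω j f x) ^ 2)

/-- The squared `L²(Ω)` norm of a scalar function. -/
def sqL2 {d : ℕ} (Ω : Set (E d)) (w : E d → ℝ) : ℝ := ∫ x in Ω, (w x) ^ 2

/-- The squared `L²(Ω)` norm of a vector field. -/
def sqL2v {d : ℕ} (Ω : Set (E d)) (w : E d → E d) : ℝ := ∫ x in Ω, ‖w x‖ ^ 2

/-- The squared `L²(Ω)` norm of a matrix field. -/
def sqL2m {d : ℕ} (Ω : Set (E d)) (w : Fin d → Fin d → E d → ℝ) : ℝ :=
  ∫ x in Ω, ∑ i, ∑ j, (w i j x) ^ 2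

/-- Bochner-Sobolev space `W^{m,∞}(0,T;X)`, through the representative that (for `m ≥ 1`) is
continuous on `[0,T]` and is the integral of its weak time derivative. -/
def MemWTime {X : Type*} [NormedAddCommGroup X] [NormedSpace ℝ X] (T : ℝ) :
    ℕ → (ℝ → X) → Prop
  | 0, v => MemLp v ∞ (volume.restrict (Icc 0 T))
  | m + 1, v => ∃ w : ℝ → X, MemWTime T m w ∧ ∀ t ∈ Icc 0 T, v t = v 0 + ∫ s in (0 : ℝ)..t, w s

/-! ### The exact solution -/

/-- `L^∞(Ω)`. -/
abbrev Linf {d : ℕ} (Ω : Set (E d)) : Type := Lp ℝ ∞ (vol Ω)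

/-- `L^∞(Ω)^d`. -/
abbrev Linfv {d : ℕ} (Ω : Set (E d)) : Type := Lp (E d) ∞ (vol Ω)

/-- `L²(Ω)^d`. -/
abbrev L2v {d : ℕ} (Ω : Set (E d)) : Type := Lp (E d) 2 (vol Ω)

/-- Regularity of the exact solution:
`ρ ∈ W^{1,∞}(0,T;L^∞)`, `u ∈ L^∞(0,T;W^{1,∞}) ∩ W^{2,∞}(0,T;L^∞)`, `p ∈ W^{1,∞}(0,T;L^∞)`.
Since `u` is continuous from `[0,T]` to `L^∞`, a bound of `∇u(t)` in `L^∞` for almost every `t` is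
the same as that bound for every `t`. -/
structure IsRegular {d : ℕ} (Ω : Set (E d)) (T : ℝ)
    (ρ : ℝ → Linf Ω) (u : ℝ → Linfv Ω) (p : ℝ → Linf Ω) : Prop where
  density : MemWTime T 1 ρ
  velocity_time : MemWTime T 2 u
  velocity_space : ∃ K : ℝ≥0, ∀ t ∈ Icc 0 T, ∀ i,
    MemW1 Ω ∞ (fun x => u t x i) ∧ ∀ j, eLpNorm (gradv Ω (u t) i j) ∞ (vol Ω) ≤ K
  pressure : MemWTime T 1 p

/-- The variable density incompressible Navier-Stokes system on `Ω × [0,T]`, in conservative form,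
in the sense of distributions in space, at every time:
`∂_t ρ + div(ρu) = 0`, `∂_t(ρu) + div(ρu ⊗ u) - 2 div(η(ρ) ε(u)) + ∇p = f`, `div u = 0`,
with a density that is bounded away from zero and homogeneous Dirichlet boundary conditions on `u`. -/
structure IsExactSolution {d : ℕ} (Ω : Set (E d)) (T : ℝ) (η : ℝ → ℝ)
    (ρ : ℝ → Linf Ω) (u : ℝ → Linfv Ω) (p : ℝ → Linf Ω) (f : ℝ → L2v Ω) : Prop where
  density_pos : ∃ c : ℝ, 0 < c ∧ ∀ t ∈ Icc 0 T, ∀ᵐ x ∂(vol Ω), c ≤ ρ t x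
  mass : ∀ φ : E d → ℝ, IsTest Ω φ → ∀ t ∈ Icc 0 T,
    HasDerivWithinAt (fun s => ∫ x in Ω, ρ s x * φ x)
      (∫ x in Ω, ∑ j, ρ t x * u t x j * cd j φ x) (Icc 0 T) t
  momentum : ∀ φ : Fin d → E d → ℝ, (∀ i, IsTest Ω (φ i)) → ∀ t ∈ Icc 0 T,
    HasDerivWithinAt (fun s => ∫ x in Ω, ∑ i, ρ s x * u s x i * φ i x)
      ((∫ x in Ω, ∑ i, ∑ j, ρ t x * u t x i * u t x j * cd j (φ i) x)
        - 2 * (∫ x in Ω, ∑ i, ∑ j, η (ρ t x) * strain Ω (u t) i j x * cd j (φ i) x)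
        + (∫ x in Ω, p t x * ∑ i, cd i (φ i) x)
        + ∫ x in Ω, ∑ i, f t x i * φ i x) (Icc 0 T) t
  incompressible : ∀ t ∈ Icc 0 T, ∀ᵐ x ∂(vol Ω), dv Ω (u t) x = 0
  boundary : ∀ t ∈ Icc 0 T, MemH10v Ω (u t)

/-! ### Parameters of the scheme, computed from the initial density `ρ⁰` -/

/-- `ρ_min`. -/
def rhoMin {d : ℕ} (Ω : Set (E d)) (ρ0 : E d → ℝ) : ℝ := essInf ρ0 (vol Ω)

/-- `ρ_max`. -/
def rhoMax {d : ℕ} (Ω : Set (E d)) (ρ0 : E d → ℝ) : ℝ := essSup ρ0 (vol Ω)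

/-- `ν̄ = 1.1 ‖η(ρ⁰)/ρ⁰‖_{L^∞}`. -/
def nuBar {d : ℕ} (Ω : Set (E d)) (η : ℝ → ℝ) (ρ0 : E d → ℝ) : ℝ :=
  (11 / 10) * (eLpNorm (fun x => η (ρ0 x) / ρ0 x) ∞ (vol Ω)).toReal

/-- `λ̄ = 1.1 λ / ρ̲`, where `1 / ρ̲ = ‖1/ρ⁰‖_{L^∞}`. -/
def lamBar {d : ℕ} (Ω : Set (E d)) (lam : ℝ) (ρ0 : E d → ℝ) : ℝ :=
  (11 / 10) * lam * (eLpNorm (fun x => 1 / ρ0 x) ∞ (vol Ω)).toReal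

/-! ### The scheme -/

/-- The sequences `ρⁿ, mⁿ, uⁿ, pⁿ` and the density residual `R_ρⁿ`, for `n ≤ N`, are produced by the
time marching algorithm with time step `τ`, source terms `fⁿ` and initial data `ρ⁰, u⁰, p⁰`
(written `ρi, ui, pi`). -/
structure IsScheme {d : ℕ} (Ω : Set (E d)) (η : ℝ → ℝ) (lam nub lamb τ : ℝ) (N : ℕ)
    (fh : ℕ → E d → E d) (ρi : E d → ℝ) (ui : E d → E d) (pi : E d → ℝ)
    (ρ : ℕ → E d → ℝ) (m u : ℕ → E d → E d) (p R : ℕ → E d → ℝ) : Prop where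
  density_mem : ∀ n ≤ N, MemW1 Ω ∞ (ρ n)
  momentum_mem : ∀ n ≤ N, MemH10v Ω (m n)
  velocity_mem : ∀ n ≤ N, MemH10v Ω (u n)
  pressure_mem : ∀ n ≤ N, MemLp (p n) 2 (vol Ω)
  initial : ∀ᵐ x ∂(vol Ω), ρ 0 x = ρi x ∧ u 0 x = ui x ∧ m 0 x = ρi x • ui x ∧ p 0 x = pi x
  /-- `δρⁿ⁺¹/τ + uⁿ · ∇ρⁿ = R_ρⁿ⁺¹`. -/
  step_density : ∀ n < N, ∀ᵐ x ∂(vol Ω),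
    (ρ (n + 1) x - ρ n x) / τ + ∑ j, u n x j * wd Ω j (ρ n) x = R (n + 1) x
  /-- The momentum equation for `mⁿ⁺¹`, in variational form, with `m* = ρⁿ⁺¹ uⁿ`. -/
  step_momentum : ∀ n < N, ∀ v : E d → E d, MemH10v Ω v →
    (∫ x in Ω, ∑ i, (m (n + 1) x i - m n x i) / τ * v x i)
      + 2 * nub * (∫ x in Ω, ∑ i, ∑ j,
          strain Ω (fun y => m (n + 1) y - ρ (n + 1) y • u n y) i j x * strain Ω v i j x)
      + 2 * (∫ x in Ω, ∑ i, ∑ j, η (ρ (n + 1) x) * strain Ω (u n) i j x * strain Ω v i j x)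
      + lamb * (∫ x in Ω, dv Ω (fun y => m (n + 1) y - ρ (n + 1) y • u n y) x * dv Ω v x)
      + lam * (∫ x in Ω, dv Ω (u n) x * dv Ω v x)
      - (∫ x in Ω, p n x * dv Ω v x)
      - (∫ x in Ω, ∑ i, ∑ j, ρ n x * u (n + 1) x i * u n x j * gradv Ω v i j x)
      - (1 / 2) * (∫ x in Ω, ∑ i, ρ n x * u (n + 1) x i * dv Ω (u n) x * v x i)
      - (1 / 2) * (∫ x in Ω, ∑ i, R (n + 1) x * u (n + 1) x i * v x i)
      = ∫ x in Ω, ∑ i, fh (n + 1) x i * v x i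
  step_velocity : ∀ n < N, ∀ᵐ x ∂(vol Ω), u (n + 1) x = (1 / ρ (n + 1) x) • m (n + 1) x
  step_pressure : ∀ n < N, ∀ᵐ x ∂(vol Ω), p (n + 1) x = p n x - lam * dv Ω (u (n + 1)) x

/-- Minimum-maximum principle for the discrete density. -/
def MinMax {d : ℕ} (Ω : Set (E d)) (N : ℕ) (ρi : E d → ℝ) (ρ : ℕ → E d → ℝ) : Prop :=
  ∀ n ≤ N, ∀ᵐ x ∂(vol Ω), rhoMin Ω ρi ≤ ρ n x ∧ ρ n x ≤ rhoMax Ω ρi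

/-- Smallness conditions on the time step and the discrete density, with parameter `γ`. -/
structure SmallnessConditions {d : ℕ} (Ω : Set (E d)) (η : ℝ → ℝ) (lam nub lamb τ γ : ℝ) (N : ℕ)
    (ρ : ℕ → E d → ℝ) : Prop where
  /-- `(τ ν̄)^{1/2} ‖∇ρⁿ⁺¹ / √(ρⁿ ηⁿ⁺¹)‖_{L^∞} ≤ γ`. -/
  grad_nu : ∀ n < N, eLpNorm (fun x => √(τ * nub) *
    (gradNorm Ω (ρ (n + 1)) x / √(ρ n x * η (ρ (n + 1) x)))) ∞ (vol Ω) ≤ ENNReal.ofReal γ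
  /-- `τ^{1/2} ‖√2 λ̄ ∇ρⁿ⁺¹ / √(ρⁿ ηⁿ⁺¹)‖_{L^∞} ≤ γ`. -/
  grad_lam : ∀ n < N, eLpNorm (fun x => √τ *
    (√2 * lamb * gradNorm Ω (ρ (n + 1)) x / √(ρ n x * η (ρ (n + 1) x)))) ∞ (vol Ω)
      ≤ ENNReal.ofReal γ
  /-- `‖ν̄ δρⁿ⁺¹ / ηⁿ⁺¹‖_{L^∞} ≤ 1`. -/
  incr_nu : ∀ n < N, eLpNorm (fun x => nub * (ρ (n + 1) x - ρ n x) / η (ρ (n + 1) x)) ∞ (vol Ω) ≤ 1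
  /-- `‖λ̄ δρⁿ⁺¹ / λ‖_{L^∞} ≤ 1`. -/
  incr_lam : ∀ n < N, eLpNorm (fun x => lamb * (ρ (n + 1) x - ρ n x) / lam) ∞ (vol Ω) ≤ 1

/-! ### The error functionals -/

/-- `Aⁿ = ‖√ρⁿ e_u‖² + (τ/λ)‖e_p‖² + 2τν̄ ‖√ρⁿ ε(e_u)‖² + τλ̄ ‖√ρⁿ div e_u‖²`. -/
def errA {d : ℕ} (Ω : Set (E d)) (lam nub lamb τ : ℝ)
    (ρn : E d → ℝ) (eu : E d → E d) (ep : E d → ℝ) : ℝ :=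
  sqL2v Ω (fun x => √(ρn x) • eu x) + τ / lam * sqL2 Ω ep
    + 2 * τ * nub * sqL2m Ω (fun i j x => √(ρn x) * strain Ω eu i j x)
    + τ * lamb * sqL2 Ω (fun x => √(ρn x) * dv Ω eu x)

/-- `Bⁿ = ‖√η(ρⁿ) ε(e_u)‖²`. -/
def errB {d : ℕ} (Ω : Set (E d)) (η : ℝ → ℝ) (ρn : E d → ℝ) (eu : E d → E d) : ℝ :=
  sqL2m Ω (fun i j x => √(η (ρn x)) * strain Ω eu i j x)

end

end VarDensityNS

namespace VarDensityNS

/-! The estimate is a discrete energy argument. The exact momentum equation at the new time,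
rewritten as ρ(∂ₜu + u·∇u) - 2 div(η(ρ)ε(u)) + ∇p = f, is compared with the scheme; both are tested
with e, the velocity error at the new time. Two null integrals are added, those of div(ρⁿuⁿ
(u(t)·e)) and of half of div(ρⁿuⁿ |e|²). The correction terms with div uⁿ and R_ρ in the scheme are
designed so that, after this, every convective term quadratic in e cancels. All remaining work is
pointwise: `energy_identity` is exact algebra at a point, `energy_pointwise` bounds its right-hand
side, and `step_estimate` integrates the resulting inequality once.

Four mechanisms give stability. Inertia yields ρⁿ|e - e'|² with e' the old error. The viscous term,
whose implicit part has a coefficient dominating the viscosity (η ≤ ν̄ρ), yields twice the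
dissipation τη|ε(e)|² beyond the increment of the weighted strain in the error functional
(`viscous_energy`). The pressure update is an exact difference equation for the pressure error
(`pressure_energy`), and the factor 1.1 in λ̄ leaves one tenth of τλ|div(e - e')|². The implicit
part acts on m - ρuⁿ = ρ(u - uⁿ), so it produces commutators with ∇ρ. The smallness conditions make
these absorbable by the inertial and viscous gains.

Three facts about the data are needed. First, η(s) ≤ ν̄s must hold on the whole interval [ρ_min,
ρ_max], although ν̄ sees only the values of ρ(0). This is true because a W^{1,∞} function on a
connected set is locally Lipschitz, so its essential range has no gap (`MemW1.no_gap`,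
`MemW1.le_of_mem_Icc`). Secondly, no time regularity of ∇u is assumed. It comes from the equation:
testing its forms at times s and t with u(s) - u(t) removes the pressure and gives ‖ε(u(s) - u(t))‖²
≤ C|s - t| (`ExactBounds.strain_increment`), exactly what a consistency error O(τ²) per step
requires. Thirdly, the cubic convection terms are integrable on H¹₀ by the embedding in L⁴, which is
where d ≤ 3 enters. -/

/-! ### Convergence in `L^p` -/

/-- The sequence `f` of `L^p` functions converges to the `L^p` function `g` in `L^p`. -/
structure LpLim {α : Type*} [MeasurableSpace α] (μ : Measure α) (p : ℝ≥0∞)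
    (f : ℕ → α → ℝ) (g : α → ℝ) : Prop where
  mem : ∀ k, MemLp (f k) p μ
  lim_mem : MemLp g p μ
  tendsto : Tendsto (fun k => eLpNorm (fun x => f k x - g x) p μ) atTop (𝓝 0)

section LpLim

variable {α : Type*} [MeasurableSpace α] {μ : Measure α} {p q r : ℝ≥0∞}
  {f f' : ℕ → α → ℝ} {g g' : α → ℝ}

theorem LpLim.const (hg : MemLp g p μ) : LpLim μ p (fun _ => g) g :=
  ⟨fun _ => hg, hg, by simp⟩

theorem LpLim.add (hp : 1 ≤ p) (h : LpLim μ p f g) (h' : LpLim μ p f' g') :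
    LpLim μ p (fun k x => f k x + f' k x) (fun x => g x + g' x) := by
  refine ⟨fun k => (h.mem k).add (h'.mem k), h.lim_mem.add h'.lim_mem, ?_⟩
  refine tendsto_of_tendsto_of_tendsto_of_le_of_le tendsto_const_nhds
    (by simpa using h.tendsto.add h'.tendsto) (fun _ => zero_le) fun k => ?_
  have := eLpNorm_add_le ((h.mem k).sub h.lim_mem).1 ((h'.mem k).sub h'.lim_mem).1 hp
  refine le_trans (le_of_eq ?_) this
  congr 1
  ext x
  simp only [Pi.add_apply, Pi.sub_apply]
  ring

theorem LpLim.neg (h : LpLim μ p f g) : LpLim μ p (fun k x => - f k x) (fun x => - g x) := by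
  refine ⟨fun k => (h.mem k).neg, h.lim_mem.neg, h.tendsto.congr fun k => ?_⟩
  rw [← eLpNorm_neg]
  congr 1
  ext x
  simp only [Pi.neg_apply]
  ring

theorem LpLim.sub (hp : 1 ≤ p) (h : LpLim μ p f g) (h' : LpLim μ p f' g') :
    LpLim μ p (fun k x => f k x - f' k x) (fun x => g x - g' x) := by
  simpa [sub_eq_add_neg] using h.add hp h'.neg

/-- Expanding both factors around their limits leaves three products, each with a factor that tends
to zero; no separate bound on the sequences is needed. -/
theorem LpLim.mul [ENNReal.HolderTriple p q r] (hr : 1 ≤ r)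
    (h : LpLim μ p f g) (h' : LpLim μ q f' g') :
    LpLim μ r (fun k x => f k x * f' k x) (fun x => g x * g' x) := by
  refine ⟨fun k => (h'.mem k).mul' (h.mem k), h'.lim_mem.mul' h.lim_mem, ?_⟩
  have key : Tendsto (fun k => eLpNorm (fun x => f k x - g x) p μ *
      eLpNorm (fun x => f' k x - g' x) q μ + eLpNorm (fun x => f k x - g x) p μ * eLpNorm g' q μ
      + eLpNorm g p μ * eLpNorm (fun x => f' k x - g' x) q μ) atTop (𝓝 0) := by
    have h1 := ENNReal.Tendsto.mul h.tendsto (Or.inr ENNReal.zero_ne_top) h'.tendsto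
      (Or.inr ENNReal.zero_ne_top)
    have h2 := ENNReal.Tendsto.mul_const (b := eLpNorm g' q μ) h.tendsto
      (Or.inr h'.lim_mem.eLpNorm_ne_top)
    have h3 := ENNReal.Tendsto.const_mul (a := eLpNorm g p μ) h'.tendsto
      (Or.inr h.lim_mem.eLpNorm_ne_top)
    simpa using (h1.add h2).add h3
  refine tendsto_of_tendsto_of_tendsto_of_le_of_le tendsto_const_nhds key
    (fun _ => zero_le) fun k => ?_
  have m1 := (h.mem k).sub h.lim_mem
  have m2 := (h'.mem k).sub h'.lim_mem
  have e : (fun x => f k x * f' k x - g x * g' x)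
      = ((f k - g) • (f' k - g') + (f k - g) • g') + g • (f' k - g') := by
    ext x
    simp only [Pi.add_apply, Pi.mul_apply, Pi.sub_apply, smul_eq_mul]
    ring
  rw [e]
  have n1 : MemLp ((f k - g) • (f' k - g')) r μ := m2.smul m1
  have n2 : MemLp ((f k - g) • g') r μ := h'.lim_mem.smul m1
  have n3 : MemLp (g • (f' k - g')) r μ := m2.smul h.lim_mem
  refine (eLpNorm_add_le (n1.add n2).1 n3.1 hr).trans
    (add_le_add ((eLpNorm_add_le n1.1 n2.1 hr).trans (add_le_add ?_ ?_)) ?_)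
  · exact eLpNorm_smul_le_mul_eLpNorm m2.1 m1.1
  · exact eLpNorm_smul_le_mul_eLpNorm h'.lim_mem.1 m1.1
  · exact eLpNorm_smul_le_mul_eLpNorm m2.1 h.lim_mem.1

theorem LpLim.tendsto_integral (h : LpLim μ 1 f g) :
    Tendsto (fun k => ∫ x, f k x ∂μ) atTop (𝓝 (∫ x, g x ∂μ)) := by
  refine tendsto_integral_of_L1' g h.lim_mem.1
    (Eventually.of_forall fun k => memLp_one_iff_integrable.1 (h.mem k)) h.tendsto

theorem LpLim.congr_lim (h : LpLim μ p f g) (e : g =ᵐ[μ] g') : LpLim μ p f g' := by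
  refine ⟨h.mem, h.lim_mem.ae_eq e, h.tendsto.congr fun k => eLpNorm_congr_ae ?_⟩
  filter_upwards [e] with x hx
  rw [hx]

theorem LpLim.congr_seq (h : LpLim μ p f g) (e : ∀ k, f k =ᵐ[μ] f' k) : LpLim μ p f' g := by
  refine ⟨fun k => (h.mem k).ae_eq (e k), h.lim_mem, h.tendsto.congr fun k => eLpNorm_congr_ae ?_⟩
  filter_upwards [e k] with x hx
  rw [hx]

theorem LpLim.finset_sum {ι : Type*} (s : Finset ι) {F : ι → ℕ → α → ℝ} {G : ι → α → ℝ}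
    (hp : 1 ≤ p) (h : ∀ i ∈ s, LpLim μ p (F i) (G i)) :
    LpLim μ p (fun k x => ∑ i ∈ s, F i k x) (fun x => ∑ i ∈ s, G i x) := by
  classical
  induction s using Finset.induction_on with
  | empty => simpa using LpLim.const (μ := μ) (p := p) (g := fun _ => (0 : ℝ)) MemLp.zero'
  | insert i s hi ih =>
    simp only [Finset.sum_insert hi]
    exact (h i (by simp)).add hp (ih fun j hj => h j (by simp [hj]))

end LpLim

/-- Used for the convection terms: two undifferentiated factors in L⁴ against one gradient in L². -/
theorem holderTriple_four_four_two : ENNReal.HolderTriple 4 4 2 := by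
  constructor
  have h4 : (4 : ℝ≥0∞)⁻¹ = 2⁻¹ * 2⁻¹ := by
    rw [← ENNReal.mul_inv (by simp) (by simp)]
    norm_num
  rw [h4, ← two_mul, ← mul_assoc, ENNReal.mul_inv_cancel (by simp) (by simp), one_mul]

attribute [instance] holderTriple_four_four_two

theorem MemLp.integrable_mul_two {α : Type*} [MeasurableSpace α] {μ : Measure α} {f g : α → ℝ}
    (hf : MemLp f 2 μ) (hg : MemLp g 2 μ) : Integrable (fun x => f x * g x) μ :=
  memLp_one_iff_integrable.1 (hg.mul' hf)

theorem integral_add_three {α : Type*} [MeasurableSpace α] {μ : Measure α} {f g h : α → ℝ}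
    (hf : Integrable f μ) (hg : Integrable g μ) (hh : Integrable h μ) :
    ∫ x, (f x + g x + h x) ∂μ = ∫ x, f x ∂μ + ∫ x, g x ∂μ + ∫ x, h x ∂μ := by
  rw [integral_add (f := fun x => f x + g x) (hf.add hg) hh, integral_add hf hg]

/-! ### Bookkeeping of integrable functions with known integral -/

/-- `f` is integrable with integral `c`. -/
structure IntegralEq {α : Type*} [MeasurableSpace α] (μ : Measure α) (f : α → ℝ) (c : ℝ) :
    Prop where
  integrable : Integrable f μ
  eq : ∫ x, f x ∂μ = c

section IntegralEq

variable {α : Type*} [MeasurableSpace α] {μ : Measure α} {f g : α → ℝ} {c e : ℝ}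

theorem IntegralEq.of_integrable (hf : Integrable f μ) : IntegralEq μ f (∫ x, f x ∂μ) := ⟨hf, rfl⟩

theorem IntegralEq.add (hf : IntegralEq μ f c) (hg : IntegralEq μ g e) :
    IntegralEq μ (fun x => f x + g x) (c + e) :=
  ⟨hf.1.add hg.1, by rw [integral_add hf.1 hg.1, hf.2, hg.2]⟩

theorem IntegralEq.sub (hf : IntegralEq μ f c) (hg : IntegralEq μ g e) :
    IntegralEq μ (fun x => f x - g x) (c - e) :=
  ⟨hf.1.sub hg.1, by rw [integral_sub hf.1 hg.1, hf.2, hg.2]⟩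

theorem IntegralEq.const_mul (hf : IntegralEq μ f c) (k : ℝ) :
    IntegralEq μ (fun x => k * f x) (k * c) :=
  ⟨hf.1.const_mul k, by rw [integral_const_mul, hf.2]⟩

theorem IntegralEq.sum {ι : Type*} (s : Finset ι) {F : ι → α → ℝ} {C : ι → ℝ}
    (h : ∀ i ∈ s, IntegralEq μ (F i) (C i)) :
    IntegralEq μ (fun x => ∑ i ∈ s, F i x) (∑ i ∈ s, C i) :=
  ⟨integrable_finsetSum s fun i hi => (h i hi).1, by
    rw [integral_finsetSum s fun i hi => (h i hi).1]
    exact Finset.sum_congr rfl fun i hi => (h i hi).2⟩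

theorem IntegralEq.congr_ae (hf : IntegralEq μ f c) (h : f =ᵐ[μ] g) : IntegralEq μ g c :=
  ⟨hf.1.congr h, by rw [← integral_congr_ae h, hf.2]⟩

theorem IntegralEq.congr_val (hf : IntegralEq μ f c) (h : c = e) : IntegralEq μ f e := h ▸ hf

theorem IntegralEq.mono (hf : IntegralEq μ f c) (hg : IntegralEq μ g e) (h : f ≤ᵐ[μ] g) :
    c ≤ e := by
  rw [← hf.2, ← hg.2]
  exact integral_mono_ae hf.1 hg.1 h

end IntegralEq

/-! ### Test functions -/

section Sobolev

variable {d : ℕ} {Ω : Set (E d)}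

theorem isFiniteMeasure_vol (hΩb : Bornology.IsBounded Ω) : IsFiniteMeasure (vol Ω) :=
  ⟨by rw [Measure.restrict_apply_univ]; exact hΩb.measure_lt_top⟩

theorem IsTest.mul {φ ψ : E d → ℝ} (hφ : IsTest Ω φ) (hψ : IsTest Ω ψ) :
    IsTest Ω (fun x => φ x * ψ x) :=
  ⟨hφ.1.mul hψ.1, hφ.2.1.mul_right, (tsupport_mul_subset_left (f := φ) (g := ψ)).trans hφ.2.2⟩

theorem IsTest.sub {φ ψ : E d → ℝ} (hφ : IsTest Ω φ) (hψ : IsTest Ω ψ) :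
    IsTest Ω (fun x => φ x - ψ x) :=
  ⟨hφ.1.sub hψ.1, hφ.2.1.sub hψ.2.1,
    (tsupport_sub φ ψ).trans (union_subset hφ.2.2 hψ.2.2)⟩

theorem IsTest.differentiable {φ : E d → ℝ} (hφ : IsTest Ω φ) : Differentiable ℝ φ :=
  hφ.1.differentiable (by simp)

theorem IsTest.continuous_cd {φ : E d → ℝ} (hφ : IsTest Ω φ) (j : Fin d) :
    Continuous (cd j φ) :=
  (hφ.1.continuous_fderiv (by simp)).clm_apply continuous_const

theorem IsTest.hasCompactSupport_cd {φ : E d → ℝ} (hφ : IsTest Ω φ) (j : Fin d) :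
    HasCompactSupport (cd j φ) :=
  hφ.2.1.fderiv_apply (𝕜 := ℝ) (EuclideanSpace.single j 1)

theorem IsTest.memLp {φ : E d → ℝ} (hφ : IsTest Ω φ) (p : ℝ≥0∞) : MemLp φ p (vol Ω) :=
  (hφ.1.continuous.memLp_of_hasCompactSupport hφ.2.1).restrict Ω

theorem IsTest.memLp_cd {φ : E d → ℝ} (hφ : IsTest Ω φ) (j : Fin d) (p : ℝ≥0∞) :
    MemLp (cd j φ) p (vol Ω) :=
  ((hφ.continuous_cd j).memLp_of_hasCompactSupport (hφ.hasCompactSupport_cd j)).restrict Ω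

theorem cd_mul {φ ψ : E d → ℝ} (hφ : Differentiable ℝ φ) (hψ : Differentiable ℝ ψ) (j : Fin d)
    (x : E d) : cd j (fun y => φ y * ψ y) x = φ x * cd j ψ x + ψ x * cd j φ x := by
  simp only [cd]
  rw [fderiv_fun_mul (hφ x) (hψ x)]
  simp

theorem cd_sub {φ ψ : E d → ℝ} (hφ : Differentiable ℝ φ) (hψ : Differentiable ℝ ψ) (j : Fin d)
    (x : E d) : cd j (fun y => φ y - ψ y) x = cd j φ x - cd j ψ x := by
  simp only [cd]
  rw [fderiv_fun_sub (hφ x) (hψ x)]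
  simp

/-! ### Weak derivatives -/

theorem hasWeakDeriv_of_memLp (hΩb : Bornology.IsBounded Ω) {j : Fin d} {f g : E d → ℝ}
    {p q : ℝ≥0∞} (hp : 1 ≤ p) (hq : 1 ≤ q) (hf : MemLp f p (vol Ω)) (hg : MemLp g q (vol Ω))
    (h : ∀ φ : E d → ℝ, IsTest Ω φ → ∫ x in Ω, f x * cd j φ x = - ∫ x in Ω, g x * φ x) :
    HasWeakDeriv Ω j f g := by
  have := isFiniteMeasure_vol hΩb
  exact ⟨IntegrableOn.locallyIntegrableOn (hf.integrable hp),
    IntegrableOn.locallyIntegrableOn (hg.integrable hq), h⟩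

/-- The fundamental lemma of the calculus of variations, applied to g - g'. Allowing f and f' to
differ on a null set matters later, since the scheme fixes its fields only almost everywhere. -/
theorem HasWeakDeriv.unique (hΩo : IsOpen Ω) {j : Fin d} {f f' g g' : E d → ℝ}
    (h : HasWeakDeriv Ω j f g) (h' : HasWeakDeriv Ω j f' g') (e : f =ᵐ[vol Ω] f') :
    g =ᵐ[vol Ω] g' := by
  have hl : LocallyIntegrableOn (fun x => g x - g' x) Ω := h.2.1.sub h'.2.1
  have intg : ∀ {g : E d → ℝ} {φ : E d → ℝ}, LocallyIntegrableOn g Ω → IsTest Ω φ →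
      IntegrableOn (fun x => g x * φ x) Ω := by
    intro g φ hg hφ
    have h1 : IntegrableOn g (tsupport φ) := hg.integrableOn_compact_subset hφ.2.2 hφ.2.1
    obtain ⟨C, hC⟩ := hφ.1.continuous.bounded_above_of_compact_support hφ.2.1
    have h2 : IntegrableOn (fun x => g x * φ x) (tsupport φ) :=
      h1.mul_bdd (c := C) hφ.1.continuous.aestronglyMeasurable (Eventually.of_forall hC)
    refine (h2.integrable_of_forall_notMem_eq_zero fun x hx => ?_).integrableOn
    rw [image_eq_zero_of_notMem_tsupport hx, mul_zero]
  have := hΩo.ae_eq_zero_of_integral_contDiff_smul_eq_zero (μ := volume) hl fun φ h1 h2 h3 => by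
    have ht : IsTest Ω φ := ⟨h1, h2, h3⟩
    have e1 := h.2.2 φ ht
    have e2 := h'.2.2 φ ht
    have e3 : ∫ x in Ω, f x * cd j φ x = ∫ x in Ω, f' x * cd j φ x :=
      integral_congr_ae (by filter_upwards [e] with x hx; rw [hx])
    have e4 : ∫ x in Ω, φ x • (g x - g' x) = 0 := by
      have : ∀ x, φ x • (g x - g' x) = g x * φ x - g' x * φ x := fun x => by
        simp only [smul_eq_mul]; ring
      simp only [this]
      rw [integral_sub (intg h.2.1 ht) (intg h'.2.1 ht)]
      linarith
    rw [← e4, setIntegral_eq_integral_of_forall_compl_eq_zero]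
    intro x hx
    rw [image_eq_zero_of_notMem_tsupport (fun hx' => hx (h3 hx')), zero_smul]
  rw [EventuallyEq, ae_restrict_iff' hΩo.measurableSet]
  filter_upwards [this] with x hx hxΩ
  linarith [hx hxΩ]

theorem hasWeakDeriv_wd {j : Fin d} {f : E d → ℝ} (h : ∃ g, HasWeakDeriv Ω j f g) :
    HasWeakDeriv Ω j f (wd Ω j f) := by
  rw [wd, dif_pos h]
  exact h.choose_spec

theorem HasWeakDeriv.wd_eq (hΩo : IsOpen Ω) {j : Fin d} {f g : E d → ℝ}
    (h : HasWeakDeriv Ω j f g) : wd Ω j f =ᵐ[vol Ω] g :=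
  (hasWeakDeriv_wd ⟨g, h⟩).unique hΩo h (ae_eq_refl _)

theorem HasWeakDeriv.congr_ae {j : Fin d} {f f' g : E d → ℝ} (hΩo : IsOpen Ω)
    (h : HasWeakDeriv Ω j f g) (e : f =ᵐ[vol Ω] f') : HasWeakDeriv Ω j f' g := by
  refine ⟨?_, h.2.1, fun φ hφ => ?_⟩
  · have h1 := h.1
    rw [locallyIntegrableOn_iff hΩo.isLocallyClosed] at h1 ⊢
    intro k hk hkc
    exact (h1 k hk hkc).congr_fun_ae (ae_restrict_of_ae_restrict_of_subset hk e)
  · rw [← h.2.2 φ hφ]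
    exact integral_congr_ae (by filter_upwards [e] with x hx; rw [hx])

theorem MemW1.of_hasWeakDeriv (hΩo : IsOpen Ω) {q : ℝ≥0∞} {f : E d → ℝ} {g : Fin d → E d → ℝ}
    (hf : MemLp f q (vol Ω)) (hg : ∀ j, MemLp (g j) q (vol Ω))
    (h : ∀ j, HasWeakDeriv Ω j f (g j)) : MemW1 Ω q f :=
  ⟨hf, fun j => ⟨⟨g j, h j⟩, (hg j).ae_eq ((h j).wd_eq hΩo).symm⟩⟩

theorem MemW1.congr_ae (hΩo : IsOpen Ω) {q : ℝ≥0∞} {f f' : E d → ℝ} (h : MemW1 Ω q f)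
    (e : f =ᵐ[vol Ω] f') : MemW1 Ω q f' :=
  MemW1.of_hasWeakDeriv hΩo (h.1.ae_eq e) (fun j => (h.2 j).2)
    fun j => (hasWeakDeriv_wd (h.2 j).1).congr_ae hΩo e

theorem MemW1.hasWeakDeriv_sub (hΩb : Bornology.IsBounded Ω) {f f' : E d → ℝ}
    (h : MemW1 Ω 2 f) (h' : MemW1 Ω 2 f') (j : Fin d) :
    HasWeakDeriv Ω j (fun x => f x - f' x) (fun x => wd Ω j f x - wd Ω j f' x) := by
  refine hasWeakDeriv_of_memLp hΩb one_le_two one_le_two (h.1.sub h'.1)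
    ((h.2 j).2.sub (h'.2 j).2) fun φ hφ => ?_
  have e1 := (hasWeakDeriv_wd (h.2 j).1).2.2 φ hφ
  have e2 := (hasWeakDeriv_wd (h'.2 j).1).2.2 φ hφ
  simp only [sub_mul]
  rw [integral_sub (MemLp.integrable_mul_two h.1 (hφ.memLp_cd j 2))
      (MemLp.integrable_mul_two h'.1 (hφ.memLp_cd j 2)),
    integral_sub (MemLp.integrable_mul_two (h.2 j).2 (hφ.memLp 2))
      (MemLp.integrable_mul_two (h'.2 j).2 (hφ.memLp 2)), e1, e2]
  ring

theorem MemW1.wd_sub (hΩo : IsOpen Ω) (hΩb : Bornology.IsBounded Ω) {f f' : E d → ℝ}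
    (h : MemW1 Ω 2 f) (h' : MemW1 Ω 2 f') (j : Fin d) :
    wd Ω j (fun x => f x - f' x) =ᵐ[vol Ω] fun x => wd Ω j f x - wd Ω j f' x :=
  (h.hasWeakDeriv_sub hΩb h' j).wd_eq hΩo

/-! ### The space `H¹₀` -/

theorem MemH10.exists_seq {f : E d → ℝ} (h : MemH10 Ω f) :
    ∃ φ : ℕ → E d → ℝ, (∀ k, IsTest Ω (φ k)) ∧ LpLim (vol Ω) 2 φ f ∧
      ∀ j, LpLim (vol Ω) 2 (fun k => cd j (φ k)) (wd Ω j f) := by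
  obtain ⟨h1, φ, ht, h2, h3⟩ := h
  exact ⟨φ, ht, ⟨fun k => (ht k).memLp 2, h1.1, h2⟩,
    fun j => ⟨fun k => (ht k).memLp_cd j 2, (h1.2 j).2, h3 j⟩⟩

theorem MemH10.of_seq (hΩo : IsOpen Ω) {f : E d → ℝ} {g : Fin d → E d → ℝ}
    (hw : ∀ j, HasWeakDeriv Ω j f (g j)) {φ : ℕ → E d → ℝ} (ht : ∀ k, IsTest Ω (φ k))
    (hf : LpLim (vol Ω) 2 φ f) (hg : ∀ j, LpLim (vol Ω) 2 (fun k => cd j (φ k)) (g j)) :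
    MemH10 Ω f :=
  ⟨MemW1.of_hasWeakDeriv hΩo hf.lim_mem (fun j => (hg j).lim_mem) hw, φ, ht, hf.tendsto,
    fun j => ((hg j).congr_lim ((hw j).wd_eq hΩo).symm).tendsto⟩

theorem MemH10.sub (hΩo : IsOpen Ω) (hΩb : Bornology.IsBounded Ω) {f f' : E d → ℝ}
    (h : MemH10 Ω f) (h' : MemH10 Ω f') : MemH10 Ω (fun x => f x - f' x) := by
  obtain ⟨φ, ht, h1, h2⟩ := h.exists_seq
  obtain ⟨φ', ht', h1', h2'⟩ := h'.exists_seq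
  refine MemH10.of_seq hΩo (fun j => h.1.hasWeakDeriv_sub hΩb h'.1 j)
    (φ := fun k x => φ k x - φ' k x) (fun k => (ht k).sub (ht' k)) (h1.sub one_le_two h1')
    fun j => ((h2 j).sub one_le_two (h2' j)).congr_seq fun k => Eventually.of_forall fun x => ?_
  exact (cd_sub (ht k).differentiable (ht' k).differentiable j x).symm

/-- Product of a bounded Lipschitz function and an `H¹₀` function. -/
theorem MemH10.hasWeakDeriv_mul (hΩb : Bornology.IsBounded Ω) {a f : E d → ℝ}
    (ha : MemW1 Ω ∞ a) (hf : MemH10 Ω f) (j : Fin d) :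
    HasWeakDeriv Ω j (fun x => a x * f x) (fun x => a x * wd Ω j f x + wd Ω j a x * f x) := by
  have m1 : MemLp (fun x => a x * wd Ω j f x) 2 (vol Ω) := (hf.1.2 j).2.mul' ha.1
  have m2 : MemLp (fun x => wd Ω j a x * f x) 2 (vol Ω) := hf.1.1.mul' (ha.2 j).2
  refine hasWeakDeriv_of_memLp hΩb one_le_two one_le_two (hf.1.1.mul' ha.1) (m1.add m2)
    fun φ hφ => ?_
  obtain ⟨ψ, ht, h1, h2⟩ := hf.exists_seq
  have L1 : LpLim (vol Ω) 1 (fun k x => a x * (ψ k x * cd j φ x)) (fun x => a x * (f x * cd j φ x)) :=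
    LpLim.mul (p := ∞) (q := 1) le_rfl (LpLim.const ha.1)
      (h1.mul (p := 2) (q := 2) le_rfl (LpLim.const (hφ.memLp_cd j 2)))
  have L2 : LpLim (vol Ω) 1 (fun k x => a x * (cd j (ψ k) x * φ x)) (fun x => a x * (wd Ω j f x * φ x)) :=
    LpLim.mul (p := ∞) (q := 1) le_rfl (LpLim.const ha.1)
      ((h2 j).mul (p := 2) (q := 2) le_rfl (LpLim.const (hφ.memLp 2)))
  have L3 : LpLim (vol Ω) 1 (fun k x => wd Ω j a x * (ψ k x * φ x)) (fun x => wd Ω j a x * (f x * φ x)) :=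
    LpLim.mul (p := ∞) (q := 1) le_rfl (LpLim.const (ha.2 j).2)
      (h1.mul (p := 2) (q := 2) le_rfl (LpLim.const (hφ.memLp 2)))
  -- The product `ψ k * φ` is a test function for the weak derivative of a. The resulting identity
  -- is stable under convergence of `ψ k` to f in H¹.
  have key : ∀ k, ∫ x in Ω, (a x * (ψ k x * cd j φ x) + a x * (cd j (ψ k) x * φ x))
      + wd Ω j a x * (ψ k x * φ x) = 0 := by
    intro k
    have e := (hasWeakDeriv_wd (ha.2 j).1).2.2 _ ((ht k).mul hφ)
    have i1 := memLp_one_iff_integrable.1 (L1.mem k)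
    have i2 := memLp_one_iff_integrable.1 (L2.mem k)
    have i3 := memLp_one_iff_integrable.1 (L3.mem k)
    have c : ∫ x in Ω, a x * cd j (fun x => ψ k x * φ x) x
        = (∫ x in Ω, a x * (ψ k x * cd j φ x)) + ∫ x in Ω, a x * (cd j (ψ k) x * φ x) := by
      rw [← integral_add i1 i2]
      refine integral_congr_ae (Eventually.of_forall fun x => ?_)
      dsimp only
      rw [cd_mul (ht k).differentiable hφ.differentiable]
      ring
    rw [integral_add_three i1 i2 i3]
    linarith
  have lim := ((L1.add le_rfl L2).add le_rfl L3).tendsto_integral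
  simp only [key] at lim
  have e0 := tendsto_nhds_unique lim tendsto_const_nhds
  have i1 := memLp_one_iff_integrable.1 L1.lim_mem
  have i2 := memLp_one_iff_integrable.1 L2.lim_mem
  have i3 := memLp_one_iff_integrable.1 L3.lim_mem
  rw [integral_add_three i1 i2 i3] at e0
  have c1 : ∫ x in Ω, a x * f x * cd j φ x = ∫ x in Ω, a x * (f x * cd j φ x) := by
    simp only [mul_assoc]
  have c2 : ∫ x in Ω, (a x * wd Ω j f x + wd Ω j a x * f x) * φ x
      = (∫ x in Ω, a x * (wd Ω j f x * φ x)) + ∫ x in Ω, wd Ω j a x * (f x * φ x) := by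
    rw [← integral_add i2 i3]
    exact integral_congr_ae (Eventually.of_forall fun x => by ring)
  rw [c1, c2]
  linarith

/-! ### The embedding of `H¹₀` in `L⁴` -/

theorem norm_fderiv_le_sum_cd (φ : E d → ℝ) (x : E d) : ‖fderiv ℝ φ x‖ ≤ ∑ j, ‖cd j φ x‖ := by
  refine ContinuousLinearMap.opNorm_le_bound _ (Finset.sum_nonneg fun _ _ => norm_nonneg _)
    fun v => ?_
  have hv : v = ∑ j, v j • EuclideanSpace.single j (1 : ℝ) := by
    ext i
    simp [Finset.sum_apply, Pi.single_apply]
  conv_lhs => rw [hv, map_sum]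
  refine (norm_sum_le _ _).trans ?_
  rw [Finset.sum_mul]
  refine Finset.sum_le_sum fun j _ => ?_
  rw [map_smul, norm_smul, mul_comm]
  exact mul_le_mul_of_nonneg_left (PiLp.norm_apply_le v j) (norm_nonneg _)

/-- Gagliardo–Nirenberg–Sobolev with exponent 12/7. It is the critical exponent for L⁴ when d = 3,
as 7/12 - 1/3 = 1/4, and subcritical when d = 2. It lies strictly below d in both cases, which 2
would not for d = 2, and below 2, so that an L² bound of the gradient suffices on a bounded set. -/
theorem exists_eLpNorm_four_le_eLpNorm_fderiv (hd : d = 2 ∨ d = 3)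
    (hΩb : Bornology.IsBounded Ω) :
    ∃ C : ℝ≥0, ∀ φ : E d → ℝ, IsTest Ω φ →
      eLpNorm φ 4 volume ≤ C * eLpNorm (fderiv ℝ φ) ((12 / 7 : ℝ≥0) : ℝ≥0∞) volume := by
  refine ⟨eLpNormLESNormFDerivOfLeConst ℝ (volume : Measure (E d)) Ω (12 / 7) 4, fun φ hφ => ?_⟩
  have h1le : (1 : ℝ≥0) ≤ 12 / 7 := by
    rw [le_div_iff₀ (by norm_num)]
    norm_num
  have hlt : (12 / 7 : ℝ≥0) < Module.finrank ℝ (E d) := by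
    rw [finrank_euclideanSpace_fin, div_lt_iff₀ (by norm_num)]
    rcases hd with rfl | rfl <;> norm_num
  have hq : ((12 / 7 : ℝ≥0) : ℝ)⁻¹ - (Module.finrank ℝ (E d) : ℝ)⁻¹ ≤ ((4 : ℝ≥0) : ℝ)⁻¹ := by
    rw [finrank_euclideanSpace_fin]
    rcases hd with rfl | rfl <;> norm_num
  have := eLpNorm_le_eLpNorm_fderiv_of_le (μ := (volume : Measure (E d))) (u := φ) (s := Ω)
    (hφ.1.of_le (by simp)) ((subset_tsupport φ).trans hφ.2.2) h1le hlt hq hΩb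
  rwa [ENNReal.coe_ofNat] at this

theorem exists_eLpNorm_fderiv_le (hΩb : Bornology.IsBounded Ω) {p : ℝ≥0∞} (hp1 : 1 ≤ p)
    (hp : p ≤ 2) :
    ∃ C : ℝ≥0∞, C ≠ ⊤ ∧ ∀ φ : E d → ℝ, IsTest Ω φ →
      eLpNorm (fderiv ℝ φ) p volume ≤ C * ∑ j, eLpNorm (cd j φ) 2 (vol Ω) := by
  have := isFiniteMeasure_vol hΩb
  have hp0 : p ≠ ⊤ := (hp.trans_lt (by simp)).ne
  refine ⟨vol Ω univ ^ (1 / p.toReal - 1 / (2 : ℝ≥0∞).toReal),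
    ENNReal.rpow_ne_top_of_nonneg ?_ (measure_ne_top _ _), fun φ hφ => ?_⟩
  · rw [sub_nonneg]
    refine one_div_le_one_div_of_le ?_ (ENNReal.toReal_mono (by simp) hp)
    exact ENNReal.toReal_pos (zero_lt_one.trans_le hp1).ne' hp0
  have e1 : eLpNorm (fderiv ℝ φ) p volume ≤ eLpNorm (∑ j, fun x => ‖cd j φ x‖) p volume := by
    refine eLpNorm_mono_real fun x => ?_
    rw [Finset.sum_apply]
    exact norm_fderiv_le_sum_cd φ x
  refine e1.trans ((eLpNorm_sum_le
    (fun j _ => (hφ.continuous_cd j).aestronglyMeasurable.norm) hp1).trans ?_)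
  rw [Finset.mul_sum]
  refine Finset.sum_le_sum fun j _ => ?_
  have hs : Function.support (cd j φ) ⊆ Ω :=
    (subset_tsupport _).trans ((tsupport_fderiv_apply_subset ℝ _).trans hφ.2.2)
  rw [eLpNorm_norm, mul_comm, ← eLpNorm_restrict_eq_of_support_subset hs]
  exact eLpNorm_le_eLpNorm_mul_rpow_measure_univ hp (hφ.memLp_cd j 2).1

theorem exists_eLpNorm_four_le (hd : d = 2 ∨ d = 3) (hΩb : Bornology.IsBounded Ω) :
    ∃ C : ℝ≥0∞, C ≠ ⊤ ∧ ∀ φ : E d → ℝ, IsTest Ω φ →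
      eLpNorm φ 4 (vol Ω) ≤ C * ∑ j, eLpNorm (cd j φ) 2 (vol Ω) := by
  have h1le : (1 : ℝ≥0) ≤ 12 / 7 := by
    rw [le_div_iff₀ (by norm_num)]
    norm_num
  have hle : (12 / 7 : ℝ≥0) ≤ 2 := by
    rw [div_le_iff₀ (by norm_num)]
    norm_num
  obtain ⟨C, hC⟩ := exists_eLpNorm_four_le_eLpNorm_fderiv hd hΩb
  obtain ⟨C', hC', h'⟩ := exists_eLpNorm_fderiv_le (d := d) hΩb
    (p := ((12 / 7 : ℝ≥0) : ℝ≥0∞)) (by exact_mod_cast h1le) (by exact_mod_cast hle)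
  refine ⟨C * C', ENNReal.mul_ne_top ENNReal.coe_ne_top hC', fun φ hφ => ?_⟩
  refine (eLpNorm_mono_measure _ Measure.restrict_le_self).trans ((hC φ hφ).trans ?_)
  rw [mul_assoc]
  exact mul_le_mul_of_nonneg_left (h' φ hφ) zero_le

/-- The embedding makes the approximating test functions Cauchy in L⁴. Their limit is identified by
Fatou's lemma along a subsequence converging almost everywhere, which also gives the rate C·`δ k`.
-/
theorem MemH10.exists_seq_four (hd : d = 2 ∨ d = 3) (hΩb : Bornology.IsBounded Ω) {f : E d → ℝ} (h : MemH10 Ω f) :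
    ∃ φ : ℕ → E d → ℝ, (∀ k, IsTest Ω (φ k)) ∧ LpLim (vol Ω) 2 φ f ∧
      (∀ j, LpLim (vol Ω) 2 (fun k => cd j (φ k)) (wd Ω j f)) ∧ LpLim (vol Ω) 4 φ f := by
  obtain ⟨φ, ht, h1, h2⟩ := h.exists_seq
  refine ⟨φ, ht, h1, h2, ?_⟩
  obtain ⟨C, hC, hgns⟩ := exists_eLpNorm_four_le hd hΩb
  set δ : ℕ → ℝ≥0∞ := fun k => ∑ j, eLpNorm (fun x => cd j (φ k) x - wd Ω j f x) 2 (vol Ω) with hδ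
  have hδ0 : Tendsto δ atTop (𝓝 0) := by
    have := tendsto_finsetSum Finset.univ fun j (_ : j ∈ Finset.univ) => (h2 j).tendsto
    simpa using this
  have hδf : ∀ k, δ k ≠ ⊤ := fun k => by
    refine (ENNReal.sum_lt_top.2 fun j _ => ?_).ne
    exact (((h2 j).mem k).sub (h2 j).lim_mem).2
  have hdiff : ∀ k m, eLpNorm (fun x => φ k x - φ m x) 4 (vol Ω) ≤ C * (δ k + δ m) := by
    intro k m
    refine (hgns _ ((ht k).sub (ht m))).trans (mul_le_mul_of_nonneg_left ?_ zero_le)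
    simp only [hδ]
    rw [← Finset.sum_add_distrib]
    refine Finset.sum_le_sum fun j _ => ?_
    have e : cd j (fun x => φ k x - φ m x)
        = (fun x => cd j (φ k) x - wd Ω j f x) - (fun x => cd j (φ m) x - wd Ω j f x) := by
      ext x
      rw [cd_sub (ht k).differentiable (ht m).differentiable]
      simp
    rw [e]
    exact eLpNorm_sub_le (((h2 j).mem k).sub (h2 j).lim_mem).1
      (((h2 j).mem m).sub (h2 j).lim_mem).1 one_le_two
  obtain ⟨ns, hns, hae⟩ := (tendstoInMeasure_of_tendsto_eLpNorm (p := 2) two_ne_zero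
    (fun k => (h1.mem k).1) h1.lim_mem.1 h1.tendsto).exists_seq_tendsto_ae
  have hlim : ∀ k, eLpNorm (fun x => φ k x - f x) 4 (vol Ω) ≤ C * δ k := by
    intro k
    have e1 := Lp.eLpNorm_lim_le_liminf_eLpNorm (p := 4)
      (f := fun i x => φ k x - φ (ns i) x) (μ := vol Ω)
      (fun i => ((h1.mem k).sub (h1.mem (ns i))).1) (fun x => φ k x - f x)
      (by filter_upwards [hae] with x hx; exact hx.const_sub _)
    refine e1.trans ((liminf_le_liminf (Eventually.of_forall fun i => hdiff k (ns i))).trans ?_)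
    refine le_of_eq (Tendsto.liminf_eq ?_)
    have := ENNReal.Tendsto.const_mul (a := C)
      ((tendsto_const_nhds (x := δ k)).add (hδ0.comp hns.tendsto_atTop)) (Or.inr hC)
    simpa using this
  have m4 : MemLp f 4 (vol Ω) := by
    have n1 : MemLp (fun x => φ 0 x - f x) 4 (vol Ω) :=
      ⟨((h1.mem 0).sub h1.lim_mem).1,
        (hlim 0).trans_lt (ENNReal.mul_lt_top hC.lt_top (hδf 0).lt_top)⟩
    have n2 := ((ht 0).memLp 4).sub n1
    refine n2.ae_eq (Eventually.of_forall fun x => ?_)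
    simp
  refine ⟨fun k => (ht k).memLp 4, m4, ?_⟩
  refine tendsto_of_tendsto_of_tendsto_of_le_of_le tendsto_const_nhds ?_ (fun _ => zero_le) hlim
  simpa using ENNReal.Tendsto.const_mul (a := C) hδ0 (Or.inr hC)

theorem MemH10.memLp_four (hd : d = 2 ∨ d = 3) (hΩb : Bornology.IsBounded Ω) {f : E d → ℝ} (h : MemH10 Ω f) : MemLp f 4 (vol Ω) := by
  obtain ⟨_, -, -, -, h4⟩ := h.exists_seq_four hd hΩb
  exact h4.lim_mem

theorem Integrable.mul_top {α : Type*} [MeasurableSpace α] {μ : Measure α} {a f : α → ℝ}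
    (ha : MemLp a ∞ μ) (hf : Integrable f μ) : Integrable (fun x => a x * f x) μ :=
  memLp_one_iff_integrable.1 ((memLp_one_iff_integrable.2 hf).mul' ha)

/-- Integral of the derivative of a product with three factors in `H¹₀`. -/
theorem integral_deriv_mul_mul_mul (hd : d = 2 ∨ d = 3) (hΩb : Bornology.IsBounded Ω) {a f g h : E d → ℝ} (ha : MemW1 Ω ∞ a) (hf : MemH10 Ω f)
    (hg : MemH10 Ω g) (hh : MemH10 Ω h) (j : Fin d) :
    Integrable (fun x => a x * (f x * g x * wd Ω j h x + f x * h x * wd Ω j g x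
      + g x * h x * wd Ω j f x) + wd Ω j a x * (f x * g x * h x)) (vol Ω) ∧
    ∫ x in Ω, (a x * (f x * g x * wd Ω j h x + f x * h x * wd Ω j g x
      + g x * h x * wd Ω j f x) + wd Ω j a x * (f x * g x * h x)) = 0 := by
  have := isFiniteMeasure_vol hΩb
  obtain ⟨φ, tf, -, f2, f4⟩ := hf.exists_seq_four hd hΩb
  obtain ⟨ψ, tg, -, g2, g4⟩ := hg.exists_seq_four hd hΩb
  obtain ⟨χ, th, h1, h2, h4⟩ := hh.exists_seq_four hd hΩb
  -- Each product with a derivative has two factors converging in L⁴ and the derivative converging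
  -- in L², so its limit holds in L¹. The statement for test functions is the weak derivative of a
  -- against a product of three of them.
  have L1 : LpLim (vol Ω) 1 (fun k x => φ k x * ψ k x * cd j (χ k) x)
      (fun x => f x * g x * wd Ω j h x) :=
    ((f4.mul (r := 2) one_le_two g4).mul (q := 2) le_rfl (h2 j))
  have L2 : LpLim (vol Ω) 1 (fun k x => φ k x * χ k x * cd j (ψ k) x)
      (fun x => f x * h x * wd Ω j g x) :=
    ((f4.mul (r := 2) one_le_two h4).mul (q := 2) le_rfl (g2 j))
  have L3 : LpLim (vol Ω) 1 (fun k x => ψ k x * χ k x * cd j (φ k) x)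
      (fun x => g x * h x * wd Ω j f x) :=
    ((g4.mul (r := 2) one_le_two h4).mul (q := 2) le_rfl (f2 j))
  have L4 : LpLim (vol Ω) 1 (fun k x => φ k x * ψ k x * χ k x) (fun x => f x * g x * h x) :=
    ((f4.mul (r := 2) one_le_two g4).mul (q := 2) le_rfl h1)
  have L5 : LpLim (vol Ω) 1 (fun k x => a x * (φ k x * ψ k x * cd j (χ k) x
      + φ k x * χ k x * cd j (ψ k) x + ψ k x * χ k x * cd j (φ k) x))
      (fun x => a x * (f x * g x * wd Ω j h x + f x * h x * wd Ω j g x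
        + g x * h x * wd Ω j f x)) :=
    LpLim.mul (p := ∞) (q := 1) le_rfl (LpLim.const ha.1)
      ((L1.add le_rfl L2).add le_rfl L3)
  have L6 : LpLim (vol Ω) 1 (fun k x => wd Ω j a x * (φ k x * ψ k x * χ k x))
      (fun x => wd Ω j a x * (f x * g x * h x)) :=
    LpLim.mul (p := ∞) (q := 1) le_rfl (LpLim.const (ha.2 j).2) L4
  have key : ∀ k, ∫ x in Ω, (a x * (φ k x * ψ k x * cd j (χ k) x
      + φ k x * χ k x * cd j (ψ k) x + ψ k x * χ k x * cd j (φ k) x)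
      + wd Ω j a x * (φ k x * ψ k x * χ k x)) = 0 := by
    intro k
    have e := (hasWeakDeriv_wd (ha.2 j).1).2.2 _ (((tf k).mul (tg k)).mul (th k))
    rw [integral_add (memLp_one_iff_integrable.1 (L5.mem k))
      (memLp_one_iff_integrable.1 (L6.mem k)), ← sub_neg_eq_add, ← e, sub_eq_zero]
    refine integral_congr_ae (Eventually.of_forall fun x => ?_)
    dsimp only
    rw [cd_mul ((tf k).mul (tg k)).differentiable (th k).differentiable,
      cd_mul (tf k).differentiable (tg k).differentiable]
    ring
  have L7 := L5.add le_rfl L6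
  have lim := L7.tendsto_integral
  simp only [key] at lim
  exact ⟨memLp_one_iff_integrable.1 L7.lim_mem, tendsto_nhds_unique lim tendsto_const_nhds⟩

/-- A linear functional on `H¹₀` with square integrable coefficients vanishes as soon as it vanishes
on the test functions. -/
theorem integral_eq_zero_of_isTest {a : Fin d → E d → ℝ} {b : Fin d → Fin d → E d → ℝ}
    (ha : ∀ i, MemLp (a i) 2 (vol Ω)) (hb : ∀ i j, MemLp (b i j) 2 (vol Ω))
    (h : ∀ φ : Fin d → E d → ℝ, (∀ i, IsTest Ω (φ i)) →
      ∫ x in Ω, ∑ i, (a i x * φ i x + ∑ j, b i j x * cd j (φ i) x) = 0)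
    {v : E d → E d} (hv : MemH10v Ω v) :
    Integrable (fun x => ∑ i, (a i x * v x i + ∑ j, b i j x * gradv Ω v i j x)) (vol Ω) ∧
    ∫ x in Ω, ∑ i, (a i x * v x i + ∑ j, b i j x * gradv Ω v i j x) = 0 := by
  choose φ ht h1 h2 using fun i => (hv i).exists_seq
  have L : LpLim (vol Ω) 1
      (fun k x => ∑ i, (a i x * φ i k x + ∑ j, b i j x * cd j (φ i k) x))
      (fun x => ∑ i, (a i x * v x i + ∑ j, b i j x * gradv Ω v i j x)) := by
    refine LpLim.finset_sum _ le_rfl fun i _ => LpLim.add le_rfl ?_ ?_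
    · exact LpLim.mul (p := 2) (q := 2) le_rfl (LpLim.const (ha i)) (h1 i)
    · refine LpLim.finset_sum _ le_rfl fun j _ => ?_
      exact LpLim.mul (p := 2) (q := 2) le_rfl (LpLim.const (hb i j)) (h2 i j)
  have lim := L.tendsto_integral
  have key := fun k => h (fun i => φ i k) fun i => ht i k
  simp only [key] at lim
  exact ⟨memLp_one_iff_integrable.1 L.lim_mem, tendsto_nhds_unique lim tendsto_const_nhds⟩

end Sobolev

/-! ### Essential range of a function with bounded weak gradient -/

section EssentialRange

open scoped Convolution

variable {d : ℕ} {Ω : Set (E d)}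

theorem ae_abs_le_of_memLp_top {f : E d → ℝ} (hf : MemLp f ∞ (vol Ω)) :
    ∃ K : ℝ, 0 ≤ K ∧ ∀ᵐ x ∂(vol Ω), |f x| ≤ K := by
  refine ⟨(eLpNorm f ∞ (vol Ω)).toReal, ENNReal.toReal_nonneg, ?_⟩
  have h := ae_le_eLpNormEssSup (f := f) (μ := vol Ω)
  filter_upwards [h] with x hx
  rw [← eLpNorm_exponent_top] at hx
  have := ENNReal.toReal_mono hf.2.ne hx
  simpa using this

theorem isTest_comp_const_sub {φ : E d → ℝ} (h1 : ContDiff ℝ ∞ φ) {r : ℝ} {x : E d}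
    (h2 : tsupport φ ⊆ Metric.closedBall 0 r) (h3 : Metric.closedBall x r ⊆ Ω) :
    IsTest Ω (fun t => φ (x - t)) := by
  have hs : tsupport (fun t => φ (x - t)) ⊆ Metric.closedBall x r := by
    refine closure_minimal (fun t ht => ?_) Metric.isClosed_closedBall
    have := h2 (subset_tsupport φ (show x - t ∈ Function.support φ from ht))
    rw [mem_closedBall_zero_iff] at this
    rw [Metric.mem_closedBall, dist_comm, dist_eq_norm]
    exact this
  exact ⟨h1.comp (contDiff_const.sub contDiff_id),
    (isCompact_closedBall x r).of_isClosed_subset (isClosed_tsupport _) hs, hs.trans h3⟩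

theorem cd_comp_const_sub {φ : E d → ℝ} (h1 : Differentiable ℝ φ) (x t : E d) (j : Fin d) :
    cd j (fun t => φ (x - t)) t = - cd j φ (x - t) := by
  have h : HasFDerivAt (fun t => φ (x - t))
      ((fderiv ℝ φ (x - t)).comp (-(ContinuousLinearMap.id ℝ (E d)))) t := by
    have h2 : HasFDerivAt (fun t : E d => x - t) (-(ContinuousLinearMap.id ℝ (E d))) t :=
      (hasFDerivAt_id t).const_sub x
    exact (h1 (x - t)).hasFDerivAt.comp t h2
  simp only [cd]
  rw [h.fderiv]
  simp

/-- A function in `W^{1,∞}` is almost everywhere locally Lipschitz. -/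
theorem MemW1.locally_lipschitz (hΩo : IsOpen Ω) (hΩb : Bornology.IsBounded Ω) {f : E d → ℝ}
    (hf : MemW1 Ω ∞ f) :
    ∃ L : ℝ, 0 ≤ L ∧ ∃ S : Set (E d), (∀ᵐ x, x ∈ S) ∧ ∀ x₀ ∈ Ω, ∃ R > 0, Metric.ball x₀ R ⊆ Ω ∧
      ∀ x ∈ S ∩ Metric.ball x₀ R, ∀ y ∈ S ∩ Metric.ball x₀ R, |f x - f y| ≤ L * dist x y := by
  have := isFiniteMeasure_vol hΩb
  choose K hK0 hK using fun j => ae_abs_le_of_memLp_top (hf.2 j).2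
  have hL0 : 0 ≤ ∑ j, K j := Finset.sum_nonneg fun j _ => hK0 j
  -- Extension by zero, so that mollification makes sense everywhere. The jump at the boundary is
  -- harmless: the kernels used below are supported inside Ω.
  let g : E d → ℝ := Ω.indicator f
  have hgi : Integrable g := (integrable_indicator_iff hΩo.measurableSet).2 (hf.1.integrable le_top)
  -- Outer and inner radii keep the ratio 2, so the kernels are comparable to averages over balls
  -- and Lebesgue differentiation gives convergence almost everywhere.
  let φ : ℕ → ContDiffBump (0 : E d) := fun n =>
    ⟨1 / ((n : ℝ) + 1), 2 / ((n : ℝ) + 1), by positivity, by gcongr; norm_num⟩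
  have hφ : Tendsto (fun n => (φ n).rOut) atTop (𝓝 0) := by
    have := (tendsto_one_div_add_atTop_nhds_zero_nat (𝕜 := ℝ)).const_mul 2
    simp only [mul_zero] at this
    refine this.congr fun n => ?_
    show 2 * (1 / ((n : ℝ) + 1)) = 2 / ((n : ℝ) + 1)
    ring
  have hae := ContDiffBump.ae_convolution_tendsto_right_of_locallyIntegrable (K := 2)
    (μ := (volume : Measure (E d))) hφ
    (Eventually.of_forall fun n => by
      show 2 / ((n : ℝ) + 1) ≤ 2 * (1 / ((n : ℝ) + 1))
      exact le_of_eq (by ring)) hgi.locallyIntegrable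
  let ψ : ℕ → E d → ℝ := fun n => (φ n).normed volume
  have hψ1 : ∀ n, ContDiff ℝ ∞ (ψ n) := fun n => (φ n).contDiff_normed
  have hψs : ∀ n, tsupport (ψ n) ⊆ Metric.closedBall 0 (φ n).rOut := fun n => by
    simp only [ψ]
    rw [(φ n).tsupport_normed_eq]
  have hψc : ∀ n, HasCompactSupport (ψ n) := fun n => (φ n).hasCompactSupport_normed
  let F : ℕ → E d → ℝ := fun n => g ⋆[ContinuousLinearMap.mul ℝ ℝ, volume] (ψ n)
  have hF : ∀ n x, HasFDerivAt (F n) ((g ⋆[(ContinuousLinearMap.mul ℝ ℝ).precompR (E d), volume]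
      fderiv ℝ (ψ n)) x) x := fun n x =>
    (hψc n).hasFDerivAt_convolution_right _ hgi.locallyIntegrable ((hψ1 n).of_le (by simp)) x
  have hcd : ∀ n x j, cd j (F n) x = ∫ t in Ω, f t * cd j (ψ n) (x - t) := by
    intro n x j
    simp only [cd]
    rw [(hF n x).fderiv, convolution_precompR_apply _ hgi.locallyIntegrable
      ((hψc n).fderiv ℝ) ((hψ1 n).continuous_fderiv (by simp)), convolution_mul,
      ← integral_indicator hΩo.measurableSet]
    refine integral_congr_ae (Eventually.of_forall fun t => ?_)
    by_cases ht : t ∈ Ω <;> simp [g, ht]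
  -- S consists of the points where the mollifications converge; one set serves all centres x₀.
  refine ⟨∑ j, K j, hL0, {x | Tendsto (fun n => F n x) atTop (𝓝 (g x))}, ?_, fun x₀ hx₀ => ?_⟩
  · filter_upwards [hae] with x hx
    refine hx.congr fun n => ?_
    rw [convolution_lsmul_swap]
    show _ = ∫ t, g t * ψ n (x - t)
    refine integral_congr_ae (Eventually.of_forall fun t => ?_)
    simp only [smul_eq_mul, ψ]
    ring
  · obtain ⟨R, hR, hRs⟩ := Metric.isOpen_iff.1 hΩo x₀ hx₀
    have hsub : Metric.ball x₀ (R / 2) ⊆ Ω := (Metric.ball_subset_ball (by linarith)).trans hRs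
    refine ⟨R / 2, by linarith, hsub, ?_⟩
    rintro x ⟨hxS, hx⟩ y ⟨hyS, hy⟩
    have hgx : g x = f x := indicator_of_mem (hsub hx) f
    have hgy : g y = f y := indicator_of_mem (hsub hy) f
    rw [← hgx, ← hgy]
    refine le_of_tendsto ((hxS.sub hyS).abs) ?_
    have hev : ∀ᶠ n in atTop, (φ n).rOut < R / 2 := hφ.eventually_lt_const (by linarith)
    filter_upwards [hev] with n hn
    -- Well inside Ω the translated kernel is a test function, so a partial derivative of the
    -- mollification is an average of the weak one against a probability density. The bound is
    -- therefore uniform in n, and the mean value inequality passes to the limit on S.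
    have bound : ∀ z ∈ Metric.ball x₀ (R / 2), ‖fderiv ℝ (F n) z‖ ≤ ∑ j, K j := by
      intro z hz
      have hzΩ : Metric.closedBall z (φ n).rOut ⊆ Ω := by
        refine Subset.trans (fun w hw => ?_) hRs
        rw [Metric.mem_ball] at hz ⊢
        rw [Metric.mem_closedBall] at hw
        linarith [dist_triangle w z x₀]
      have ht := isTest_comp_const_sub (hψ1 n) (hψs n) hzΩ
      have hint : ∫ t in Ω, ψ n (z - t) = 1 := by
        rw [setIntegral_eq_integral_of_forall_compl_eq_zero fun t htΩ =>
          image_eq_zero_of_notMem_tsupport (fun h => htΩ (ht.2.2 h)),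
          integral_sub_left_eq_self (fun t => ψ n t) volume z]
        exact (φ n).integral_normed
      refine (norm_fderiv_le_sum_cd _ _).trans (Finset.sum_le_sum fun j _ => ?_)
      have e := (hasWeakDeriv_wd (hf.2 j).1).2.2 _ ht
      simp only [cd_comp_const_sub ((hψ1 n).differentiable (by simp)), mul_neg, integral_neg,
        neg_inj] at e
      rw [hcd, e]
      have i2 : Integrable (fun t => ψ n (z - t)) (vol Ω) := (ht.memLp 1).integrable le_rfl
      calc ‖∫ t in Ω, wd Ω j f t * ψ n (z - t)‖ ≤ ∫ t in Ω, K j * ψ n (z - t) := by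
            refine norm_integral_le_of_norm_le (i2.const_mul _) ?_
            filter_upwards [hK j] with t ht'
            have h0 : 0 ≤ ψ n (z - t) := (φ n).nonneg_normed _
            rw [norm_mul, Real.norm_eq_abs, Real.norm_eq_abs, abs_of_nonneg h0]
            exact mul_le_mul_of_nonneg_right ht' h0
        _ = K j := by rw [integral_const_mul, hint, mul_one]
    have := (convex_ball x₀ (R / 2)).norm_image_sub_le_of_norm_fderiv_le
      (fun z _ => (hF n z).differentiableAt) bound hy hx
    rwa [← dist_eq_norm x y] at this

theorem isOpen_setOf_locally_ae (P : E d → Prop) :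
    IsOpen {x | ∃ r > 0, ∀ᵐ y, y ∈ Metric.ball x r → P y} := by
  rw [Metric.isOpen_iff]
  rintro x ⟨r, hr, h⟩
  refine ⟨r / 2, by linarith, fun z hz => ⟨r / 2, by linarith, ?_⟩⟩
  filter_upwards [h] with y hy hyz
  apply hy
  rw [Metric.mem_ball] at *
  linarith [dist_triangle y z x]

/-- A locally null set is null, by second countability. -/
theorem ae_of_locally_ae (hΩo : IsOpen Ω) {P : E d → Prop}
    (h : Ω ⊆ {x | ∃ r > 0, ∀ᵐ y, y ∈ Metric.ball x r → P y}) : ∀ᵐ x ∂(vol Ω), P x := by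
  rw [ae_restrict_iff' hΩo.measurableSet, ae_iff]
  refine measure_null_of_locally_null _ fun x hx => ?_
  simp only [mem_ofPred_eq, Classical.not_imp] at hx
  obtain ⟨r, hr, hP⟩ := h hx.1
  refine ⟨{y | ¬ (y ∈ Metric.ball x r → P y)}, ?_, ae_iff.1 hP⟩
  rw [mem_nhdsWithin]
  refine ⟨Metric.ball x r, Metric.isOpen_ball, Metric.mem_ball_self hr, fun y hy hh => ?_⟩
  exact hy.2 fun _ => hh hy.1

/-- The essential range of a `W^{1,∞}` function on a connected set has no gap. -/
theorem MemW1.no_gap (hΩo : IsOpen Ω) (hΩb : Bornology.IsBounded Ω) (hΩc : IsPreconnected Ω)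
    {f : E d → ℝ} (hf : MemW1 Ω ∞ f) {a b : ℝ} (hab : a < b)
    (h : ∀ᵐ x ∂(vol Ω), f x ≤ a ∨ b ≤ f x) :
    (∀ᵐ x ∂(vol Ω), f x ≤ a) ∨ ∀ᵐ x ∂(vol Ω), b ≤ f x := by
  obtain ⟨L, hL0, S, hS, hloc⟩ := hf.locally_lipschitz hΩo hΩb
  rw [ae_restrict_iff' hΩo.measurableSet] at h
  have ne : ∀ (x : E d) (r : ℝ), 0 < r → ∀ P : E d → Prop, (∀ᵐ y, P y) →
      ∃ y ∈ Metric.ball x r, P y := by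
    intro x r hr P hP
    by_contra! hcon
    have : volume (Metric.ball x r) = 0 :=
      measure_mono_null (fun y hy => hcon y hy) (ae_iff.1 hP)
    exact (Metric.measure_ball_pos volume x hr).ne' this
  have cover : Ω ⊆ {x | ∃ r > 0, ∀ᵐ y, y ∈ Metric.ball x r → f y ≤ a} ∪
      {x | ∃ r > 0, ∀ᵐ y, y ∈ Metric.ball x r → b ≤ f y} := by
    intro x hx
    obtain ⟨R, hR, hRΩ, hlip⟩ := hloc x hx
    -- Points of the ball are at distance at most 2r, so f oscillates by at most 2Lr < b - a there
    -- and cannot reach both sides of the gap. The two alternatives then split Ω into disjoint open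
    -- pieces. L + 1 avoids dividing by zero.
    set r := min R ((b - a) / (4 * (L + 1))) with hr
    have hr0 : 0 < r := lt_min hR (div_pos (by linarith) (by linarith))
    have hball : Metric.ball x r ⊆ Metric.ball x R := Metric.ball_subset_ball (min_le_left _ _)
    have small : ∀ y ∈ S ∩ Metric.ball x r, ∀ z ∈ S ∩ Metric.ball x r, |f y - f z| < b - a := by
      rintro y ⟨hyS, hy⟩ z ⟨hzS, hz⟩
      refine (hlip y ⟨hyS, hball hy⟩ z ⟨hzS, hball hz⟩).trans_lt ?_
      have h1 : dist y z ≤ 2 * r := by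
        rw [Metric.mem_ball] at hy hz
        linarith [dist_triangle_right y z x]
      have h2 : r * (4 * (L + 1)) ≤ b - a := by
        rw [← le_div_iff₀ (by linarith)]
        exact min_le_right _ _
      nlinarith [mul_le_mul_of_nonneg_left h1 hL0]
    obtain ⟨y₀, hy₀, hy₀S, hy₀f⟩ := ne x r hr0 _ (hS.and h)
    rcases hy₀f (hRΩ (hball hy₀)) with h1 | h1
    · refine Or.inl ⟨r, hr0, ?_⟩
      filter_upwards [hS, h] with y hyS hyf hy
      have := abs_lt.1 (small y ⟨hyS, hy⟩ y₀ ⟨hy₀S, hy₀⟩)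
      rcases hyf (hRΩ (hball hy)) with h2 | h2
      · exact h2
      · linarith
    · refine Or.inr ⟨r, hr0, ?_⟩
      filter_upwards [hS, h] with y hyS hyf hy
      have := abs_lt.1 (small y ⟨hyS, hy⟩ y₀ ⟨hy₀S, hy₀⟩)
      rcases hyf (hRΩ (hball hy)) with h2 | h2
      · linarith
      · exact h2
  have disj : Disjoint {x : E d | ∃ r > 0, ∀ᵐ y, y ∈ Metric.ball x r → f y ≤ a}
      {x | ∃ r > 0, ∀ᵐ y, y ∈ Metric.ball x r → b ≤ f y} := by
    rw [Set.disjoint_left]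
    rintro x ⟨r, hr, h1⟩ ⟨r', hr', h2⟩
    obtain ⟨y, hy, h1, h2⟩ := ne x (min r r') (lt_min hr hr') _ (h1.and h2)
    have h1 := h1 (Metric.ball_subset_ball (min_le_left _ _) hy)
    have h2 := h2 (Metric.ball_subset_ball (min_le_right _ _) hy)
    linarith
  rcases hΩc.subset_or_subset (isOpen_setOf_locally_ae _) (isOpen_setOf_locally_ae _) disj cover
    with h1 | h1
  · exact Or.inl (ae_of_locally_ae hΩo h1)
  · exact Or.inr (ae_of_locally_ae hΩo h1)

theorem vol_ne_zero (hΩo : IsOpen Ω) (hΩn : Ω.Nonempty) : (ae (vol Ω)).NeBot := by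
  rw [ae_neBot, Ne, Measure.restrict_eq_zero]
  exact (hΩo.measure_pos volume hΩn).ne'

theorem le_rhoMin [(ae (vol Ω)).NeBot] {f : E d → ℝ} {c M : ℝ} (h1 : ∀ᵐ x ∂(vol Ω), c ≤ f x)
    (h2 : ∀ᵐ x ∂(vol Ω), f x ≤ M) : c ≤ rhoMin Ω f :=
  le_liminf_of_le (IsBoundedUnder.isCoboundedUnder_ge ⟨M, eventually_map.2 h2⟩) h1

theorem rhoMax_le [(ae (vol Ω)).NeBot] {f : E d → ℝ} {c M : ℝ} (h1 : ∀ᵐ x ∂(vol Ω), c ≤ f x)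
    (h2 : ∀ᵐ x ∂(vol Ω), f x ≤ M) : rhoMax Ω f ≤ M :=
  limsup_le_of_le (IsBoundedUnder.isCoboundedUnder_le ⟨c, eventually_map.2 h1⟩) h2

/-- A bound of `θ ∘ f` is a bound of `θ` on the whole interval between the essential bounds of
`f`. -/
theorem MemW1.le_of_mem_Icc (hΩo : IsOpen Ω) (hΩb : Bornology.IsBounded Ω) (hΩc : IsConnected Ω)
    {f : E d → ℝ} (hf : MemW1 Ω ∞ f) {c M : ℝ} (h1 : ∀ᵐ x ∂(vol Ω), c ≤ f x)
    (h2 : ∀ᵐ x ∂(vol Ω), f x ≤ M) {θ : ℝ → ℝ} {B : ℝ} (hB : ∀ᵐ x ∂(vol Ω), θ (f x) ≤ B) {s : ℝ}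
    (hs1 : rhoMin Ω f ≤ s) (hs2 : s ≤ rhoMax Ω f) (hθ : ContinuousAt θ s) : θ s ≤ B := by
  have := vol_ne_zero hΩo hΩc.nonempty
  by_contra! hcon
  obtain ⟨δ, hδ, hball⟩ := Metric.eventually_nhds_iff.1 (hθ.eventually_const_lt hcon)
  -- By continuity θ exceeds B on the interval of radius δ around s, which f must therefore avoid.
  -- With no gap allowed, f lies on one side, and s falls outside its essential bounds.
  have hgap : ∀ᵐ x ∂(vol Ω), f x ≤ s - δ ∨ s + δ ≤ f x := by
    filter_upwards [hB] with x hx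
    by_contra! hh
    have := hball (y := f x) (by rw [Real.dist_eq, abs_lt]; constructor <;> linarith [hh.1, hh.2])
    linarith
  rcases hf.no_gap hΩo hΩb hΩc.isPreconnected (by linarith) hgap with h | h
  · have := rhoMax_le h1 h
    linarith
  · have := le_rhoMin h h2
    linarith

end EssentialRange

/-! ### Regularity in time -/

section Time

variable {X : Type*} [NormedAddCommGroup X] [NormedSpace ℝ X] {T : ℝ}

theorem MemWTime.lipschitz {v : ℝ → X} (h : MemWTime T 1 v) :
    ∃ K : ℝ, 0 ≤ K ∧ ∀ s ∈ Icc 0 T, ∀ t ∈ Icc 0 T, ‖v s - v t‖ ≤ K * |s - t| := by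
  obtain ⟨w, hw, hv⟩ := h
  have hw : MemLp w ∞ (volume.restrict (Icc 0 T)) := hw
  refine ⟨(eLpNorm w ∞ (volume.restrict (Icc 0 T))).toReal, ENNReal.toReal_nonneg, ?_⟩
  have hb : ∀ᵐ x, x ∈ Icc 0 T → ‖w x‖ ≤ (eLpNorm w ∞ (volume.restrict (Icc 0 T))).toReal := by
    rw [← ae_restrict_iff' measurableSet_Icc]
    filter_upwards [ae_le_eLpNormEssSup (f := w) (μ := volume.restrict (Icc 0 T))] with x hx
    rw [← eLpNorm_exponent_top] at hx
    simpa using ENNReal.toReal_mono hw.2.ne hx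
  have hi : IntegrableOn w (Icc 0 T) := hw.integrable le_top
  have hii : ∀ s ∈ Icc 0 T, IntervalIntegrable w volume 0 s := fun s hs => by
    rw [intervalIntegrable_iff_integrableOn_Icc_of_le hs.1]
    exact hi.mono_set (Icc_subset_Icc_right hs.2)
  intro s hs t ht
  rw [hv s hs, hv t ht, add_sub_add_left_eq_sub,
    intervalIntegral.integral_interval_sub_left (hii s hs) (hii t ht)]
  refine intervalIntegral.norm_integral_le_of_norm_le_const_ae ?_
  filter_upwards [hb] with x hx hxs
  exact hx (uIcc_subset_Icc ht hs (uIoc_subset_uIcc hxs))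

theorem MemWTime.bounded {v : ℝ → X} (h : MemWTime T 1 v) :
    ∃ K : ℝ, 0 ≤ K ∧ ∀ s ∈ Icc 0 T, ‖v s‖ ≤ K := by
  obtain ⟨K, hK, h⟩ := h.lipschitz
  refine ⟨K * |T| + ‖v 0‖, by positivity, fun s hs => ?_⟩
  have h1 := h s hs 0 ⟨le_rfl, hs.1.trans hs.2⟩
  have h2 : |s - 0| ≤ |T| := by
    rw [sub_zero, abs_of_nonneg hs.1]
    exact hs.2.trans (le_abs_self T)
  have h3 := norm_sub_norm_le (v s) (v 0)
  nlinarith [mul_le_mul_of_nonneg_left h2 hK]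

/-- First order Taylor expansion in time. -/
theorem MemWTime.taylor [CompleteSpace X] {v : ℝ → X} (h : MemWTime T 2 v) :
    MemWTime T 1 v ∧ ∃ w : ℝ → X, MemWTime T 1 w ∧ ∃ K : ℝ, 0 ≤ K ∧
      ∀ s ∈ Icc 0 T, ∀ t ∈ Icc 0 T, ‖v s - v t - (s - t) • w t‖ ≤ K * |s - t| ^ 2 := by
  obtain ⟨w, hw, hv⟩ := h
  have hw : MemWTime T 1 w := hw
  obtain ⟨K, hK, hlip⟩ := hw.lipschitz
  have hcont : ContinuousOn w (Icc 0 T) := by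
    refine (LipschitzOnWith.of_dist_le_mul (K := K.toNNReal) fun s hs t ht => ?_).continuousOn
    rw [dist_eq_norm, Real.dist_eq, Real.coe_toNNReal _ hK]
    exact hlip s hs t ht
  refine ⟨⟨w, ?_, hv⟩, w, hw, K, hK, fun s hs t ht => ?_⟩
  · obtain ⟨B, hB, hb⟩ := hw.bounded
    exact MemLp.of_bound (hcont.aestronglyMeasurable measurableSet_Icc) B
      ((ae_restrict_iff' measurableSet_Icc).2 (Eventually.of_forall hb))
  have hii : ∀ s ∈ Icc 0 T, ∀ t ∈ Icc 0 T, IntervalIntegrable w volume s t := fun s hs t ht =>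
    (hcont.mono (uIcc_subset_Icc hs ht)).intervalIntegrable
  have h0 : (0 : ℝ) ∈ Icc 0 T := ⟨le_rfl, hs.1.trans hs.2⟩
  -- The remainder is quadratic because w is itself Lipschitz in time.
  have e : v s - v t - (s - t) • w t = ∫ r in t..s, (w r - w t) := by
    rw [hv s hs, hv t ht, add_sub_add_left_eq_sub,
      intervalIntegral.integral_interval_sub_left (hii 0 h0 s hs) (hii 0 h0 t ht),
      intervalIntegral.integral_sub (hii t ht s hs) intervalIntegrable_const,
      intervalIntegral.integral_const]
  rw [e, pow_two, ← mul_assoc]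
  refine intervalIntegral.norm_integral_le_of_norm_le_const fun r hr => ?_
  have hr' := uIoc_subset_uIcc hr
  refine (hlip r (uIcc_subset_Icc ht hs hr') t ht).trans (mul_le_mul_of_nonneg_left ?_ hK)
  exact abs_sub_left_of_mem_uIcc hr'

theorem hasDerivWithinAt_of_quadratic {F : ℝ → ℝ} {S : Set ℝ} {t D C : ℝ}
    (h : ∀ s ∈ S, |F s - F t - (s - t) * D| ≤ C * |s - t| ^ 2) : HasDerivWithinAt F D S t := by
  rw [hasDerivWithinAt_iff_isLittleO]
  have h1 : (fun s => F s - F t - (s - t) • D) =O[𝓝[S] t] fun s => (s - t) ^ 2 := by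
    refine Asymptotics.IsBigO.of_bound C ?_
    filter_upwards [self_mem_nhdsWithin] with s hs
    simpa using h s hs
  refine h1.trans_isLittleO ?_
  have h2 : Tendsto (fun s : ℝ => s - t) (𝓝[S] t) (𝓝 0) := by
    have : Tendsto (fun s : ℝ => s - t) (𝓝 t) (𝓝 (t - t)) :=
      (continuous_id.sub continuous_const).tendsto t
    rw [sub_self] at this
    exact this.mono_left nhdsWithin_le_nhds
  have := ((Asymptotics.isLittleO_pow_id (𝕜 := ℝ) one_lt_two)).comp_tendsto h2
  exact this

end Time

/-- Pointwise bounds of the exact solution `ρ, u, p` and of the time derivative `W` of `u`. -/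
structure ExactBounds {d : ℕ} (Ω : Set (E d)) (T : ℝ) (ρ : ℝ → Linf Ω) (u W : ℝ → Linfv Ω)
    (p : ℝ → Linf Ω) (K : ℝ) : Prop where
  nonneg : 0 ≤ K
  rho_bd : ∀ t ∈ Icc 0 T, ∀ᵐ x ∂(vol Ω), |ρ t x| ≤ K
  rho_lip : ∀ s ∈ Icc 0 T, ∀ t ∈ Icc 0 T, ∀ᵐ x ∂(vol Ω), |ρ s x - ρ t x| ≤ K * |s - t|
  p_lip : ∀ s ∈ Icc 0 T, ∀ t ∈ Icc 0 T, ∀ᵐ x ∂(vol Ω), |p s x - p t x| ≤ K * |s - t|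
  u_bd : ∀ t ∈ Icc 0 T, ∀ᵐ x ∂(vol Ω), ‖u t x‖ ≤ K
  u_lip : ∀ s ∈ Icc 0 T, ∀ t ∈ Icc 0 T, ∀ᵐ x ∂(vol Ω), ‖u s x - u t x‖ ≤ K * |s - t|
  W_bd : ∀ t ∈ Icc 0 T, ∀ᵐ x ∂(vol Ω), ‖W t x‖ ≤ K
  u_taylor : ∀ s ∈ Icc 0 T, ∀ t ∈ Icc 0 T, ∀ᵐ x ∂(vol Ω),
    ‖u s x - u t x - (s - t) • W t x‖ ≤ K * |s - t| ^ 2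
  grad_mem : ∀ t ∈ Icc 0 T, ∀ i, MemW1 Ω ∞ (fun x => u t x i)
  grad_bd : ∀ t ∈ Icc 0 T, ∀ i j, ∀ᵐ x ∂(vol Ω), |gradv Ω (u t) i j x| ≤ K

theorem ae_norm_le_of_Lp_top {d : ℕ} {Ω : Set (E d)} {F : Type*} [NormedAddCommGroup F]
    (v : Lp F ∞ (vol Ω)) {K : ℝ} (h : ‖v‖ ≤ K) : ∀ᵐ x ∂(vol Ω), ‖v x‖ ≤ K := by
  filter_upwards [ae_le_eLpNormEssSup (f := v) (μ := vol Ω)] with x hx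
  rw [← eLpNorm_exponent_top] at hx
  have h1 := ENNReal.toReal_mono (Lp.memLp v).2.ne hx
  rw [Lp.norm_def] at h
  refine le_trans ?_ h
  simpa using h1

theorem IsRegular.exists_bounds {d : ℕ} {Ω : Set (E d)} {T : ℝ} {ρ : ℝ → Linf Ω}
    {u : ℝ → Linfv Ω} {p : ℝ → Linf Ω} (h : IsRegular Ω T ρ u p) :
    ∃ (W : ℝ → Linfv Ω) (K : ℝ), ExactBounds Ω T ρ u W p K := by
  obtain ⟨hu1, W, hW, K0, hK0, htay⟩ := h.velocity_time.taylor
  obtain ⟨K1, hK1, b1⟩ := h.density.bounded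
  obtain ⟨K2, hK2, b2⟩ := h.density.lipschitz
  obtain ⟨K3, hK3, b3⟩ := h.pressure.lipschitz
  obtain ⟨K4, hK4, b4⟩ := hu1.bounded
  obtain ⟨K5, hK5, b5⟩ := hu1.lipschitz
  obtain ⟨K6, hK6, b6⟩ := hW.bounded
  obtain ⟨K7, b7⟩ := h.velocity_space
  have hK7 : (0 : ℝ) ≤ K7 := K7.2
  refine ⟨W, K0 + K1 + K2 + K3 + K4 + K5 + K6 + K7, ?_⟩
  set K := K0 + K1 + K2 + K3 + K4 + K5 + K6 + K7 with hK
  have lip : ∀ {F : Type _} [NormedAddCommGroup F] [NormedSpace ℝ F] (v : ℝ → Lp F ∞ (vol Ω))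
      (k : ℝ), k ≤ K → (∀ s ∈ Icc 0 T, ∀ t ∈ Icc 0 T, ‖v s - v t‖ ≤ k * |s - t|) →
      ∀ s ∈ Icc 0 T, ∀ t ∈ Icc 0 T, ∀ᵐ x ∂(vol Ω), ‖v s x - v t x‖ ≤ K * |s - t| := by
    intro F _ _ v k hk hv s hs t ht
    have h1 := ae_norm_le_of_Lp_top _ ((hv s hs t ht).trans
      (mul_le_mul_of_nonneg_right hk (abs_nonneg _)))
    filter_upwards [h1, Lp.coeFn_sub (v s) (v t)] with x hx hx'
    rwa [hx'] at hx
  refine ⟨by positivity, fun t ht => ?_, lip ρ K2 (by linarith) b2,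
    lip p K3 (by linarith) b3, fun t ht => ?_, lip u K5 (by linarith) b5, fun t ht => ?_,
    fun s hs t ht => ?_, fun t ht i => (b7 t ht i).1,
    fun t ht i j => ?_⟩
  · exact ae_norm_le_of_Lp_top _ ((b1 t ht).trans (by linarith))
  · exact ae_norm_le_of_Lp_top _ ((b4 t ht).trans (by linarith))
  · exact ae_norm_le_of_Lp_top _ ((b6 t ht).trans (by linarith))
  · have h1 := ae_norm_le_of_Lp_top _ ((htay s hs t ht).trans
      (mul_le_mul_of_nonneg_right (show K0 ≤ K by linarith) (sq_nonneg |s - t|)))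
    filter_upwards [h1, Lp.coeFn_sub (u s - u t) ((s - t) • W t), Lp.coeFn_sub (u s) (u t),
      Lp.coeFn_smul (s - t) (W t)] with x hx e1 e2 e3
    rw [e1, Pi.sub_apply, e2, e3] at hx
    exact hx
  · have h1 := (b7 t ht i).2 j
    filter_upwards [ae_le_eLpNormEssSup (f := gradv Ω (u t) i j) (μ := vol Ω)] with x hx
    rw [← eLpNorm_exponent_top] at hx
    have h2 := ENNReal.toReal_mono ENNReal.coe_ne_top (hx.trans h1)
    simp only [toReal_enorm, Real.norm_eq_abs, ENNReal.coe_toReal] at h2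
    linarith

/-! ### The exact solution in nonconservative weak form -/

theorem LpLim.abs {α : Type*} [MeasurableSpace α] {μ : Measure α} {p : ℝ≥0∞}
    {f : ℕ → α → ℝ} {g : α → ℝ} (h : LpLim μ p f g) :
    LpLim μ p (fun k x => |f k x|) (fun x => |g x|) := by
  refine ⟨fun k => (h.mem k).norm, h.lim_mem.norm, ?_⟩
  refine tendsto_of_tendsto_of_tendsto_of_le_of_le tendsto_const_nhds h.tendsto
    (fun _ => zero_le) fun k => ?_
  exact eLpNorm_mono fun x => abs_abs_sub_abs_le _ _

theorem memLp_apply {d : ℕ} {Ω : Set (E d)} {q : ℝ≥0∞} {v : E d → E d} (h : MemLp v q (vol Ω))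
    (i : Fin d) : MemLp (fun x => v x i) q (vol Ω) :=
  (EuclideanSpace.proj (𝕜 := ℝ) i).comp_memLp' h

theorem abs_mul_sub_mul_le {a b c e K δ : ℝ} (ha : |a| ≤ K) (he : |e| ≤ K)
    (h1 : |a - c| ≤ K * δ) (h2 : |b - e| ≤ K * δ) : |a * b - c * e| ≤ 2 * K ^ 2 * δ := by
  have e1 : a * b - c * e = a * (b - e) + (a - c) * e := by ring
  have h3 : |a * (b - e)| ≤ K * (K * δ) := by
    rw [abs_mul]
    exact mul_le_mul ha h2 (abs_nonneg _) ((abs_nonneg _).trans ha)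
  have h4 : |(a - c) * e| ≤ K * δ * K := by
    rw [abs_mul]
    exact mul_le_mul h1 he (abs_nonneg _) ((abs_nonneg _).trans h1)
  rw [e1]
  refine (abs_add_le _ _).trans ?_
  linarith

section Exact

variable {d : ℕ} {Ω : Set (E d)} {T : ℝ} {ρ : ℝ → Linf Ω} {u W : ℝ → Linfv Ω} {p : ℝ → Linf Ω}
  {K : ℝ}

theorem abs_apply_le_of_norm_le {v : E d} {B : ℝ} (h : ‖v‖ ≤ B) (i : Fin d) : |v i| ≤ B :=
  (PiLp.norm_apply_le v i).trans h

theorem memLp_flux (ρ : Linf Ω) (u : Linfv Ω) (j : Fin d) :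
    MemLp (fun x => ρ x * u x j) ∞ (vol Ω) :=
  (memLp_apply (Lp.memLp u) j).mul' (Lp.memLp ρ)

/-- The mass equation, in integrated form. -/
theorem ExactBounds.mass_test (hΩb : Bornology.IsBounded Ω) (hb : ExactBounds Ω T ρ u W p K)
    (hmass : ∀ φ : E d → ℝ, IsTest Ω φ → ∀ t ∈ Icc 0 T,
      HasDerivWithinAt (fun s => ∫ x in Ω, ρ s x * φ x)
        (∫ x in Ω, ∑ j, ρ t x * u t x j * cd j φ x) (Icc 0 T) t)
    {φ : E d → ℝ} (hφ : IsTest Ω φ) {s t : ℝ} (hs : s ∈ Icc 0 T) (ht : t ∈ Icc 0 T) :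
    |(∫ x in Ω, (ρ s x - ρ t x) * φ x) - (s - t) * ∫ x in Ω, ∑ j, ρ t x * u t x j * cd j φ x|
      ≤ 2 * K ^ 2 * (∫ x in Ω, ∑ j, |cd j φ x|) * |s - t| ^ 2 := by
  have := isFiniteMeasure_vol hΩb
  have i1 : ∀ t, Integrable (fun x => ρ t x * φ x) (vol Ω) := fun t =>
    Integrable.mul_top (Lp.memLp (ρ t)) ((hφ.memLp 1).integrable le_rfl)
  have i2 : ∀ t, Integrable (fun x => ∑ j, ρ t x * u t x j * cd j φ x) (vol Ω) := fun t =>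
    integrable_finsetSum _ fun j _ => Integrable.mul_top (memLp_flux (ρ t) (u t) j)
      ((hφ.memLp_cd j 1).integrable le_rfl)
  have i3 : Integrable (fun x => ∑ j, |cd j φ x|) (vol Ω) :=
    integrable_finsetSum _ fun j _ => ((hφ.memLp_cd j 1).integrable le_rfl).abs
  set G : ℝ → ℝ := fun t => ∫ x in Ω, ∑ j, ρ t x * u t x j * cd j φ x with hG
  set I := ∫ x in Ω, ∑ j, |cd j φ x| with hI
  have hsub : uIcc t s ⊆ Icc 0 T := uIcc_subset_Icc ht hs
  -- With the linear function ξ·G(t) removed, the derivative is G(ξ) - G(t) = O(|s - t|), and the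
  -- mean value inequality gives a quadratic remainder.
  have hder : ∀ ξ ∈ uIcc t s, HasDerivWithinAt
      (fun ξ => (∫ x in Ω, ρ ξ x * φ x) - ξ * G t) (G ξ - G t) (uIcc t s) ξ := fun ξ hξ => by
    have h1 := (hmass φ hφ ξ (hsub hξ)).mono hsub
    have h2 := (hasDerivWithinAt_id ξ (uIcc t s)).mul_const (G t)
    rw [one_mul] at h2
    exact h1.sub h2
  have hbd : ∀ ξ ∈ uIcc t s, ‖G ξ - G t‖ ≤ 2 * K ^ 2 * I * |s - t| := by
    intro ξ hξ
    have h1 : ‖G ξ - G t‖ ≤ ∫ x in Ω, 2 * K ^ 2 * |s - t| * ∑ j, |cd j φ x| := by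
      simp only [hG]
      rw [← integral_sub (i2 ξ) (i2 t)]
      refine norm_integral_le_of_norm_le (i3.const_mul _) ?_
      filter_upwards [hb.rho_bd ξ (hsub hξ), hb.rho_lip ξ (hsub hξ) t ht, hb.u_bd t ht,
        hb.u_lip ξ (hsub hξ) t ht] with x h1 h2 h3 h4
      rw [← Finset.sum_sub_distrib, Finset.mul_sum]
      refine (norm_sum_le _ _).trans (Finset.sum_le_sum fun j _ => ?_)
      rw [← sub_mul, norm_mul, Real.norm_eq_abs, Real.norm_eq_abs]
      refine mul_le_mul_of_nonneg_right ?_ (abs_nonneg _)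
      have h5 := abs_mul_sub_mul_le h1 (abs_apply_le_of_norm_le h3 j) h2
        (b := u ξ x j) (abs_apply_le_of_norm_le (v := u ξ x - u t x) h4 j)
      refine h5.trans (mul_le_mul_of_nonneg_left (abs_sub_left_of_mem_uIcc hξ) (by positivity))
    rw [integral_const_mul] at h1
    refine h1.trans (le_of_eq ?_)
    ring
  have key := (convex_uIcc t s).norm_image_sub_le_of_norm_hasDerivWithin_le hder hbd
    left_mem_uIcc right_mem_uIcc
  simp only [Real.norm_eq_abs, sub_mul] at key ⊢
  rw [integral_sub (i1 s) (i1 t)]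
  refine le_trans (le_of_eq ?_) (key.trans (le_of_eq ?_))
  · congr 1
    ring
  · ring

/-- The remainder in `mass_test` sees the test function only through the L¹ norm of its gradient. It
therefore survives the limit in which products of test functions approach φf, and the mass equation
may be tested with φ times a velocity component. -/
theorem ExactBounds.mass_mul (hΩb : Bornology.IsBounded Ω) (hb : ExactBounds Ω T ρ u W p K)
    (hmass : ∀ φ : E d → ℝ, IsTest Ω φ → ∀ t ∈ Icc 0 T,
      HasDerivWithinAt (fun s => ∫ x in Ω, ρ s x * φ x)
        (∫ x in Ω, ∑ j, ρ t x * u t x j * cd j φ x) (Icc 0 T) t)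
    {φ : E d → ℝ} (hφ : IsTest Ω φ) {f : E d → ℝ} (hf : MemH10 Ω f) {t : ℝ} (ht : t ∈ Icc 0 T) :
    ∃ C : ℝ, ∀ s ∈ Icc 0 T, |(∫ x in Ω, (ρ s x - ρ t x) * (φ x * f x))
      - (s - t) * ∫ x in Ω, ∑ j, ρ t x * u t x j * (φ x * wd Ω j f x + f x * cd j φ x)|
      ≤ C * |s - t| ^ 2 := by
  have := isFiniteMeasure_vol hΩb
  obtain ⟨ψ, hψ, h1, h2⟩ := hf.exists_seq
  refine ⟨2 * K ^ 2 * ∫ x in Ω, ∑ j, |φ x * wd Ω j f x + f x * cd j φ x|, fun s hs => ?_⟩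
  have L0 : LpLim (vol Ω) 1 (fun k x => φ x * ψ k x) (fun x => φ x * f x) :=
    LpLim.mul (p := 2) (q := 2) le_rfl (LpLim.const (hφ.memLp 2)) h1
  have L1 : ∀ j, LpLim (vol Ω) 1 (fun k x => cd j (fun x => φ x * ψ k x) x)
      (fun x => φ x * wd Ω j f x + f x * cd j φ x) := fun j => by
    have := LpLim.add le_rfl
      (LpLim.mul (p := 2) (q := 2) le_rfl (LpLim.const (hφ.memLp 2)) (h2 j))
      (LpLim.mul (p := 2) (q := 2) le_rfl h1 (LpLim.const (hφ.memLp_cd j 2)))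
    refine this.congr_seq fun k => Eventually.of_forall fun x => ?_
    exact (cd_mul hφ.differentiable (hψ k).differentiable j x).symm
  have hρ : MemLp (fun x => ρ s x - ρ t x) ∞ (vol Ω) := (Lp.memLp (ρ s)).sub (Lp.memLp (ρ t))
  have l1 := (LpLim.mul (p := ∞) (q := 1) le_rfl (LpLim.const hρ) L0).tendsto_integral
  have l2 := (LpLim.finset_sum Finset.univ le_rfl fun j _ =>
    LpLim.mul (p := ∞) (q := 1) le_rfl (LpLim.const (memLp_flux (ρ t) (u t) j))
      (L1 j)).tendsto_integral
  have l3 := (LpLim.finset_sum Finset.univ le_rfl fun j _ => (L1 j).abs).tendsto_integral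
  refine le_of_tendsto_of_tendsto' (l1.sub (l2.const_mul (s - t))).abs
    ((l3.const_mul (2 * K ^ 2)).mul_const _) fun k => ?_
  exact hb.mass_test hΩb hmass (hφ.mul (hψ k)) hs ht

end Exact

section Exact

variable {d : ℕ} {Ω : Set (E d)} {T : ℝ} {ρ : ℝ → Linf Ω} {u W : ℝ → Linfv Ω} {p : ℝ → Linf Ω}
  {K : ℝ}

/-- Time derivative of a component of the momentum. -/
theorem ExactBounds.hasDerivWithinAt_momentum (hΩb : Bornology.IsBounded Ω)
    (hb : ExactBounds Ω T ρ u W p K)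
    (hmass : ∀ φ : E d → ℝ, IsTest Ω φ → ∀ t ∈ Icc 0 T,
      HasDerivWithinAt (fun s => ∫ x in Ω, ρ s x * φ x)
        (∫ x in Ω, ∑ j, ρ t x * u t x j * cd j φ x) (Icc 0 T) t)
    (hbdry : ∀ t ∈ Icc 0 T, MemH10v Ω (u t))
    {φ : E d → ℝ} (hφ : IsTest Ω φ) (i : Fin d) {t : ℝ} (ht : t ∈ Icc 0 T) :
    HasDerivWithinAt (fun s => ∫ x in Ω, ρ s x * u s x i * φ x)
      ((∫ x in Ω, ρ t x * W t x i * φ x) + ∫ x in Ω, ∑ j, ρ t x * u t x j *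
        (φ x * gradv Ω (u t) i j x + u t x i * cd j φ x)) (Icc 0 T) t := by
  have := isFiniteMeasure_vol hΩb
  obtain ⟨C, hC⟩ := hb.mass_mul hΩb hmass hφ (hbdry t ht i) ht
  have iφ : Integrable φ (vol Ω) := (hφ.memLp 1).integrable le_rfl
  have i1 : ∀ t, Integrable (fun x => ρ t x * u t x i * φ x) (vol Ω) := fun t =>
    Integrable.mul_top (memLp_flux (ρ t) (u t) i) iφ
  have i2 : Integrable (fun x => ρ t x * W t x i * φ x) (vol Ω) :=
    Integrable.mul_top (memLp_flux (ρ t) (W t) i) iφ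
  refine hasDerivWithinAt_of_quadratic (C := C + 2 * K ^ 2 * ∫ x in Ω, |φ x|) fun s hs => ?_
  have i3 : Integrable (fun x => (ρ s x - ρ t x) * (φ x * u t x i)) (vol Ω) := by
    refine Integrable.mul_top ((Lp.memLp (ρ s)).sub (Lp.memLp (ρ t))) ?_
    simpa only [mul_comm] using Integrable.mul_top (memLp_apply (Lp.memLp (u t)) i) iφ
  have h1 := hC s hs
  -- Product rule for ρu: the increment of ρ is paired with the frozen u(t), where `mass_mul`
  -- applies, the increment of u is replaced by (s - t)W, and what is left is quadratic in s - t.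
  have h2 : |∫ x in Ω, (ρ s x * u s x i * φ x - ρ t x * u t x i * φ x
      - (ρ s x - ρ t x) * (φ x * u t x i) - (s - t) * (ρ t x * W t x i * φ x))|
      ≤ ∫ x in Ω, 2 * K ^ 2 * |s - t| ^ 2 * |φ x| := by
    refine norm_integral_le_of_norm_le (f := fun x => (ρ s x * u s x i * φ x
      - ρ t x * u t x i * φ x - (ρ s x - ρ t x) * (φ x * u t x i)
      - (s - t) * (ρ t x * W t x i * φ x))) (iφ.abs.const_mul (2 * K ^ 2 * |s - t| ^ 2)) ?_
    filter_upwards [hb.rho_bd t ht, hb.rho_lip s hs t ht, hb.u_lip s hs t ht,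
      hb.u_taylor s hs t ht] with x h1 h2 h3 h4
    have h3' := abs_apply_le_of_norm_le (v := u s x - u t x) h3 i
    have h4' := abs_apply_le_of_norm_le (v := u s x - u t x - (s - t) • W t x) h4 i
    simp only [PiLp.sub_apply, PiLp.smul_apply, smul_eq_mul] at h3' h4'
    have e : ρ s x * u s x i * φ x - ρ t x * u t x i * φ x
      - (ρ s x - ρ t x) * (φ x * u t x i) - (s - t) * (ρ t x * W t x i * φ x)
      = ((ρ s x - ρ t x) * (u s x i - u t x i)
        + ρ t x * (u s x i - u t x i - (s - t) * W t x i)) * φ x := by ring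
    rw [e, norm_mul, Real.norm_eq_abs, Real.norm_eq_abs]
    refine mul_le_mul_of_nonneg_right ((abs_add_le _ _).trans ?_) (abs_nonneg _)
    rw [abs_mul, abs_mul]
    have h5 := mul_le_mul h2 h3' (abs_nonneg _) ((abs_nonneg _).trans h2)
    have h6 := mul_le_mul h1 h4' (abs_nonneg _) hb.nonneg
    calc _ ≤ K * |s - t| * (K * |s - t|) + K * (K * |s - t| ^ 2) := add_le_add h5 h6
      _ = 2 * K ^ 2 * |s - t| ^ 2 := by ring
  rw [((((IntegralEq.of_integrable (i1 s)).sub (.of_integrable (i1 t))).sub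
    (.of_integrable i3)).sub ((IntegralEq.of_integrable i2).const_mul (s - t))).eq,
    integral_const_mul] at h2
  refine le_trans (le_of_eq ?_) ((abs_add_le _ _).trans
    ((add_le_add h1 h2).trans (le_of_eq ?_)))
  · congr 1
    simp only [gradv]
    ring
  · ring

/-- The momentum equation in nonconservative weak form, at every time. -/
theorem ExactBounds.weak_form (hΩb : Bornology.IsBounded Ω) (hT : 0 < T)
    {η : ℝ → ℝ} {f : ℝ → L2v Ω} (hb : ExactBounds Ω T ρ u W p K)
    (hsol : IsExactSolution Ω T η ρ u p f)
    (hη : ∀ t ∈ Icc 0 T, MemLp (fun x => η (ρ t x)) ∞ (vol Ω)) {t : ℝ} (ht : t ∈ Icc 0 T)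
    {v : E d → E d} (hv : MemH10v Ω v) :
    Integrable (fun x => ∑ i, ((ρ t x * W t x i + (∑ j, ρ t x * u t x j * gradv Ω (u t) i j x)
        - f t x i) * v x i + ∑ j, (2 * (η (ρ t x) * strain Ω (u t) i j x)
        - if i = j then p t x else 0) * gradv Ω v i j x)) (vol Ω) ∧
    ∫ x in Ω, ∑ i, ((ρ t x * W t x i + (∑ j, ρ t x * u t x j * gradv Ω (u t) i j x)
        - f t x i) * v x i + ∑ j, (2 * (η (ρ t x) * strain Ω (u t) i j x)
        - if i = j then p t x else 0) * gradv Ω v i j x) = 0 := by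
  have := isFiniteMeasure_vol hΩb
  have mg : ∀ i j, MemLp (gradv Ω (u t) i j) ∞ (vol Ω) := fun i j => ((hb.grad_mem t ht i).2 j).2
  have ms : ∀ i j, MemLp (strain Ω (u t) i j) ∞ (vol Ω) := fun i j => by
    refine (((mg i j).add (mg j i)).mul_const (2⁻¹ : ℝ)).ae_eq (Eventually.of_forall fun x => ?_)
    simp [strain, div_eq_mul_inv]
  have mf : ∀ i, MemLp (fun x => f t x i) 2 (vol Ω) := fun i => memLp_apply (Lp.memLp (f t)) i
  have m1 : ∀ i, MemLp (fun x => ρ t x * W t x i + (∑ j, ρ t x * u t x j * gradv Ω (u t) i j x))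
      ∞ (vol Ω) := fun i => (memLp_flux (ρ t) (W t) i).add
    (memLp_finsetSum _ fun j _ => (mg i j).mul' (memLp_flux (ρ t) (u t) j))
  have m2 : ∀ i j, MemLp (fun x => η (ρ t x) * strain Ω (u t) i j x) ∞ (vol Ω) := fun i j =>
    (ms i j).mul' (hη t ht)
  have m3 : ∀ i j : Fin d, MemLp (fun x => if i = j then p t x else 0) ∞ (vol Ω) := fun i j => by
    by_cases h : i = j
    · simpa [h] using Lp.memLp (p t)
    · simp [h]
  refine integral_eq_zero_of_isTest (fun i => ((m1 i).mono_exponent le_top).sub (mf i))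
    (fun i j => (((m2 i j).const_mul 2).sub (m3 i j)).mono_exponent le_top) (fun φ hφ => ?_) hv
  have iφ : ∀ i, Integrable (φ i) (vol Ω) := fun i => ((hφ i).memLp 1).integrable le_rfl
  have icφ : ∀ i j, Integrable (cd j (φ i)) (vol Ω) := fun i j =>
    ((hφ i).memLp_cd j 1).integrable le_rfl
  have I0 : ∀ s, ∀ i, Integrable (fun x => ρ s x * u s x i * φ i x) (vol Ω) := fun s i =>
    Integrable.mul_top (memLp_flux (ρ s) (u s) i) (iφ i)
  have I1 : Integrable (fun x => ∑ i, ∑ j, ρ t x * u t x i * u t x j * cd j (φ i) x) (vol Ω) :=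
    integrable_finsetSum _ fun i _ => integrable_finsetSum _ fun j _ =>
      Integrable.mul_top ((memLp_apply (Lp.memLp (u t)) j).mul' (memLp_flux (ρ t) (u t) i))
        (icφ i j)
  have I2 : Integrable (fun x => ∑ i, ∑ j, η (ρ t x) * strain Ω (u t) i j x * cd j (φ i) x)
      (vol Ω) := integrable_finsetSum _ fun i _ => integrable_finsetSum _ fun j _ =>
      Integrable.mul_top (m2 i j) (icφ i j)
  have I3 : Integrable (fun x => p t x * ∑ i, cd i (φ i) x) (vol Ω) :=
    Integrable.mul_top (Lp.memLp (p t)) (integrable_finsetSum _ fun i _ => icφ i i)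
  have I4 : Integrable (fun x => ∑ i, f t x i * φ i x) (vol Ω) :=
    integrable_finsetSum _ fun i _ => MemLp.integrable_mul_two (mf i) ((hφ i).memLp 2)
  have I5 : ∀ i, Integrable (fun x => ρ t x * W t x i * φ i x) (vol Ω) := fun i =>
    Integrable.mul_top (memLp_flux (ρ t) (W t) i) (iφ i)
  have I6 : ∀ i, Integrable (fun x => ∑ j, ρ t x * u t x j *
      (φ i x * gradv Ω (u t) i j x + u t x i * cd j (φ i) x)) (vol Ω) := fun i =>
    integrable_finsetSum _ fun j _ => Integrable.mul_top (memLp_flux (ρ t) (u t) j)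
      (Integrable.add (by simpa only [mul_comm] using Integrable.mul_top (mg i j) (iφ i))
        (Integrable.mul_top (memLp_apply (Lp.memLp (u t)) i) (icφ i j)))
  have h1 := hsol.momentum φ hφ t ht
  have h2 : HasDerivWithinAt (fun s => ∑ i, ∫ x in Ω, ρ s x * u s x i * φ i x)
      (∑ i, ((∫ x in Ω, ρ t x * W t x i * φ i x) + ∫ x in Ω, ∑ j, ρ t x * u t x j *
        (φ i x * gradv Ω (u t) i j x + u t x i * cd j (φ i) x))) (Icc 0 T) t :=
    HasDerivWithinAt.fun_sum fun i _ =>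
      hb.hasDerivWithinAt_momentum hΩb hsol.mass hsol.boundary (hφ i) i ht
  have e0 : (fun s => ∫ x in Ω, ∑ i, ρ s x * u s x i * φ i x)
      = fun s => ∑ i, ∫ x in Ω, ρ s x * u s x i * φ i x := by
    ext s
    exact integral_finsetSum _ fun i _ => I0 s i
  rw [e0] at h1
  -- The momentum has two expressions for its time derivative, also one-sided at the endpoints since
  -- T > 0. Equating them cancels the flux of ρu ⊗ u and leaves the nonconservative form.
  have e1 := (uniqueDiffOn_Icc hT t ht).eq_deriv _ h1 h2
  have e2 := (IntegralEq.sum Finset.univ fun i _ =>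
      (IntegralEq.of_integrable (I5 i)).add (.of_integrable (I6 i))).sub
    ((((IntegralEq.of_integrable I1).sub ((IntegralEq.of_integrable I2).const_mul 2)).add
      (.of_integrable I3)).add (.of_integrable I4))
  rw [← e1, sub_self] at e2
  refine (e2.congr_ae (Eventually.of_forall fun x => ?_)).eq
  have hp : ∀ i, ∑ j, (if i = j then p t x else 0) * cd j (φ i) x = p t x * cd i (φ i) x :=
    fun i => by simp
  simp only [Pi.sub_apply, sub_mul, Finset.mul_sum,
    ← Finset.sum_add_distrib, ← Finset.sum_sub_distrib, add_mul, Finset.sum_mul]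
  refine Finset.sum_congr rfl fun i _ => ?_
  simp only [Finset.sum_add_distrib, Finset.sum_sub_distrib, hp, mul_add]
  have e3 : ∀ j, ρ t x * u t x i * u t x j * cd j (φ i) x
    = ρ t x * u t x j * (u t x i * cd j (φ i) x) := fun j => by ring
  have e4 : ∀ j, ρ t x * u t x j * (φ i x * gradv Ω (u t) i j x)
    = ρ t x * u t x j * gradv Ω (u t) i j x * φ i x := fun j => by ring
  have e5 : ∀ j, 2 * (η (ρ t x) * strain Ω (u t) i j x * cd j (φ i) x)
    = 2 * (η (ρ t x) * strain Ω (u t) i j x) * cd j (φ i) x := fun j => by ring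
  simp only [e3, e4, e5]
  ring

/-! ### Time regularity of the strain, obtained from the equation -/

theorem MemH10v.sub (hΩo : IsOpen Ω) (hΩb : Bornology.IsBounded Ω) {v w : E d → E d}
    (hv : MemH10v Ω v) (hw : MemH10v Ω w) : MemH10v Ω (fun x => v x - w x) := fun i =>
  (hv i).sub hΩo hΩb (hw i)

theorem MemH10v.gradv_sub (hΩo : IsOpen Ω) (hΩb : Bornology.IsBounded Ω) {v w : E d → E d}
    (hv : MemH10v Ω v) (hw : MemH10v Ω w) :
    ∀ᵐ x ∂(vol Ω), ∀ i j, gradv Ω (fun x => v x - w x) i j x = gradv Ω v i j x - gradv Ω w i j x := by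
  simp only [ae_all_iff]
  intro i j
  exact (hv i).1.wd_sub hΩo hΩb (hw i).1 j

theorem sum_sum_symm_mul {A G : Fin d → Fin d → ℝ} (hA : ∀ i j, A i j = A j i) :
    ∑ i, ∑ j, A i j * G i j = ∑ i, ∑ j, A i j * ((G i j + G j i) / 2) := by
  have h : ∑ i, ∑ j, A i j * G i j = ∑ i, ∑ j, A i j * G j i := by
    rw [Finset.sum_comm]
    exact Finset.sum_congr rfl fun i _ => Finset.sum_congr rfl fun j _ => by rw [hA]
  have h2 : ∑ i, ∑ j, A i j * ((G i j + G j i) / 2)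
      = ((∑ i, ∑ j, A i j * G i j) + ∑ i, ∑ j, A i j * G j i) / 2 := by
    rw [← Finset.sum_add_distrib, Finset.sum_div]
    refine Finset.sum_congr rfl fun i _ => ?_
    rw [← Finset.sum_add_distrib, Finset.sum_div]
    exact Finset.sum_congr rfl fun j _ => by ring
  rw [h2, ← h]
  ring

theorem IsExactSolution.sq_norm_source (f : L2v Ω) {B : ℝ} (hB : ‖f‖ ≤ B) :
    Integrable (fun x => ‖f x‖ ^ 2) (vol Ω) ∧ ∫ x in Ω, ‖f x‖ ^ 2 ≤ B ^ 2 := by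
  have h1 := L2.integrable_inner (𝕜 := ℝ) f f
  have h2 := L2.inner_def (𝕜 := ℝ) f f
  simp only [real_inner_self_eq_norm_sq] at h1 h2
  refine ⟨h1, ?_⟩
  rw [← h2]
  exact pow_le_pow_left₀ (norm_nonneg f) hB 2

/-- Replaces the source, which enters linearly, by its integrable square. -/
theorem abs_le_one_add_sq (y : ℝ) : |y| ≤ 1 + y ^ 2 := by
  rw [← sq_abs]
  nlinarith [sq_nonneg (|y| - 1 / 2)]

theorem sum_diag_mul (q : ℝ) (G : Fin d → Fin d → ℝ) :
    ∑ i, ∑ j, (if i = j then q else 0) * G i j = q * ∑ i, G i i := by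
  simp [Finset.mul_sum]

/-- Integrand of the difference of the weak forms at two times, tested with the velocity increment.
The pressures q, q' vanish because both velocities are divergence free. The inertial terms and the
source need only be bounded, since they multiply v - v' = O(δ), and the change of viscosity is
itself O(δ). Hence the squared strain increment is O(δ), not O(δ²). -/
theorem strain_increment_pointwise {r r' : ℝ} {v v' w w' g g' : Fin d → ℝ}
    {G G' S S' : Fin d → Fin d → ℝ} {h h' h₀ q q' K α δ : ℝ} (hK : 0 ≤ K)
    (hr : |r| ≤ K) (hr' : |r'| ≤ K) (hw : ∀ i, |w i| ≤ K) (hw' : ∀ i, |w' i| ≤ K)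
    (hv : ∀ i, |v i| ≤ K) (hv' : ∀ i, |v' i| ≤ K) (hvv : ∀ i, |v i - v' i| ≤ K * δ)
    (hG : ∀ i j, |G i j| ≤ K) (hG' : ∀ i j, |G' i j| ≤ K)
    (hS : ∀ i j, S i j = (G i j + G j i) / 2) (hS' : ∀ i j, S' i j = (G' i j + G' j i) / 2)
    (htr : ∑ i, G i i = 0) (htr' : ∑ i, G' i i = 0) (hh : h₀ ≤ h) (hhh : |h - h'| ≤ α * (K * δ)) :
    2 * h₀ * ∑ i, ∑ j, (S i j - S' i j) ^ 2 ≤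
      (∑ i, ((r * w i + (∑ j, r * v j * G i j) - g i) * (v i - v' i)
        + ∑ j, (2 * (h * S i j) - if i = j then q else 0) * (G i j - G' i j))
      - ∑ i, ((r' * w' i + (∑ j, r' * v' j * G' i j) - g' i) * (v i - v' i)
        + ∑ j, (2 * (h' * S' i j) - if i = j then q' else 0) * (G i j - G' i j)))
      + δ * (d * (K * (2 * (K ^ 2 + d * K ^ 3) + 2)) + d * d * (4 * α * K ^ 3))
      + K * δ * (∑ i, g i ^ 2 + ∑ i, g' i ^ 2) := by
  have hSb : ∀ i j, |S i j| ≤ K := fun i j => by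
    have h1 := abs_le.1 (hG i j)
    have h2 := abs_le.1 (hG j i)
    rw [hS, abs_le]
    constructor <;> linarith
  have hSb' : ∀ i j, |S' i j| ≤ K := fun i j => by
    have h1 := abs_le.1 (hG' i j)
    have h2 := abs_le.1 (hG' j i)
    rw [hS', abs_le]
    constructor <;> linarith
  have hacc : ∀ (r : ℝ) (w v : Fin d → ℝ) (G : Fin d → Fin d → ℝ), |r| ≤ K → (∀ i, |w i| ≤ K) →
      (∀ i, |v i| ≤ K) → (∀ i j, |G i j| ≤ K) → ∀ i,
      |r * w i + ∑ j, r * v j * G i j| ≤ K ^ 2 + d * K ^ 3 := by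
    intro r w v G hr hw hv hG i
    refine (abs_add_le _ _).trans (add_le_add ?_ ?_)
    · rw [abs_mul, pow_two]
      exact mul_le_mul hr (hw i) (abs_nonneg _) hK
    · refine (Finset.abs_sum_le_sum_abs _ _).trans ((Finset.sum_le_card_nsmul _ _ (K ^ 3)
        fun j _ => ?_).trans (by simp))
      rw [abs_mul, abs_mul]
      calc |r| * |v j| * |G i j| ≤ K * K * K :=
            mul_le_mul (mul_le_mul hr (hv j) (abs_nonneg _) hK) (hG i j) (abs_nonneg _)
              (by positivity)
        _ = K ^ 3 := by ring
  have hfirst : -(δ * (d * (K * (2 * (K ^ 2 + d * K ^ 3) + 2)))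
      + K * δ * (∑ i, g i ^ 2 + ∑ i, g' i ^ 2)) ≤
      ∑ i, ((r * w i + (∑ j, r * v j * G i j) - g i)
        - (r' * w' i + (∑ j, r' * v' j * G' i j) - g' i)) * (v i - v' i) := by
    have h1 : ∀ i, -(δ * (K * (2 * (K ^ 2 + d * K ^ 3) + 2)) + K * δ * (g i ^ 2 + g' i ^ 2)) ≤
        ((r * w i + (∑ j, r * v j * G i j) - g i)
        - (r' * w' i + (∑ j, r' * v' j * G' i j) - g' i)) * (v i - v' i) := by
      intro i
      have b1 := abs_le.1 (hacc r w v G hr hw hv hG i)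
      have b2 := abs_le.1 (hacc r' w' v' G' hr' hw' hv' hG' i)
      have b3 := abs_le.1 (abs_le_one_add_sq (g i))
      have b4 := abs_le.1 (abs_le_one_add_sq (g' i))
      set a := r * w i + (∑ j, r * v j * G i j)
      set a' := r' * w' i + (∑ j, r' * v' j * G' i j)
      have b5 : |(a - g i) - (a' - g' i)| ≤ 2 * (K ^ 2 + d * K ^ 3) + 2 + (g i ^ 2 + g' i ^ 2) := by
        rw [abs_le]
        constructor <;> linarith [b1.1, b1.2, b2.1, b2.2, b3.1, b3.2, b4.1, b4.2]
      refine le_trans (le_of_eq ?_) (neg_le_of_abs_le (le_of_eq (abs_mul _ _)|>.trans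
        (mul_le_mul b5 (hvv i) (abs_nonneg _) ((abs_nonneg _).trans b5))))
      ring
    refine le_trans (le_of_eq ?_) (Finset.sum_le_sum fun i _ => h1 i)
    simp only [Finset.sum_neg_distrib, Finset.sum_add_distrib, ← Finset.mul_sum, Finset.sum_const,
      Finset.card_univ, Fintype.card_fin, nsmul_eq_mul]
    ring
  have hsecond : 2 * h₀ * ∑ i, ∑ j, (S i j - S' i j) ^ 2 - δ * (d * d * (4 * α * K ^ 3)) ≤
      ∑ i, ∑ j, 2 * (h * S i j - h' * S' i j) * (S i j - S' i j) := by
    have h1 : ∀ i j, 2 * h₀ * (S i j - S' i j) ^ 2 - δ * (4 * α * K ^ 3) ≤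
        2 * (h * S i j - h' * S' i j) * (S i j - S' i j) := by
      intro i j
      have e : 2 * (h * S i j - h' * S' i j) * (S i j - S' i j)
        = 2 * h * (S i j - S' i j) ^ 2 + 2 * ((h - h') * S' i j * (S i j - S' i j)) := by ring
      have b1 : |S i j - S' i j| ≤ 2 * K := by
        have h1 := abs_le.1 (hSb i j)
        have h2 := abs_le.1 (hSb' i j)
        rw [abs_le]
        constructor <;> linarith
      have b2 : |(h - h') * S' i j * (S i j - S' i j)| ≤ α * (K * δ) * K * (2 * K) := by
        rw [abs_mul, abs_mul]
        have h0 := (abs_nonneg _).trans hhh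
        exact mul_le_mul (mul_le_mul hhh (hSb' i j) (abs_nonneg _) h0) b1 (abs_nonneg _)
          (by positivity)
      have b3 := mul_le_mul_of_nonneg_right hh (sq_nonneg (S i j - S' i j))
      have b4 := neg_le_of_abs_le b2
      rw [e]
      linarith
    refine le_trans (le_of_eq ?_) (Finset.sum_le_sum fun i _ => Finset.sum_le_sum fun j _ => h1 i j)
    simp only [Finset.sum_sub_distrib, ← Finset.mul_sum, Finset.sum_const,
      Finset.card_univ, Fintype.card_fin, nsmul_eq_mul]
    ring
  have hsym : ∑ i, ∑ j, 2 * (h * S i j - h' * S' i j) * (G i j - G' i j)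
      = ∑ i, ∑ j, 2 * (h * S i j - h' * S' i j) * (S i j - S' i j) := by
    rw [sum_sum_symm_mul (A := fun i j => 2 * (h * S i j - h' * S' i j))
      (G := fun i j => G i j - G' i j)]
    · refine Finset.sum_congr rfl fun i _ => Finset.sum_congr rfl fun j _ => ?_
      rw [hS i j, hS' i j]
      ring
    · intro i j
      simp only [hS, hS']
      ring
  have hq : ∀ q : ℝ, ∑ i, ∑ j, (if i = j then q else 0) * (G i j - G' i j) = 0 := by
    intro q
    rw [sum_diag_mul q fun i j => G i j - G' i j, Finset.sum_sub_distrib, htr, htr']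
    simp
  have hsplit : ∀ (a : Fin d → ℝ) (M : Fin d → Fin d → ℝ) (q : ℝ),
      ∑ i, (a i * (v i - v' i) + ∑ j, (M i j - if i = j then q else 0) * (G i j - G' i j))
      = ∑ i, a i * (v i - v' i) + ∑ i, ∑ j, M i j * (G i j - G' i j) := by
    intro a M q
    simp only [sub_mul _ (if _ then q else 0), Finset.sum_sub_distrib, Finset.sum_add_distrib]
    simp only [hq]
    ring
  rw [hsplit, hsplit]
  have hD : ∑ i, ∑ j, 2 * (h * S i j) * (G i j - G' i j)
      - ∑ i, ∑ j, 2 * (h' * S' i j) * (G i j - G' i j)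
      = ∑ i, ∑ j, 2 * (h * S i j - h' * S' i j) * (G i j - G' i j) := by
    simp only [← Finset.sum_sub_distrib]
    exact Finset.sum_congr rfl fun i _ => Finset.sum_congr rfl fun j _ => by ring
  have hA : ∑ i, (r * w i + (∑ j, r * v j * G i j) - g i) * (v i - v' i)
      - ∑ i, (r' * w' i + (∑ j, r' * v' j * G' i j) - g' i) * (v i - v' i)
      = ∑ i, ((r * w i + (∑ j, r * v j * G i j) - g i)
        - (r' * w' i + (∑ j, r' * v' j * G' i j) - g' i)) * (v i - v' i) := by
    simp only [← Finset.sum_sub_distrib]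
    exact Finset.sum_congr rfl fun i _ => by ring
  linarith

/-- The velocity is Hölder continuous in time, with exponent `1/2`, in the energy norm. -/
theorem ExactBounds.strain_increment (hΩo : IsOpen Ω) (hΩb : Bornology.IsBounded Ω) (hT : 0 < T)
    {η : ℝ → ℝ} {f : ℝ → L2v Ω} (hb : ExactBounds Ω T ρ u W p K)
    (hsol : IsExactSolution Ω T η ρ u p f)
    (hη : ∀ t ∈ Icc 0 T, MemLp (fun x => η (ρ t x)) ∞ (vol Ω)) {α : ℝ≥0}
    (hηL : LipschitzOnWith α η (Ioi 0)) {h₀ : ℝ} (hh₀ : 0 < h₀)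
    (hηlb : ∀ t ∈ Icc 0 T, ∀ᵐ x ∂(vol Ω), h₀ ≤ η (ρ t x)) {B : ℝ}
    (hf : ∀ t ∈ Icc 0 T, ‖f t‖ ≤ B) :
    ∃ C : ℝ, 0 ≤ C ∧ ∀ s ∈ Icc 0 T, ∀ t ∈ Icc 0 T,
      Integrable (fun x => ∑ i, ∑ j, (strain Ω (u s) i j x - strain Ω (u t) i j x) ^ 2) (vol Ω) ∧
      ∫ x in Ω, ∑ i, ∑ j, (strain Ω (u s) i j x - strain Ω (u t) i j x) ^ 2 ≤ C * |s - t| := by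
  have := isFiniteMeasure_vol hΩb
  have hK := hb.nonneg
  obtain ⟨c, hc, hρc⟩ := hsol.density_pos
  set k : ℝ := d * (K * (2 * (K ^ 2 + d * K ^ 3) + 2)) + d * d * (4 * α * K ^ 3) with hk
  have hk0 : 0 ≤ k := by positivity
  have ms : ∀ t ∈ Icc 0 T, ∀ i j, MemLp (strain Ω (u t) i j) 2 (vol Ω) := fun t ht i j => by
    have mg : ∀ i j, MemLp (gradv Ω (u t) i j) ∞ (vol Ω) := fun i j => ((hb.grad_mem t ht i).2 j).2
    have : MemLp (strain Ω (u t) i j) ∞ (vol Ω) := by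
      refine (((mg i j).add (mg j i)).mul_const (2⁻¹ : ℝ)).ae_eq (Eventually.of_forall fun x => ?_)
      simp [strain, div_eq_mul_inv]
    exact this.mono_exponent le_top
  -- k collects the pointwise bounds, B² bounds the squared norm of the source at each of the two
  -- times, and 2h₀ is the coercivity constant of the viscous term.
  refine ⟨(k * (vol Ω).real univ + K * (B ^ 2 + B ^ 2)) / (2 * h₀), by positivity,
    fun s hs t ht => ?_⟩
  have iZ : Integrable (fun x => ∑ i, ∑ j, (strain Ω (u s) i j x - strain Ω (u t) i j x) ^ 2)
      (vol Ω) := integrable_finsetSum _ fun i _ => integrable_finsetSum _ fun j _ =>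
    ((ms s hs i j).sub (ms t ht i j)).integrable_sq
  refine ⟨iZ, ?_⟩
  have hv := (hsol.boundary s hs).sub hΩo hΩb (hsol.boundary t ht)
  obtain ⟨n1, n2⟩ := hb.weak_form hΩb hT hsol hη hs hv
  obtain ⟨n3, n4⟩ := hb.weak_form hΩb hT hsol hη ht hv
  obtain ⟨f1, f2⟩ := IsExactSolution.sq_norm_source (f s) (hf s hs)
  obtain ⟨f3, f4⟩ := IsExactSolution.sq_norm_source (f t) (hf t ht)
  have hl := ((IntegralEq.of_integrable iZ).const_mul (2 * h₀))
  have hr := (((IntegralEq.mk n1 n2).sub (IntegralEq.mk n3 n4)).add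
    ((IntegralEq.of_integrable (integrable_const (μ := vol Ω) k)).const_mul |s - t|)).add
    (((IntegralEq.of_integrable f1).add (.of_integrable f3)).const_mul (K * |s - t|))
  have key := hl.mono hr (by
    have a1 : ∀ᵐ x ∂(vol Ω), ∀ i j, |gradv Ω (u s) i j x| ≤ K := by
      simpa only [ae_all_iff] using hb.grad_bd s hs
    have a2 : ∀ᵐ x ∂(vol Ω), ∀ i j, |gradv Ω (u t) i j x| ≤ K := by
      simpa only [ae_all_iff] using hb.grad_bd t ht
    filter_upwards [(hsol.boundary s hs).gradv_sub hΩo hΩb (hsol.boundary t ht), a1, a2,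
      hb.rho_bd s hs, hb.rho_bd t ht, hb.rho_lip s hs t ht, hb.u_bd s hs, hb.u_bd t ht,
      hb.u_lip s hs t ht, hb.W_bd s hs, hb.W_bd t ht, hρc s hs, hρc t ht, hηlb s hs,
      hsol.incompressible s hs, hsol.incompressible t ht] with x hG g1 g2 r1 r2 r3 u1 u2 u3 w1 w2
      c1 c2 e1 d1 d2
    have hη1 : |η (ρ s x) - η (ρ t x)| ≤ α * (K * |s - t|) := by
      have := hηL.dist_le_mul (ρ s x) (hc.trans_le c1) (ρ t x) (hc.trans_le c2)
      rw [Real.dist_eq, Real.dist_eq] at this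
      exact this.trans (mul_le_mul_of_nonneg_left r3 α.2)
    have hpt := strain_increment_pointwise (v := u s x) (v' := u t x) (w := W s x) (w' := W t x)
      (g := f s x) (g' := f t x) (G := fun i j => gradv Ω (u s) i j x)
      (G' := fun i j => gradv Ω (u t) i j x) (S := fun i j => strain Ω (u s) i j x)
      (S' := fun i j => strain Ω (u t) i j x) (q := p s x) (q' := p t x) (δ := |s - t|) hK
      r1 r2 (abs_apply_le_of_norm_le w1) (abs_apply_le_of_norm_le w2)
      (abs_apply_le_of_norm_le u1) (abs_apply_le_of_norm_le u2)
      (fun i => abs_apply_le_of_norm_le (v := u s x - u t x) u3 i) g1 g2 (fun _ _ => rfl)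
      (fun _ _ => rfl) d1 d2 e1 hη1
    simp only [hG, PiLp.sub_apply, EuclideanSpace.real_norm_sq_eq]
    exact hpt)
  simp only [integral_const, smul_eq_mul, sub_self, zero_add] at key
  rw [div_mul_eq_mul_div, le_div_iff₀ (by positivity)]
  have h1 : K * |s - t| * ((∫ x in Ω, ‖f s x‖ ^ 2) + ∫ x in Ω, ‖f t x‖ ^ 2)
      ≤ K * |s - t| * (B ^ 2 + B ^ 2) :=
    mul_le_mul_of_nonneg_left (add_le_add f2 f4) (by positivity)
  calc _ = 2 * h₀ * ∫ x in Ω, ∑ i, ∑ j, (strain Ω (u s) i j x - strain Ω (u t) i j x) ^ 2 := by ring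
    _ ≤ _ := key
    _ ≤ |s - t| * ((vol Ω).real univ * k) + K * |s - t| * (B ^ 2 + B ^ 2) := by linarith
    _ = _ := by ring

end Exact

/-! ### The pointwise energy inequality -/

theorem abs_le_young {t P Q s : ℝ} (hP : 0 ≤ P) (hQ : 0 ≤ Q) (hs : 0 < s) (h : t ^ 2 ≤ P * Q) :
    |t| ≤ s * P + Q / (4 * s) := by
  refine abs_le_of_sq_le_sq ?_ (by positivity)
  have e : (s * P + Q / (4 * s)) ^ 2 = P * Q + (s * P - Q / (4 * s)) ^ 2 := by
    field_simp
    ring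
  rw [e]
  nlinarith [sq_nonneg (s * P - Q / (4 * s))]

/-- The right side is 4τ(νr₁XX - (νr₁ - h)XY). Since νr₁ ≥ h, the mixed term may be bounded by (XX +
YY)/2, and the increment condition νr₁ - h ≤ νr₀ turns the coefficient of YY into the weight at the
old time. -/
theorem viscous_energy {τ ν r₀ r₁ h XX YY XY : ℝ} (hτ : 0 ≤ τ) (hYY : 0 ≤ YY)
    (hXY : 2 * XY ≤ XX + YY) (hνr : h ≤ ν * r₁) (hinc : ν * (r₁ - r₀) ≤ h) :
    2 * τ * ν * (r₁ * XX) - 2 * τ * ν * (r₀ * YY) + 2 * (τ * h * XX)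
      ≤ 4 * τ * (h * XY + ν * r₁ * (XX - XY)) := by
  have h1 := mul_le_mul_of_nonneg_left hXY (mul_nonneg hτ (sub_nonneg.2 hνr))
  have h2 := mul_le_mul_of_nonneg_left hinc (mul_nonneg hτ hYY)
  nlinarith

/-- Here a, b are the new and old divergences of the error. Polarization of (a - b)a and ba gives
the increment of the weighted divergence plus (Λr₁ - l)(a - b)² ≥ l(a - b)²/10. The remaining la²
completes the square of the pressure increment. The exact pressure increment δ leaves a cross term
2τq₁δ/l, split so that q₁² carries a factor τ². -/
theorem pressure_energy {τ l Λ r₀ r₁ a b q₀ q₁ δ : ℝ} (hτ : 0 < τ) (hl : 0 < l)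
    (hΛr : 11 / 10 * l ≤ Λ * r₁) (hinc : Λ * (r₁ - r₀) ≤ l) (hp : l * a = q₀ - q₁ + δ) :
    τ / l * q₁ ^ 2 - τ / l * q₀ ^ 2 + τ * Λ * (r₁ * a ^ 2) - τ * Λ * (r₀ * b ^ 2)
      + 1 / 10 * (τ * l * (a - b) ^ 2) - τ ^ 2 / l * q₁ ^ 2 - δ ^ 2 / l
      ≤ 2 * τ * (Λ * (r₁ * ((a - b) * a)) + l * b * a - q₀ * a) := by
  have e1 : q₀ = l * a + q₁ - δ := by linarith
  have h1 : τ / l * q₁ ^ 2 - τ / l * q₀ ^ 2 - τ ^ 2 / l * q₁ ^ 2 - δ ^ 2 / l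
      ≤ τ * l * a ^ 2 - 2 * τ * q₀ * a := by
    rw [e1, ← mul_le_mul_iff_left₀ hl]
    have e2 : (τ / l * q₁ ^ 2 - τ / l * (l * a + q₁ - δ) ^ 2 - τ ^ 2 / l * q₁ ^ 2 - δ ^ 2 / l) * l
      = τ * q₁ ^ 2 - τ * (l * a + q₁ - δ) ^ 2 - τ ^ 2 * q₁ ^ 2 - δ ^ 2 := by field_simp
    rw [e2]
    nlinarith [sq_nonneg (τ * q₁ - δ), mul_nonneg hτ.le (sq_nonneg δ)]
  have h2 := mul_le_mul_of_nonneg_left hΛr (mul_nonneg hτ.le (sq_nonneg (a - b)))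
  have h3 := mul_le_mul_of_nonneg_left hinc (mul_nonneg hτ.le (sq_nonneg b))
  nlinarith

set_option maxHeartbeats 2000000 in
/-- The discrete energy inequality at a point, in terms of the scalar contractions of the errors. -/
theorem energy_scalar {τ T ν Λ l γ r₀ r₁ h η₁ M K κ α : ℝ}
    {E₁ E₀ DD XX YY XY ZZ VV G2 a b q₀ q₁ δ R ε₀ ε₁ ta tb tc te tf t5 t6 t7 t8 Ka : ℝ}
    (hτ : 0 < τ) (hτT : τ ≤ T) (hν : 0 ≤ ν) (hl : 0 < l) (hh : 0 < h) (hr₀ : 0 ≤ r₀)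
    (hr₀M : r₀ ≤ M) (hr₁M : r₁ ≤ M) (hκ : 1 ≤ κ * h) (hκ0 : 0 ≤ κ)
    (hγ1 : γ ^ 2 ≤ 1 / 4) (hγ2 : 64 * ν * γ ^ 2 ≤ 1)
    (hνr : h ≤ ν * r₁) (hincν : ν * (r₁ - r₀) ≤ h)
    (hΛr : 11 / 10 * l ≤ Λ * r₁) (hincΛ : Λ * (r₁ - r₀) ≤ l)
    (hGν : τ * ν * G2 ≤ γ ^ 2 * (r₀ * h)) (hGΛ : 2 * τ * Λ ^ 2 * G2 ≤ γ ^ 2 * (r₀ * h))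
    (hE₁ : 0 ≤ E₁) (hDD : 0 ≤ DD) (hXX : 0 ≤ XX) (hYY : 0 ≤ YY) (hZZ : 0 ≤ ZZ)
    (hVV0 : 0 ≤ VV) (hXY : 2 * XY ≤ XX + YY)
    (ha : a ^ 2 ≤ 3 * XX) (hp : l * a = q₀ - q₁ + δ) (hδ : δ ^ 2 ≤ K ^ 2 * τ ^ 2)
    (hVV : VV ≤ K ^ 2 * τ ^ 2) (hη : (η₁ - h) ^ 2 ≤ α ^ 2 * ε₁ ^ 2)
    (h5 : t5 ^ 2 ≤ DD * G2 * XX) (h6 : t6 ^ 2 ≤ G2 * DD) (h7 : t7 ^ 2 ≤ VV * G2 * XX)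
    (h8 : t8 ^ 2 ≤ G2 * VV) (hc : tc ^ 2 ≤ K ^ 2 * E₁) (he : te ^ 2 ≤ 9 * K ^ 2 * XX)
    (hf : tf ^ 2 ≤ ZZ * XX) (hta : -(2 * ta) ≤ E₁ + Ka * (ε₀ ^ 2 + τ ^ 2))
    (hKa : 0 ≤ Ka) (htb : -(2 * tb) ≤ E₁ + Ka * (ε₀ ^ 2 + τ ^ 2 + E₀)) :
    r₁ * E₁ + τ / l * q₁ ^ 2 + 2 * τ * ν * (r₁ * XX) + τ * Λ * (r₁ * a ^ 2) + τ * (h * XX)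
      ≤ r₀ * E₀ + τ / l * q₀ ^ 2 + 2 * τ * ν * (r₀ * YY) + τ * Λ * (r₀ * b ^ 2)
      + ((r₁ * E₁ - r₀ * E₀ + r₀ * DD) + 2 * τ * (ta + tb + 1 / 2 * r₀ * b * tc - 1 / 2 * R * tc
        + 2 * (η₁ - h) * te + 2 * (h - ν * r₁) * tf + 2 * (h * XY + ν * r₁ * (XX - XY))
        - 2 * ν * t7 + 2 * ν * t5 - Λ * t8 * a + Λ * t6 * a
        + (Λ * (r₁ * ((a - b) * a)) + l * b * a - q₀ * a) - δ * a))
      + τ ^ 2 / l * q₁ ^ 2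
      + (2 + 24 * κ * M ^ 2 * K ^ 2 + 5 / 2 * M ^ 2 * K ^ 2 / l + K ^ 2) * (τ * E₁) + Ka * (τ * E₀)
      + (2 * Ka + 1 + 1152 * κ * α ^ 2 * K ^ 2) * (τ * (ε₀ ^ 2 + ε₁ ^ 2 + R ^ 2))
      + 128 * κ * ν ^ 2 * M ^ 2 * (τ * ZZ)
      + (2 * Ka * T + 14 * M * K ^ 2 + 96 * κ * K ^ 2 * T + K ^ 2 / l) * τ ^ 2 := by
  -- The dissipation at the new time. `viscous_energy` supplies 2H: one copy is kept on the left,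
  -- and of the other b5 uses 1/4, b6 uses 1/2, and b7, b8, b9, bf, be, bc use 1/32 each, in all
  -- 15/16. The inertial gain r₀DD is used up by b5 and b6 as 1/4 + 3/4.
  set H := τ * h * XX with hH
  have hH0 : 0 ≤ H := by positivity
  have hτ0 := hτ.le
  have hXH : τ * XX ≤ κ * H := by
    have := mul_le_mul_of_nonneg_right hκ (mul_nonneg hτ0 hXX)
    rw [hH]
    linarith
  have hM0 : 0 ≤ M := hr₀.trans hr₀M
  have hM2 : r₀ ^ 2 ≤ M ^ 2 := pow_le_pow_left₀ hr₀ hr₀M 2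
  have hvis := viscous_energy hτ0 hYY hXY hνr hincν
  have hpre := pressure_energy (b := b) (r₀ := r₀) hτ hl hΛr hincΛ hp
  -- Commutator of the viscous term: the smallness of τν|∇ρ|² together with 64νγ² ≤ 1 bounds its
  -- square by r₀DD·H/4.
  have b5 : |4 * τ * ν * t5| ≤ 1 / 4 * (r₀ * DD) + 1 / 4 * H := by
    refine (abs_le_young (P := r₀ * DD) (Q := 1 / 4 * H) (s := 1 / 4) (by positivity)
      (by positivity) (by norm_num) ?_).trans (le_of_eq (by ring))
    have e1 : (4 * τ * ν * t5) ^ 2 = 16 * τ ^ 2 * ν ^ 2 * t5 ^ 2 := by ring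
    have e2 := mul_le_mul_of_nonneg_left h5 (show 0 ≤ 16 * τ ^ 2 * ν ^ 2 by positivity)
    have e3 := mul_le_mul_of_nonneg_left hGν (show 0 ≤ 16 * τ * ν * DD * XX by positivity)
    have e4 := mul_le_mul_of_nonneg_left hγ2 (show 0 ≤ 1 / 4 * (τ * DD * XX * (r₀ * h)) by positivity)
    rw [e1, hH]
    linarith
  -- Commutator of the divergence term. The trace bound a² ≤ 3XX and γ² ≤ 1/4 give the product
  -- r₀DD·(3/2)H; the Young weights fit what b5 leaves.
  have b6 : |2 * τ * (Λ * t6 * a)| ≤ 3 / 4 * (r₀ * DD) + 1 / 2 * H := by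
    refine (abs_le_young (P := r₀ * DD) (Q := 3 / 2 * H) (s := 3 / 4) (by positivity)
      (by positivity) (by norm_num) ?_).trans (le_of_eq (by ring))
    have e1 : (2 * τ * (Λ * t6 * a)) ^ 2 = 4 * τ ^ 2 * Λ ^ 2 * (t6 ^ 2 * a ^ 2) := by ring
    have hG : 0 ≤ G2 * DD := (sq_nonneg _).trans h6
    have e2 := mul_le_mul_of_nonneg_left (mul_le_mul h6 ha (sq_nonneg a) hG)
      (show 0 ≤ 4 * τ ^ 2 * Λ ^ 2 by positivity)
    have e3 := mul_le_mul_of_nonneg_left hGΛ (show 0 ≤ 6 * τ * DD * XX by positivity)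
    have e4 := mul_le_mul_of_nonneg_left hγ1 (show 0 ≤ 6 * (τ * DD * XX * (r₀ * h)) by positivity)
    rw [e1, hH]
    linarith
  have b7 : |4 * τ * ν * t7| ≤ 1 / 32 * H + 2 * M * K ^ 2 * τ ^ 2 := by
    refine (abs_le_young (P := H) (Q := 1 / 4 * (M * (K ^ 2 * τ ^ 2))) (s := 1 / 32) hH0
      (by positivity) (by norm_num) ?_).trans (le_of_eq (by ring))
    have e1 : (4 * τ * ν * t7) ^ 2 = 16 * τ ^ 2 * ν ^ 2 * t7 ^ 2 := by ring
    have e2 := mul_le_mul_of_nonneg_left h7 (show 0 ≤ 16 * τ ^ 2 * ν ^ 2 by positivity)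
    have e3 := mul_le_mul_of_nonneg_left hGν (show 0 ≤ 16 * τ * ν * VV * XX by positivity)
    have e4 := mul_le_mul_of_nonneg_left hγ2 (show 0 ≤ 1 / 4 * (τ * VV * XX * (r₀ * h)) by positivity)
    have e5 := mul_le_mul_of_nonneg_left (mul_le_mul hr₀M hVV hVV0 hM0)
      (show 0 ≤ 1 / 4 * H by positivity)
    rw [e1]
    rw [hH] at e5 ⊢
    linarith
  have b8 : |2 * τ * (Λ * t8 * a)| ≤ 1 / 32 * H + 12 * M * K ^ 2 * τ ^ 2 := by
    refine (abs_le_young (P := H) (Q := 3 / 2 * (M * (K ^ 2 * τ ^ 2))) (s := 1 / 32) hH0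
      (by positivity) (by norm_num) ?_).trans (le_of_eq (by ring))
    have e1 : (2 * τ * (Λ * t8 * a)) ^ 2 = 4 * τ ^ 2 * Λ ^ 2 * (t8 ^ 2 * a ^ 2) := by ring
    have hG : 0 ≤ G2 * VV := (sq_nonneg _).trans h8
    have e2 := mul_le_mul_of_nonneg_left (mul_le_mul h8 ha (sq_nonneg a) hG)
      (show 0 ≤ 4 * τ ^ 2 * Λ ^ 2 by positivity)
    have e3 := mul_le_mul_of_nonneg_left hGΛ (show 0 ≤ 6 * τ * VV * XX by positivity)
    have e4 := mul_le_mul_of_nonneg_left hγ1 (show 0 ≤ 6 * (τ * VV * XX * (r₀ * h)) by positivity)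
    have e5 := mul_le_mul_of_nonneg_left (mul_le_mul hr₀M hVV hVV0 hM0)
      (show 0 ≤ 3 / 2 * H by positivity)
    rw [e1]
    rw [hH] at e5 ⊢
    linarith
  have b9 : |2 * τ * (δ * a)| ≤ 1 / 32 * H + 96 * κ * K ^ 2 * T * τ ^ 2 := by
    refine (abs_le_young (P := H) (Q := 12 * κ * K ^ 2 * T * τ ^ 2) (s := 1 / 32) hH0
      (by have := hτ0.trans hτT; positivity) (by norm_num) ?_).trans (le_of_eq (by ring))
    have e1 : (2 * τ * (δ * a)) ^ 2 = 4 * τ ^ 2 * (δ ^ 2 * a ^ 2) := by ring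
    have e2 := mul_le_mul_of_nonneg_left (mul_le_mul hδ ha (sq_nonneg a) (by positivity))
      (show 0 ≤ 4 * τ ^ 2 by positivity)
    have e3 := mul_le_mul_of_nonneg_left hXH (show 0 ≤ 12 * τ * (K ^ 2 * τ ^ 2) by positivity)
    have e4 := mul_le_mul_of_nonneg_left hτT (show 0 ≤ 12 * (K ^ 2 * τ ^ 2) * (κ * H) by positivity)
    rw [e1]
    linarith
  have bf : |4 * τ * ((h - ν * r₁) * tf)| ≤ 1 / 32 * H + 128 * κ * ν ^ 2 * M ^ 2 * (τ * ZZ) := by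
    refine (abs_le_young (P := H) (Q := 16 * κ * ν ^ 2 * M ^ 2 * (τ * ZZ)) (s := 1 / 32) hH0
      (by positivity) (by norm_num) ?_).trans (le_of_eq (by ring))
    have e0 : (h - ν * r₁) ^ 2 ≤ (ν * M) ^ 2 := by
      refine sq_le_sq' ?_ ?_
      · have := mul_le_mul_of_nonneg_left hr₁M hν
        linarith
      · have : 0 ≤ ν * M := by positivity
        linarith
    have e1 : (4 * τ * ((h - ν * r₁) * tf)) ^ 2 = 16 * τ ^ 2 * ((h - ν * r₁) ^ 2 * tf ^ 2) := by
      ring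
    have e2 := mul_le_mul_of_nonneg_left (mul_le_mul e0 hf (sq_nonneg tf) (by positivity))
      (show 0 ≤ 16 * τ ^ 2 by positivity)
    have e3 := mul_le_mul_of_nonneg_left hXH
      (show 0 ≤ 16 * τ * ((ν * M) ^ 2 * ZZ) by positivity)
    rw [e1]
    linarith
  have be : |4 * τ * ((η₁ - h) * te)| ≤ 1 / 32 * H + 1152 * κ * α ^ 2 * K ^ 2 * (τ * ε₁ ^ 2) := by
    refine (abs_le_young (P := H) (Q := 144 * κ * α ^ 2 * K ^ 2 * (τ * ε₁ ^ 2)) (s := 1 / 32) hH0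
      (by positivity) (by norm_num) ?_).trans (le_of_eq (by ring))
    have e1 : (4 * τ * ((η₁ - h) * te)) ^ 2 = 16 * τ ^ 2 * ((η₁ - h) ^ 2 * te ^ 2) := by ring
    have e2 := mul_le_mul_of_nonneg_left (mul_le_mul hη he (sq_nonneg te) (by positivity))
      (show 0 ≤ 16 * τ ^ 2 by positivity)
    have e3 := mul_le_mul_of_nonneg_left hXH
      (show 0 ≤ 144 * τ * (α ^ 2 * ε₁ ^ 2 * K ^ 2) by positivity)
    rw [e1]
    linarith
  -- The term r₀·b·tc involves the old divergence b, which the new dissipation does not control. It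
  -- is split with b = a - (a - b): the first part is absorbed here by H, the second in bd by the
  -- tenth of τl(a - b)² left by `pressure_energy`.
  have bc : |τ * (r₀ * a * tc)| ≤ 1 / 32 * H + 24 * κ * M ^ 2 * K ^ 2 * (τ * E₁) := by
    refine (abs_le_young (P := H) (Q := 3 * κ * M ^ 2 * K ^ 2 * (τ * E₁)) (s := 1 / 32) hH0
      (by positivity) (by norm_num) ?_).trans (le_of_eq (by ring))
    have e1 : (τ * (r₀ * a * tc)) ^ 2 = τ ^ 2 * (r₀ ^ 2 * (a ^ 2 * tc ^ 2)) := by ring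
    have e2 := mul_le_mul_of_nonneg_left (mul_le_mul hM2
      (mul_le_mul ha hc (sq_nonneg tc) (by positivity)) (by positivity) (by positivity))
      (show 0 ≤ τ ^ 2 by positivity)
    have e3 := mul_le_mul_of_nonneg_left hXH
      (show 0 ≤ 3 * τ * (M ^ 2 * K ^ 2 * E₁) by positivity)
    rw [e1]
    linarith
  have bd : |τ * (r₀ * (a - b) * tc)| ≤ 1 / 10 * (τ * l * (a - b) ^ 2)
      + 5 / 2 * M ^ 2 * K ^ 2 / l * (τ * E₁) := by
    refine (abs_le_young (P := τ * l * (a - b) ^ 2) (Q := M ^ 2 * K ^ 2 / l * (τ * E₁))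
      (s := 1 / 10) (by positivity) (by positivity) (by norm_num) ?_).trans (le_of_eq (by ring))
    have e1 : (τ * (r₀ * (a - b) * tc)) ^ 2 = (τ ^ 2 * (a - b) ^ 2) * (r₀ ^ 2 * tc ^ 2) := by ring
    have e2 := mul_le_mul_of_nonneg_left (mul_le_mul hM2 hc (sq_nonneg tc) (by positivity))
      (show 0 ≤ τ ^ 2 * (a - b) ^ 2 by positivity)
    rw [e1]
    refine e2.trans (le_of_eq ?_)
    field_simp
  have bR : |τ * (R * tc)| ≤ τ * R ^ 2 + K ^ 2 * (τ * E₁) := by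
    rw [abs_le]
    have := mul_le_mul_of_nonneg_left hc hτ0
    have e1 := mul_nonneg hτ0 (sq_nonneg (R + tc))
    have e2 := mul_nonneg hτ0 (sq_nonneg (R - tc))
    have e3 := mul_nonneg hτ0 (sq_nonneg R)
    have e4 := mul_nonneg hτ0 (sq_nonneg tc)
    constructor <;> linarith
  have ba := mul_le_mul_of_nonneg_left hta hτ0
  have bb := mul_le_mul_of_nonneg_left htb hτ0
  have hδl : δ ^ 2 / l ≤ K ^ 2 / l * τ ^ 2 := by
    rw [div_mul_eq_mul_div]
    exact div_le_div_of_nonneg_right hδ hl.le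
  have hτ3 := mul_le_mul_of_nonneg_left hτT (show 0 ≤ Ka * τ ^ 2 by positivity)
  have p1 : 0 ≤ (2 * Ka) * (τ * (ε₁ ^ 2 + R ^ 2)) := by positivity
  have p2 : 0 ≤ τ * (ε₀ ^ 2 + ε₁ ^ 2) := by positivity
  have p3 : 0 ≤ 1152 * κ * α ^ 2 * K ^ 2 * (τ * (ε₀ ^ 2 + R ^ 2)) := by positivity
  have c5 := neg_le_of_abs_le b5
  have c6 := neg_le_of_abs_le b6
  have c7 := le_of_abs_le b7
  have c8 := le_of_abs_le b8
  have c9 := le_of_abs_le b9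
  have cf := neg_le_of_abs_le bf
  have ce := neg_le_of_abs_le be
  have cc := neg_le_of_abs_le bc
  have cd := le_of_abs_le bd
  have cR := le_of_abs_le bR
  clear b5 b6 b7 b8 b9 bf be bc bd bR
  have split : 2 * τ * (ta + tb + 1 / 2 * r₀ * b * tc - 1 / 2 * R * tc
        + 2 * (η₁ - h) * te + 2 * (h - ν * r₁) * tf + 2 * (h * XY + ν * r₁ * (XX - XY))
        - 2 * ν * t7 + 2 * ν * t5 - Λ * t8 * a + Λ * t6 * a
        + (Λ * (r₁ * ((a - b) * a)) + l * b * a - q₀ * a) - δ * a)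
      = -(τ * (-(2 * ta))) - τ * (-(2 * tb)) + τ * (r₀ * a * tc) - τ * (r₀ * (a - b) * tc)
        - τ * (R * tc) + 4 * τ * ((η₁ - h) * te) + 4 * τ * ((h - ν * r₁) * tf)
        + 4 * τ * (h * XY + ν * r₁ * (XX - XY)) - 4 * τ * ν * t7 + 4 * τ * ν * t5
        - 2 * τ * (Λ * t8 * a) + 2 * τ * (Λ * t6 * a)
        + 2 * τ * (Λ * (r₁ * ((a - b) * a)) + l * b * a - q₀ * a) - 2 * τ * (δ * a) := by ring
  rw [split]
  have hHe : τ * (h * XX) = H := by rw [hH]; ring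
  rw [hHe]
  have eA : (2 + 24 * κ * M ^ 2 * K ^ 2 + 5 / 2 * M ^ 2 * K ^ 2 / l + K ^ 2) * (τ * E₁)
      = 2 * (τ * E₁) + 24 * κ * M ^ 2 * K ^ 2 * (τ * E₁) + 5 / 2 * M ^ 2 * K ^ 2 / l * (τ * E₁)
        + K ^ 2 * (τ * E₁) := by ring
  have eB : (2 * Ka + 1 + 1152 * κ * α ^ 2 * K ^ 2) * (τ * (ε₀ ^ 2 + ε₁ ^ 2 + R ^ 2))
      = 2 * Ka * (τ * ε₀ ^ 2) + τ * R ^ 2 + 1152 * κ * α ^ 2 * K ^ 2 * (τ * ε₁ ^ 2)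
        + 2 * Ka * (τ * (ε₁ ^ 2 + R ^ 2)) + τ * (ε₀ ^ 2 + ε₁ ^ 2)
        + 1152 * κ * α ^ 2 * K ^ 2 * (τ * (ε₀ ^ 2 + R ^ 2)) := by ring
  have eC : (2 * Ka * T + 14 * M * K ^ 2 + 96 * κ * K ^ 2 * T + K ^ 2 / l) * τ ^ 2
      = 2 * (Ka * τ ^ 2 * T) + 2 * M * K ^ 2 * τ ^ 2 + 12 * M * K ^ 2 * τ ^ 2
        + 96 * κ * K ^ 2 * T * τ ^ 2 + K ^ 2 / l * τ ^ 2 := by ring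
  have ba' : τ * (-(2 * ta)) ≤ τ * E₁ + Ka * (τ * ε₀ ^ 2) + Ka * τ ^ 2 * τ := by linarith
  have bb' : τ * (-(2 * tb)) ≤ τ * E₁ + Ka * (τ * ε₀ ^ 2) + Ka * τ ^ 2 * τ + Ka * (τ * E₀) := by
    linarith
  rw [eA, eB, eC]
  clear_value H
  clear eA eB eC split ba bb hta htb h5 h6 h7 h8 hc he hf hVV hη hδ hGν hGΛ hνr hincν hΛr hincΛ
    hγ1 hγ2 hκ hM2 hXH hr₀M hr₁M hp ha hXY hHe hτT
  linarith

/-! ### Algebraic error identity at a point -/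

section Identity

variable {d : ℕ}

/-- The symmetric part of a matrix. -/
noncomputable def symPart (M : Fin d → Fin d → ℝ) (i j : Fin d) : ℝ := (M i j + M j i) / 2

theorem symPart_symm (M : Fin d → Fin d → ℝ) (i j : Fin d) : symPart M i j = symPart M j i := by
  simp only [symPart]
  ring

theorem sum_mul_symPart {A : Fin d → Fin d → ℝ} (hA : ∀ i j, A i j = A j i)
    (G : Fin d → Fin d → ℝ) : ∑ i, ∑ j, A i j * symPart G i j = ∑ i, ∑ j, A i j * G i j :=
  (sum_sum_symm_mul hA).symm

/-- The gradient of r(u - u') is r times a gradient increment plus a rank-one commutator with g =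
∇ρ. Inserting u = U - e separates three kinds of terms: the quadratic form handled by
`viscous_energy`, consistency errors, and commutators in U - U' and e - e'. -/
theorem viscous_identity {e e' U U' u u' g : Fin d → ℝ} {G G' GU GU' Gu Gu' GM : Fin d → Fin d → ℝ}
    {r η₁ h ν : ℝ} (hu : ∀ i, u i = U i - e i) (hu' : ∀ i, u' i = U' i - e' i)
    (hGu : ∀ i j, Gu i j = GU i j - G i j) (hGu' : ∀ i j, Gu' i j = GU' i j - G' i j)
    (hGM : ∀ i j, GM i j = r * (Gu i j - Gu' i j) + g j * (u i - u' i)) :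
    ∑ i, ∑ j, 2 * (η₁ * symPart GU i j) * G i j
      - 2 * ν * ∑ i, ∑ j, symPart GM i j * symPart G i j
      - 2 * ∑ i, ∑ j, h * symPart Gu' i j * symPart G i j
    = 2 * (η₁ - h) * ∑ i, ∑ j, symPart GU i j * symPart G i j
      + 2 * (h - ν * r) * ∑ i, ∑ j, (symPart GU i j - symPart GU' i j) * symPart G i j
      + 2 * (h * ∑ i, ∑ j, symPart G i j * symPart G' i j + ν * r *
        (∑ i, ∑ j, symPart G i j ^ 2 - ∑ i, ∑ j, symPart G i j * symPart G' i j))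
      - 2 * ν * ∑ i, ∑ j, (U i - U' i) * g j * symPart G i j
      + 2 * ν * ∑ i, ∑ j, (e i - e' i) * g j * symPart G i j := by
  have h1 : ∑ i, ∑ j, 2 * (η₁ * symPart GU i j) * G i j
      = ∑ i, ∑ j, 2 * (η₁ * symPart GU i j) * symPart G i j :=
    (sum_mul_symPart (fun i j => by rw [symPart_symm]) G).symm
  have h2 : ∑ i, ∑ j, symPart GM i j * symPart G i j
      = ∑ i, ∑ j, (r * (symPart GU i j - symPart G i j - symPart GU' i j + symPart G' i j)
        * symPart G i j + (U i - U' i) * g j * symPart G i j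
        - (e i - e' i) * g j * symPart G i j) := by
    have e1 : ∀ i j, symPart GM i j
        = r * (symPart GU i j - symPart G i j - symPart GU' i j + symPart G' i j)
          + symPart (fun i j => g j * (u i - u' i)) i j := fun i j => by
      simp only [symPart, hGM, hGu, hGu']
      ring
    have e2 : ∑ i, ∑ j, symPart G i j * symPart (fun i j => g j * (u i - u' i)) i j
      = ∑ i, ∑ j, ((U i - U' i) * g j * symPart G i j
        - (e i - e' i) * g j * symPart G i j) := by
      rw [sum_mul_symPart (symPart_symm G)]
      refine Finset.sum_congr rfl fun i _ => Finset.sum_congr rfl fun j _ => ?_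
      rw [hu, hu']
      ring
    simp only [e1, add_mul, Finset.sum_add_distrib, add_sub_assoc]
    congr 1
    rw [← e2]
    exact Finset.sum_congr rfl fun i _ => Finset.sum_congr rfl fun j _ => mul_comm _ _
  have h3 : ∀ i j, symPart Gu' i j = symPart GU' i j - symPart G' i j := fun i j => by
    simp only [symPart, hGu']
    ring
  rw [h1, h2]
  simp only [h3, Finset.mul_sum, ← Finset.sum_add_distrib, ← Finset.sum_sub_distrib]
  exact Finset.sum_congr rfl fun i _ => Finset.sum_congr rfl fun j _ => by ring

/-- Subtracting div(ru'(U·e)) and adding half of div(ru'|e|²) removes every derivative of e. What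
remains carries either ∇U or div(ru') = r div u' + u'·g. -/
theorem convection_identity {e U u u' g : Fin d → ℝ} {G GU Gu' : Fin d → Fin d → ℝ} {r : ℝ}
    (hu : ∀ i, u i = U i - e i) :
    ∑ i, ∑ j, r * u i * u' j * G i j
      - ∑ i, ∑ j, (r * (u' j * U i * G i j + u' j * e i * GU i j + U i * e i * Gu' j j)
        + g j * (u' j * U i * e i))
      + 1 / 2 * ∑ i, ∑ j, (r * (u' j * e i * G i j + u' j * e i * G i j + e i * e i * Gu' j j)
        + g j * (u' j * e i * e i))
    = - ∑ i, (∑ j, GU i j * (r * u' j)) * e i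
      - (r * ∑ j, Gu' j j + ∑ j, u' j * g j) * (∑ i, U i * e i - 1 / 2 * ∑ i, e i ^ 2) := by
  have h1 : (r * ∑ j, Gu' j j + ∑ j, u' j * g j) * (∑ i, U i * e i - 1 / 2 * ∑ i, e i ^ 2)
      = ∑ i, ∑ j, (U i * e i - 1 / 2 * e i ^ 2) * (r * Gu' j j + u' j * g j) := by
    rw [← Finset.sum_mul_sum, Finset.mul_sum, ← Finset.sum_add_distrib, Finset.mul_sum,
      ← Finset.sum_sub_distrib, mul_comm]
  rw [h1, ← Finset.sum_neg_distrib]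
  simp only [Finset.mul_sum, Finset.sum_mul, ← Finset.sum_add_distrib, ← Finset.sum_sub_distrib,
    ← Finset.sum_neg_distrib]
  refine Finset.sum_congr rfl fun i _ => Finset.sum_congr rfl fun j _ => ?_
  rw [hu]
  ring

/-- Write ru - r'u' = r'(u - u') + (r - r')u and polarize 2r'(e - e')·e. The leftover terms in r -
r' are kept because they cancel against the convection. -/
theorem inertia_identity {e e' U U' u u' m m' W : Fin d → ℝ} {s r r' τ : ℝ} (hτ : τ ≠ 0)
    (hu : ∀ i, u i = U i - e i) (hu' : ∀ i, u' i = U' i - e' i) (hm : ∀ i, m i = r * u i)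
    (hm' : ∀ i, m' i = r' * u' i) :
    2 * τ * (∑ i, s * W i * e i - ∑ i, (m i - m' i) / τ * e i)
    = r * ∑ i, e i ^ 2 - r' * ∑ i, e' i ^ 2 + r' * ∑ i, (e i - e' i) ^ 2
      + (r - r') * ∑ i, e i ^ 2 - 2 * (r - r') * ∑ i, U i * e i
      + 2 * τ * ∑ i, (s * W i - r' * ((U i - U' i) / τ)) * e i := by
  simp only [Finset.mul_sum, ← Finset.sum_add_distrib, ← Finset.sum_sub_distrib]
  refine Finset.sum_congr rfl fun i _ => ?_
  rw [hm, hm', hu, hu']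
  field_simp
  ring

/-- The discrete energy identity at a point. -/
theorem energy_identity {e e' U U' u u' m m' W f g g' : Fin d → ℝ}
    {G G' GU GU' Gu Gu' GM : Fin d → Fin d → ℝ} {s r r' τ η₁ h ν Λ l P P' p' R : ℝ} (hτ : τ ≠ 0)
    (hu : ∀ i, u i = U i - e i) (hu' : ∀ i, u' i = U' i - e' i) (hm : ∀ i, m i = r * u i)
    (hm' : ∀ i, m' i = r' * u' i)
    (hGu : ∀ i j, Gu i j = GU i j - G i j) (hGu' : ∀ i j, Gu' i j = GU' i j - G' i j)
    (hGM : ∀ i j, GM i j = r * (Gu i j - Gu' i j) + g j * (u i - u' i))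
    (hdU : ∑ i, GU i i = 0) (hdU' : ∑ i, GU' i i = 0)
    (hR : (r - r') / τ + ∑ j, u' j * g' j = R) :
    2 * τ * ((∑ i, ((s * W i + (∑ j, s * U j * GU i j) - f i) * e i
        + ∑ j, (2 * (η₁ * symPart GU i j) - if i = j then P else 0) * G i j))
      - (∑ i, (m i - m' i) / τ * e i + 2 * ν * ∑ i, ∑ j, symPart GM i j * symPart G i j
        + 2 * ∑ i, ∑ j, h * symPart Gu' i j * symPart G i j
        + Λ * ((∑ i, GM i i) * ∑ i, G i i) + l * ((∑ i, Gu' i i) * ∑ i, G i i)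
        - p' * (∑ i, G i i) - ∑ i, ∑ j, r' * u i * u' j * G i j
        - 1 / 2 * ∑ i, r' * u i * (∑ j, Gu' j j) * e i - 1 / 2 * ∑ i, R * u i * e i
        - ∑ i, f i * e i)
      - ∑ i, ∑ j, (r' * (u' j * U i * G i j + u' j * e i * GU i j + U i * e i * Gu' j j)
        + g' j * (u' j * U i * e i))
      + 1 / 2 * ∑ i, ∑ j, (r' * (u' j * e i * G i j + u' j * e i * G i j + e i * e i * Gu' j j)
        + g' j * (u' j * e i * e i)))
    = (r * ∑ i, e i ^ 2 - r' * ∑ i, e' i ^ 2 + r' * ∑ i, (e i - e' i) ^ 2)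
      + 2 * τ * (∑ i, (s * W i - r' * ((U i - U' i) / τ)) * e i
        + ∑ i, (∑ j, GU i j * (s * U j - r' * u' j)) * e i
        + 1 / 2 * r' * (∑ i, G' i i) * (∑ i, U i * e i) - 1 / 2 * R * (∑ i, U i * e i)
        + 2 * (η₁ - h) * (∑ i, ∑ j, symPart GU i j * symPart G i j)
        + 2 * (h - ν * r) * (∑ i, ∑ j, (symPart GU i j - symPart GU' i j) * symPart G i j)
        + 2 * (h * (∑ i, ∑ j, symPart G i j * symPart G' i j) + ν * r *
          ((∑ i, ∑ j, symPart G i j ^ 2) - ∑ i, ∑ j, symPart G i j * symPart G' i j))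
        - 2 * ν * (∑ i, ∑ j, (U i - U' i) * g j * symPart G i j)
        + 2 * ν * (∑ i, ∑ j, (e i - e' i) * g j * symPart G i j)
        - Λ * (∑ i, g i * (U i - U' i)) * (∑ i, G i i)
        + Λ * (∑ i, g i * (e i - e' i)) * (∑ i, G i i)
        + (Λ * (r * (((∑ i, G i i) - ∑ i, G' i i) * ∑ i, G i i))
          + l * (∑ i, G' i i) * (∑ i, G i i) - (P' - p') * (∑ i, G i i))
        - (P - P') * (∑ i, G i i)) := by
  have v := viscous_identity (η₁ := η₁) (h := h) (ν := ν) hu hu' hGu hGu' hGM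
  have c := convection_identity (g := g') (u' := u') (G := G) (GU := GU) (Gu' := Gu') (r := r') hu
  have t := inertia_identity (W := W) (s := s) hτ hu hu' hm hm'
  have d1 : ∑ i, Gu' i i = - ∑ i, G' i i := by
    simp only [hGu', Finset.sum_sub_distrib, hdU', zero_sub]
  have d2 : ∑ i, GM i i = r * (∑ i, G' i i - ∑ i, G i i)
      + ∑ i, g i * (U i - U' i) - ∑ i, g i * (e i - e' i) := by
    have h1 : ∑ i, GM i i = r * (∑ i, GU i i - ∑ i, GU' i i) + (r * (∑ i, G' i i - ∑ i, G i i)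
        + ∑ i, g i * (U i - U' i) - ∑ i, g i * (e i - e' i)) := by
      simp only [hGM, hGu, hGu', hu, hu', Finset.mul_sum, ← Finset.sum_add_distrib,
        ← Finset.sum_sub_distrib]
      exact Finset.sum_congr rfl fun i _ => by ring
    rw [h1, hdU, hdU']
    ring
  have n1 : ∑ i, ((s * W i + (∑ j, s * U j * GU i j) - f i) * e i
        + ∑ j, (2 * (η₁ * symPart GU i j) - if i = j then P else 0) * G i j)
      = ∑ i, s * W i * e i + ∑ i, (∑ j, GU i j * (s * U j)) * e i - ∑ i, f i * e i
        + ∑ i, ∑ j, 2 * (η₁ * symPart GU i j) * G i j - P * ∑ i, G i i := by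
    rw [← sum_diag_mul P G]
    simp only [← Finset.sum_add_distrib, ← Finset.sum_sub_distrib]
    refine Finset.sum_congr rfl fun i _ => ?_
    simp only [sub_mul _ (if _ then P else 0), Finset.sum_sub_distrib]
    have : ∀ j, s * U j * GU i j = GU i j * (s * U j) := fun j => by ring
    simp only [this]
    ring
  have n2 : ∑ i, (∑ j, GU i j * (s * U j - r' * u' j)) * e i
      = ∑ i, (∑ j, GU i j * (s * U j)) * e i - ∑ i, (∑ j, GU i j * (r' * u' j)) * e i := by
    simp only [mul_sub, Finset.sum_sub_distrib, sub_mul]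
  have n3 : ∀ k : ℝ, ∑ i, k * u i * e i = k * (∑ i, U i * e i - ∑ i, e i ^ 2) := by
    intro k
    rw [← Finset.sum_sub_distrib, Finset.mul_sum]
    refine Finset.sum_congr rfl fun i _ => ?_
    rw [hu]
    ring
  have n4 : ∑ i, r' * u i * (∑ j, Gu' j j) * e i
      = r' * (∑ j, Gu' j j) * (∑ i, U i * e i - ∑ i, e i ^ 2) := by
    rw [← n3]
    exact Finset.sum_congr rfl fun i _ => by ring
  -- The density step trades u'·∇ρⁿ in div(ρⁿuⁿ) for R and the density increment. The increment
  -- cancels the leftovers of `inertia_identity`; with the corrections in the scheme, the parts in R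
  -- and div u' keep only half of U·e and nothing of |e|².
  have hR' : τ * (∑ j, u' j * g' j) = τ * R - (r - r') := by
    rw [← hR]
    field_simp
    ring
  rw [n1, n2, n3, n4, d1, d2]
  rw [d1] at c
  linear_combination (2 * τ) * v + (2 * τ) * c + t
    - 2 * (∑ i, U i * e i - 1 / 2 * ∑ i, e i ^ 2) * hR'

end Identity

/-! ### Consistency errors and the pointwise inequality -/

section Pointwise

variable {d : ℕ}

theorem sum_sum_mul_sq_le (A B : Fin d → Fin d → ℝ) :
    (∑ i, ∑ j, A i j * B i j) ^ 2 ≤ (∑ i, ∑ j, A i j ^ 2) * ∑ i, ∑ j, B i j ^ 2 := by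
  simp only [← Finset.sum_product']
  exact Finset.sum_mul_sq_le_sq_mul_sq _ _ _

theorem sum_mul_mul_sq_le (v g : Fin d → ℝ) (X : Fin d → Fin d → ℝ) :
    (∑ i, ∑ j, v i * g j * X i j) ^ 2 ≤ (∑ i, v i ^ 2) * (∑ j, g j ^ 2) * ∑ i, ∑ j, X i j ^ 2 := by
  refine (sum_sum_mul_sq_le (fun i j => v i * g j) X).trans (le_of_eq ?_)
  rw [Finset.sum_mul_sum (f := fun i => v i ^ 2) (g := fun j => g j ^ 2)]
  simp only [mul_pow]

theorem trace_sq_le (hd : d ≤ 3) (G : Fin d → Fin d → ℝ) :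
    (∑ i, G i i) ^ 2 ≤ 3 * ∑ i, ∑ j, symPart G i j ^ 2 := by
  have h1 : (∑ i, G i i) ^ 2 ≤ d * ∑ i, (G i i) ^ 2 := by
    have := sq_sum_le_card_mul_sum_sq (s := (Finset.univ : Finset (Fin d))) (f := fun i => G i i)
    simpa using this
  have h2 : ∑ i, (G i i) ^ 2 ≤ ∑ i, ∑ j, symPart G i j ^ 2 := by
    refine Finset.sum_le_sum fun i _ => ?_
    have : (G i i) ^ 2 = symPart G i i ^ 2 := by
      simp only [symPart]
      ring
    rw [this]
    exact Finset.single_le_sum (f := fun j => symPart G i j ^ 2) (fun j _ => sq_nonneg _)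
      (Finset.mem_univ i)
  have h3 : (d : ℝ) ≤ 3 := by exact_mod_cast hd
  exact h1.trans (mul_le_mul h3 h2 (Finset.sum_nonneg fun i _ => sq_nonneg _) (by norm_num))

theorem sum_sq_le_of_abs_le {v : Fin d → ℝ} {B : ℝ} (h : ∀ i, |v i| ≤ B) :
    ∑ i, v i ^ 2 ≤ d * B ^ 2 := by
  refine (Finset.sum_le_card_nsmul _ _ (B ^ 2) fun i _ => ?_).trans (by simp)
  rw [← sq_abs]
  exact pow_le_pow_left₀ (abs_nonneg _) (h i) 2

theorem sum_sum_symPart_sq_le (hd : d ≤ 3) {G : Fin d → Fin d → ℝ} {K : ℝ}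
    (hG : ∀ i j, |G i j| ≤ K) : ∑ i, ∑ j, symPart G i j ^ 2 ≤ 9 * K ^ 2 := by
  have h1 : ∀ i j, |symPart G i j| ≤ K := fun i j => by
    have h1 := abs_le.1 (hG i j)
    have h2 := abs_le.1 (hG j i)
    rw [symPart, abs_le]
    constructor <;> linarith
  have h3 : (d : ℝ) ≤ 3 := by exact_mod_cast hd
  have h0 : (0 : ℝ) ≤ d := by positivity
  calc ∑ i, ∑ j, symPart G i j ^ 2 ≤ ∑ _i : Fin d, d * K ^ 2 :=
        Finset.sum_le_sum fun i _ => sum_sq_le_of_abs_le (h1 i)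
    _ = d * d * K ^ 2 := by simp [mul_assoc]
    _ ≤ 3 * 3 * K ^ 2 := by gcongr
    _ = 9 * K ^ 2 := by ring

theorem two_mul_sum_sum_le (X Y : Fin d → Fin d → ℝ) :
    2 * ∑ i, ∑ j, X i j * Y i j ≤ ∑ i, ∑ j, X i j ^ 2 + ∑ i, ∑ j, Y i j ^ 2 := by
  simp only [Finset.mul_sum, ← Finset.sum_add_distrib]
  refine Finset.sum_le_sum fun i _ => Finset.sum_le_sum fun j _ => ?_
  nlinarith [sq_nonneg (X i j - Y i j)]

theorem neg_two_mul_sum_le (x e : Fin d → ℝ) :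
    -(2 * ∑ i, x i * e i) ≤ ∑ i, e i ^ 2 + ∑ i, x i ^ 2 := by
  simp only [Finset.mul_sum, ← Finset.sum_add_distrib, ← Finset.sum_neg_distrib]
  refine Finset.sum_le_sum fun i _ => ?_
  nlinarith [sq_nonneg (x i + e i)]

theorem sq_le_two_of_abs_le {x a b : ℝ} (h : |x| ≤ a + b) : x ^ 2 ≤ 2 * (a ^ 2 + b ^ 2) := by
  have : x ^ 2 ≤ (a + b) ^ 2 := by
    rw [← sq_abs]
    exact pow_le_pow_left₀ (abs_nonneg _) h 2
  nlinarith [sq_nonneg (a - b)]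

theorem sq_le_three_of_abs_le {x a b c : ℝ} (h : |x| ≤ a + b + c) :
    x ^ 2 ≤ 3 * (a ^ 2 + b ^ 2 + c ^ 2) := by
  have : x ^ 2 ≤ (a + b + c) ^ 2 := by
    rw [← sq_abs]
    exact pow_le_pow_left₀ (abs_nonneg _) h 2
  nlinarith [sq_nonneg (a - b), sq_nonneg (a - c), sq_nonneg (b - c)]

/-- Constant in the estimates of the inertial consistency errors. -/
noncomputable def inertiaConst (K M : ℝ) : ℝ :=
  (6 + 81 * K ^ 2) * (K ^ 2 + (K ^ 2 + M * K) ^ 2 + M ^ 2)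

theorem inertiaConst_nonneg (K M : ℝ) : 0 ≤ inertiaConst K M := by
  unfold inertiaConst
  positivity

/-- Three sources of error: the exact density moves by O(τ) in one step, the discrete density
differs from the exact one at the old time, and the difference quotient V/τ differs from W by a
Taylor remainder O(τ). -/
theorem acceleration_error (hd : d ≤ 3) {W V e : Fin d → ℝ} {s s' r' τ K M : ℝ} (hτ : 0 < τ)
    (hK : 0 ≤ K) (hr0 : 0 ≤ r') (hrM : r' ≤ M) (hs : |s - s'| ≤ K * τ) (hW : ∀ i, |W i| ≤ K)
    (hV : ∀ i, |V i - τ * W i| ≤ K * τ ^ 2) :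
    -(2 * ∑ i, (s * W i - r' * (V i / τ)) * e i)
      ≤ ∑ i, e i ^ 2 + inertiaConst K M * ((s' - r') ^ 2 + τ ^ 2) := by
  have hM := hr0.trans hrM
  have h1 : ∀ i, |s * W i - r' * (V i / τ)| ≤ K * |s' - r'| + (K ^ 2 + M * K) * τ := by
    intro i
    have e1 : s * W i - r' * (V i / τ)
        = (s - s') * W i + (s' - r') * W i - r' * ((V i - τ * W i) / τ) := by
      field_simp
      ring
    have b1 : |(s - s') * W i| ≤ K * τ * K := by
      rw [abs_mul]
      exact mul_le_mul hs (hW i) (abs_nonneg _) (by positivity)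
    have b2 : |(s' - r') * W i| ≤ |s' - r'| * K := by
      rw [abs_mul]
      exact mul_le_mul_of_nonneg_left (hW i) (abs_nonneg _)
    have b3 : |r' * ((V i - τ * W i) / τ)| ≤ M * (K * τ) := by
      rw [abs_mul, abs_of_nonneg hr0, abs_div, abs_of_pos hτ]
      refine mul_le_mul hrM ?_ (by positivity) hM
      rw [div_le_iff₀ hτ]
      linarith [hV i]
    rw [e1]
    refine (abs_sub _ _).trans ((add_le_add (abs_add_le _ _) le_rfl).trans ?_)
    linarith
  have h2 : ∑ i, (s * W i - r' * (V i / τ)) ^ 2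
      ≤ inertiaConst K M * ((s' - r') ^ 2 + τ ^ 2) := by
    have h3 : (d : ℝ) ≤ 3 := by exact_mod_cast hd
    calc ∑ i, (s * W i - r' * (V i / τ)) ^ 2
        ≤ ∑ _i : Fin d, 2 * ((K * |s' - r'|) ^ 2 + ((K ^ 2 + M * K) * τ) ^ 2) :=
          Finset.sum_le_sum fun i _ => sq_le_two_of_abs_le (h1 i)
      _ = d * (2 * (K ^ 2 * (s' - r') ^ 2 + (K ^ 2 + M * K) ^ 2 * τ ^ 2)) := by
          simp [mul_pow]
      _ ≤ 3 * (2 * (K ^ 2 * (s' - r') ^ 2 + (K ^ 2 + M * K) ^ 2 * τ ^ 2)) := by gcongr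
      _ ≤ 6 * ((K ^ 2 + (K ^ 2 + M * K) ^ 2 + M ^ 2) * ((s' - r') ^ 2 + τ ^ 2)) := by
          have p1 : 0 ≤ K ^ 2 * τ ^ 2 := by positivity
          have p2 : 0 ≤ (K ^ 2 + M * K) ^ 2 * (s' - r') ^ 2 := by positivity
          have p3 : 0 ≤ M ^ 2 * ((s' - r') ^ 2 + τ ^ 2) := by positivity
          nlinarith
      _ ≤ _ := by
          unfold inertiaConst
          have p : 0 ≤ 81 * K ^ 2 * (K ^ 2 + (K ^ 2 + M * K) ^ 2 + M ^ 2)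
            * ((s' - r') ^ 2 + τ ^ 2) := by positivity
          linarith
  exact (neg_two_mul_sum_le _ _).trans (add_le_add le_rfl h2)

/-- The scheme transports with the old mass flux r'u', so the errors are the time shift of ρ and U,
the old density error and the old velocity error. No derivative of an error occurs, since ∇U is
bounded. -/
theorem convection_error (hd : d ≤ 3) {U U' e e' : Fin d → ℝ} {GU : Fin d → Fin d → ℝ}
    {s s' r' τ K M : ℝ} (hτ : 0 < τ)
    (hK : 0 ≤ K) (hr0 : 0 ≤ r') (hrM : r' ≤ M) (hs : |s - s'| ≤ K * τ) (hU : ∀ i, |U i| ≤ K)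
    (hV : ∀ i, |U i - U' i| ≤ K * τ) (hGU : ∀ i j, |GU i j| ≤ K) :
    -(2 * ∑ i, (∑ j, GU i j * (s * U j - r' * (U' j - e' j))) * e i)
      ≤ ∑ i, e i ^ 2 + inertiaConst K M * ((s' - r') ^ 2 + τ ^ 2 + ∑ i, e' i ^ 2) := by
  have hM := hr0.trans hrM
  have h3 : (d : ℝ) ≤ 3 := by exact_mod_cast hd
  have h1 : ∀ j, |s * U j - r' * (U' j - e' j)|
      ≤ K * |s' - r'| + (K ^ 2 + M * K) * τ + M * |e' j| := by
    intro j
    have e1 : s * U j - r' * (U' j - e' j)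
        = (s - s') * U j + (s' - r') * U j + r' * (U j - U' j) + r' * e' j := by ring
    have b1 : |(s - s') * U j| ≤ K * τ * K := by
      rw [abs_mul]
      exact mul_le_mul hs (hU j) (abs_nonneg _) (by positivity)
    have b2 : |(s' - r') * U j| ≤ |s' - r'| * K := by
      rw [abs_mul]
      exact mul_le_mul_of_nonneg_left (hU j) (abs_nonneg _)
    have b3 : |r' * (U j - U' j)| ≤ M * (K * τ) := by
      rw [abs_mul, abs_of_nonneg hr0]
      exact mul_le_mul hrM (hV j) (abs_nonneg _) hM
    have b4 : |r' * e' j| ≤ M * |e' j| := by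
      rw [abs_mul, abs_of_nonneg hr0]
      exact mul_le_mul_of_nonneg_right hrM (abs_nonneg _)
    rw [e1]
    refine (abs_add_le _ _).trans ((add_le_add ((abs_add_le _ _).trans
      (add_le_add (abs_add_le _ _) le_rfl)) le_rfl).trans ?_)
    linarith
  set Y := ∑ j, (s * U j - r' * (U' j - e' j)) ^ 2 with hY
  have hY0 : 0 ≤ Y := Finset.sum_nonneg fun j _ => sq_nonneg _
  set A := (K ^ 2 + (K ^ 2 + M * K) ^ 2 + M ^ 2) with hA
  set S := (s' - r') ^ 2 + τ ^ 2 + ∑ i, e' i ^ 2 with hS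
  have hE0 : 0 ≤ ∑ i, e' i ^ 2 := Finset.sum_nonneg fun j _ => sq_nonneg _
  have hYb : Y ≤ 9 * (A * S) := by
    calc Y ≤ ∑ j, 3 * ((K * |s' - r'|) ^ 2 + ((K ^ 2 + M * K) * τ) ^ 2 + (M * |e' j|) ^ 2) :=
          Finset.sum_le_sum fun j _ => sq_le_three_of_abs_le (h1 j)
      _ = d * (3 * (K ^ 2 * (s' - r') ^ 2 + (K ^ 2 + M * K) ^ 2 * τ ^ 2))
          + 3 * (M ^ 2 * ∑ j, e' j ^ 2) := by
          simp only [mul_pow, sq_abs, mul_add, Finset.sum_add_distrib, ← Finset.mul_sum,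
            Finset.sum_const, Finset.card_univ, Fintype.card_fin, nsmul_eq_mul]
          ring
      _ ≤ 3 * (3 * (K ^ 2 * (s' - r') ^ 2 + (K ^ 2 + M * K) ^ 2 * τ ^ 2))
          + 3 * (M ^ 2 * ∑ j, e' j ^ 2) := by gcongr
      _ ≤ 9 * (A * S) := by
          have p1 : 0 ≤ K ^ 2 * (τ ^ 2 + ∑ j, e' j ^ 2) := by positivity
          have p2 : 0 ≤ (K ^ 2 + M * K) ^ 2 * ((s' - r') ^ 2 + ∑ j, e' j ^ 2) := by positivity
          have p3 : 0 ≤ M ^ 2 * ((s' - r') ^ 2 + τ ^ 2) := by positivity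
          have p4 : 0 ≤ M ^ 2 * ∑ j, e' j ^ 2 := by positivity
          rw [hA, hS]
          linarith
  have h2 : ∀ i, (∑ j, GU i j * (s * U j - r' * (U' j - e' j))) ^ 2 ≤ 3 * K ^ 2 * Y := by
    intro i
    refine (Finset.sum_mul_sq_le_sq_mul_sq _ _ _).trans (mul_le_mul_of_nonneg_right ?_ hY0)
    exact (sum_sq_le_of_abs_le (hGU i)).trans (by gcongr)
  refine (neg_two_mul_sum_le _ _).trans (add_le_add le_rfl ?_)
  have hAS : 0 ≤ A * S := by positivity
  calc ∑ i, (∑ j, GU i j * (s * U j - r' * (U' j - e' j))) ^ 2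
      ≤ ∑ _i : Fin d, 3 * K ^ 2 * Y := Finset.sum_le_sum fun i _ => h2 i
    _ = d * (3 * K ^ 2 * Y) := by simp
    _ ≤ 3 * (3 * K ^ 2 * (9 * (A * S))) := by gcongr
    _ ≤ inertiaConst K M * S := by
        unfold inertiaConst
        rw [← hA]
        linarith

/-- The discrete energy inequality at a point. The quantities at the new time are `e`, `U`, …, those
at the previous time are `e'`, `U'`, …. -/
theorem energy_pointwise (hd : d ≤ 3) {e e' U U' u u' m m' W f g g' : Fin d → ℝ}
    {G G' GU GU' Gu Gu' GM : Fin d → Fin d → ℝ}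
    {s s' r r' τ T γ η₁ h ν Λ l P P' p p' R K M κ α : ℝ}
    (hτ : 0 < τ) (hτT : τ ≤ T) (hν : 0 ≤ ν) (hl : 0 < l) (hh : 0 < h) (hr0 : 0 ≤ r')
    (hr'M : r' ≤ M) (hrM : r ≤ M) (hκ : 1 ≤ κ * h) (hκ0 : 0 ≤ κ) (hK : 0 ≤ K)
    (hγ1 : γ ^ 2 ≤ 1 / 4) (hγ2 : 64 * ν * γ ^ 2 ≤ 1)
    (hνr : h ≤ ν * r) (hincν : ν * (r - r') ≤ h)
    (hΛr : 11 / 10 * l ≤ Λ * r) (hincΛ : Λ * (r - r') ≤ l)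
    (hGν : τ * ν * ∑ j, g j ^ 2 ≤ γ ^ 2 * (r' * h))
    (hGΛ : 2 * τ * Λ ^ 2 * ∑ j, g j ^ 2 ≤ γ ^ 2 * (r' * h))
    (hu : ∀ i, u i = U i - e i) (hu' : ∀ i, u' i = U' i - e' i) (hm : ∀ i, m i = r * u i)
    (hm' : ∀ i, m' i = r' * u' i)
    (hGu : ∀ i j, Gu i j = GU i j - G i j) (hGu' : ∀ i j, Gu' i j = GU' i j - G' i j)
    (hGM : ∀ i j, GM i j = r * (Gu i j - Gu' i j) + g j * (u i - u' i))
    (hdU : ∑ i, GU i i = 0) (hdU' : ∑ i, GU' i i = 0)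
    (hR : (r - r') / τ + ∑ j, u' j * g' j = R) (hp : p = p' - l * ∑ i, Gu i i)
    (hs : |s - s'| ≤ K * τ) (hP : |P - P'| ≤ K * τ) (hη : |η₁ - h| ≤ α * |s - r|)
    (hU : ∑ i, U i ^ 2 ≤ K ^ 2) (hV : ∑ i, (U i - U' i) ^ 2 ≤ (K * τ) ^ 2) (hW : ∀ i, |W i| ≤ K)
    (hVW : ∀ i, |U i - U' i - τ * W i| ≤ K * τ ^ 2) (hGU : ∀ i j, |GU i j| ≤ K) :
    r * ∑ i, e i ^ 2 + τ / l * (P - p) ^ 2 + 2 * τ * ν * (r * ∑ i, ∑ j, symPart G i j ^ 2)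
      + τ * Λ * (r * (∑ i, G i i) ^ 2) + τ * (h * ∑ i, ∑ j, symPart G i j ^ 2)
    ≤ r' * ∑ i, e' i ^ 2 + τ / l * (P' - p') ^ 2 + 2 * τ * ν * (r' * ∑ i, ∑ j, symPart G' i j ^ 2)
      + τ * Λ * (r' * (∑ i, G' i i) ^ 2)
      + 2 * τ * ((∑ i, ((s * W i + (∑ j, s * U j * GU i j) - f i) * e i
        + ∑ j, (2 * (η₁ * symPart GU i j) - if i = j then P else 0) * G i j))
      - (∑ i, (m i - m' i) / τ * e i + 2 * ν * ∑ i, ∑ j, symPart GM i j * symPart G i j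
        + 2 * ∑ i, ∑ j, h * symPart Gu' i j * symPart G i j
        + Λ * ((∑ i, GM i i) * ∑ i, G i i) + l * ((∑ i, Gu' i i) * ∑ i, G i i)
        - p' * (∑ i, G i i) - ∑ i, ∑ j, r' * u i * u' j * G i j
        - 1 / 2 * ∑ i, r' * u i * (∑ j, Gu' j j) * e i - 1 / 2 * ∑ i, R * u i * e i
        - ∑ i, f i * e i)
      - ∑ i, ∑ j, (r' * (u' j * U i * G i j + u' j * e i * GU i j + U i * e i * Gu' j j)
        + g' j * (u' j * U i * e i))
      + 1 / 2 * ∑ i, ∑ j, (r' * (u' j * e i * G i j + u' j * e i * G i j + e i * e i * Gu' j j)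
        + g' j * (u' j * e i * e i)))
      + τ ^ 2 / l * (P - p) ^ 2
      + (2 + 24 * κ * M ^ 2 * K ^ 2 + 5 / 2 * M ^ 2 * K ^ 2 / l + K ^ 2) * (τ * ∑ i, e i ^ 2)
      + inertiaConst K M * (τ * ∑ i, e' i ^ 2)
      + (2 * inertiaConst K M + 1 + 1152 * κ * α ^ 2 * K ^ 2)
        * (τ * ((s' - r') ^ 2 + (s - r) ^ 2 + R ^ 2))
      + 128 * κ * ν ^ 2 * M ^ 2
        * (τ * ∑ i, ∑ j, (symPart GU i j - symPart GU' i j) ^ 2)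
      + (2 * inertiaConst K M * T + 14 * M * K ^ 2 + 96 * κ * K ^ 2 * T + K ^ 2 / l) * τ ^ 2 := by
  rw [energy_identity hτ.ne' hu hu' hm hm' hGu hGu' hGM hdU hdU' hR]
  have hUi : ∀ i, |U i| ≤ K := fun i => by
    refine abs_le_of_sq_le_sq ((Finset.single_le_sum (f := fun i => U i ^ 2)
      (fun j _ => sq_nonneg _) (Finset.mem_univ i)).trans hU) hK
  have hVi : ∀ i, |U i - U' i| ≤ K * τ := fun i => by
    refine abs_le_of_sq_le_sq ((Finset.single_le_sum (f := fun i => (U i - U' i) ^ 2)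
      (fun j _ => sq_nonneg _) (Finset.mem_univ i)).trans hV) (by positivity)
  have hXX : 0 ≤ ∑ i, ∑ j, symPart G i j ^ 2 :=
    Finset.sum_nonneg fun i _ => Finset.sum_nonneg fun j _ => sq_nonneg _
  have hEE : 0 ≤ ∑ i, e i ^ 2 := Finset.sum_nonneg fun j _ => sq_nonneg _
  refine energy_scalar (T := T) (γ := γ) (G2 := ∑ j, g j ^ 2) (VV := ∑ i, (U i - U' i) ^ 2)
    hτ hτT hν hl hh hr0 hr'M hrM hκ hκ0 hγ1 hγ2 hνr hincν hΛr hincΛ hGν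
    hGΛ hEE (Finset.sum_nonneg fun j _ => sq_nonneg _) hXX
    (Finset.sum_nonneg fun i _ => Finset.sum_nonneg fun j _ => sq_nonneg _)
    (Finset.sum_nonneg fun i _ => Finset.sum_nonneg fun j _ => sq_nonneg _)
    (Finset.sum_nonneg fun j _ => sq_nonneg _)
    (two_mul_sum_sum_le _ _) (trace_sq_le hd G) ?_ ?_ (hV.trans (le_of_eq (by ring))) ?_
    (sum_mul_mul_sq_le _ _ _) (Finset.sum_mul_sq_le_sq_mul_sq _ _ _) (sum_mul_mul_sq_le _ _ _)
    (Finset.sum_mul_sq_le_sq_mul_sq _ _ _) ?_ ?_ (sum_sum_mul_sq_le _ _)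
    (acceleration_error hd hτ hK hr0 hr'M hs hW hVW) (inertiaConst_nonneg K M) ?_
  -- As div U = 0, the pressure update reads l div e = q₀ - q₁ + δ, with q₀, q₁ the old and new
  -- pressure errors and δ = P - P' the exact pressure increment.
  · have : ∑ i, Gu i i = - ∑ i, G i i := by
      simp only [hGu, Finset.sum_sub_distrib, hdU, zero_sub]
    rw [hp, this]
    ring
  · rw [← mul_pow, ← sq_abs]
    exact pow_le_pow_left₀ (abs_nonneg _) hP 2
  · rw [← sq_abs, ← sq_abs (s - r), ← mul_pow]
    exact pow_le_pow_left₀ (abs_nonneg _) hη 2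
  · exact (Finset.sum_mul_sq_le_sq_mul_sq _ _ _).trans (mul_le_mul_of_nonneg_right hU hEE)
  · exact (sum_sum_mul_sq_le _ _).trans
      (mul_le_mul_of_nonneg_right (sum_sum_symPart_sq_le hd hGU) hXX)
  · simp only [hu']
    exact convection_error hd hτ hK hr0 hr'M hs hUi hVi hGU

end Pointwise

/-! ### The parameters of the scheme -/

section Parameters

variable {d : ℕ} {Ω : Set (E d)} {η : ℝ → ℝ} {α : ℝ≥0}

theorem ae_abs_le_of_eLpNorm_top_le {β : Type*} [MeasurableSpace β] {μ : Measure β} {g : β → ℝ}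
    {B : ℝ} (hB : 0 ≤ B) (h : eLpNorm g ∞ μ ≤ ENNReal.ofReal B) : ∀ᵐ x ∂μ, |g x| ≤ B := by
  filter_upwards [ae_le_eLpNormEssSup (f := g) (μ := μ)] with x hx
  rw [← eLpNorm_exponent_top] at hx
  have h1 := hx.trans h
  rwa [← ofReal_norm, Real.norm_eq_abs, ENNReal.ofReal_le_ofReal_iff hB] at h1

/-- The boundedness hypothesis excludes the norm ⊤, whose `toReal` would be 0. -/
theorem ae_abs_le_toReal_eLpNorm_top {β : Type*} [MeasurableSpace β] {μ : Measure β} {g : β → ℝ}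
    {B : ℝ} (h : ∀ᵐ x ∂μ, |g x| ≤ B) : ∀ᵐ x ∂μ, |g x| ≤ (eLpNorm g ∞ μ).toReal := by
  refine ae_abs_le_of_eLpNorm_top_le ENNReal.toReal_nonneg ?_
  rw [ENNReal.ofReal_toReal]
  rw [eLpNorm_exponent_top]
  exact (eLpNormEssSup_lt_top_of_ae_bound h).ne

theorem abs_viscosity_le (hηL : LipschitzOnWith α η (Ioi 0)) {c M s : ℝ} (hc : 0 < c)
    (h1 : c ≤ s) (h2 : s ≤ M) : |η s| ≤ |η c| + α * M := by
  have h := hηL.dist_le_mul s (hc.trans_le h1) c hc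
  rw [Real.dist_eq, Real.dist_eq, abs_of_nonneg (by linarith : (0 : ℝ) ≤ s - c)] at h
  have h3 : |η s| ≤ |η c| + |η s - η c| := by
    have := abs_add_le (η c) (η s - η c)
    simpa using this
  have h4 : (α : ℝ) * (s - c) ≤ α * M := mul_le_mul_of_nonneg_left (by linarith) α.2
  linarith

theorem memLp_viscosity (hηL : LipschitzOnWith α η (Ioi 0)) {f : E d → ℝ}
    (hf : MemLp f ∞ (vol Ω)) {c M : ℝ} (hc : 0 < c) (h1 : ∀ᵐ x ∂(vol Ω), c ≤ f x)
    (h2 : ∀ᵐ x ∂(vol Ω), f x ≤ M) : MemLp (fun x => η (f x)) ∞ (vol Ω) := by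
  -- η is controlled only on (0,∞); truncation at c gives a continuous function on the line that
  -- agrees with η on the range of f.
  have hcont : Continuous fun s => η (max s c) :=
    hηL.continuousOn.comp_continuous (by fun_prop) fun s => lt_max_of_lt_right hc
  refine memLp_top_of_bound (C := |η c| + α * M) ?_ ?_
  · refine (hcont.comp_aestronglyMeasurable hf.1).congr ?_
    filter_upwards [h1] with x hx
    simp [max_eq_left hx]
  · filter_upwards [h1, h2] with x hx hx'
    exact abs_viscosity_le hηL hc hx hx'

theorem exists_viscosity_lower_bound (hηL : LipschitzOnWith α η (Ioi 0))
    (hηpos : ∀ s, 0 < s → 0 < η s) {c M : ℝ} (hc : 0 < c) (hcM : c ≤ M) :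
    ∃ h₀ : ℝ, 0 < h₀ ∧ ∀ s, c ≤ s → s ≤ M → h₀ ≤ η s := by
  obtain ⟨x, hx, hmin⟩ := isCompact_Icc.exists_isMinOn (nonempty_Icc.2 hcM)
    (hηL.continuousOn.mono fun s hs => hc.trans_le hs.1)
  exact ⟨η x, hηpos x (hc.trans_le hx.1), fun s h1 h2 => hmin ⟨h1, h2⟩⟩

theorem nuBar_nonneg (η : ℝ → ℝ) (f : E d → ℝ) : 0 ≤ nuBar Ω η f := by
  unfold nuBar
  positivity

theorem lamBar_nonneg {lam : ℝ} (hlam : 0 ≤ lam) (f : E d → ℝ) : 0 ≤ lamBar Ω lam f := by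
  unfold lamBar
  positivity

/-- The quotient η(s)/s need not be monotone, so its bound on the values of f extends to
intermediate s only through the absence of gaps, hence through connectedness of Ω. -/
theorem viscosity_le_nuBar_mul (hΩo : IsOpen Ω) (hΩb : Bornology.IsBounded Ω)
    (hΩc : IsConnected Ω) (hηL : LipschitzOnWith α η (Ioi 0)) (hηpos : ∀ s, 0 < s → 0 < η s)
    {f : E d → ℝ} (hf : MemW1 Ω ∞ f) {c M : ℝ} (hc : 0 < c) (h1 : ∀ᵐ x ∂(vol Ω), c ≤ f x)
    (h2 : ∀ᵐ x ∂(vol Ω), f x ≤ M) {s : ℝ} (hs1 : rhoMin Ω f ≤ s) (hs2 : s ≤ rhoMax Ω f) :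
    η s ≤ nuBar Ω η f * s := by
  have := vol_ne_zero hΩo hΩc.nonempty
  have hs : 0 < s := hc.trans_le ((le_rhoMin h1 h2).trans hs1)
  have hb : ∀ᵐ x ∂(vol Ω), |η (f x) / f x| ≤ (|η c| + α * M) / c := by
    filter_upwards [h1, h2] with x hx hx'
    rw [abs_div, abs_of_pos (hc.trans_le hx)]
    have := abs_viscosity_le hηL hc hx hx'
    exact div_le_div₀ ((abs_nonneg _).trans this) this hc hx
  have hB : ∀ᵐ x ∂(vol Ω), η (f x) / f x
      ≤ (eLpNorm (fun x => η (f x) / f x) ∞ (vol Ω)).toReal := by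
    filter_upwards [ae_abs_le_toReal_eLpNorm_top hb] with x hx
    exact (le_abs_self _).trans hx
  have h3 := hf.le_of_mem_Icc hΩo hΩb hΩc h1 h2 (θ := fun s => η s / s) hB hs1 hs2
    ((hηL.continuousOn.continuousAt (Ioi_mem_nhds hs)).div continuousAt_id hs.ne')
  rw [div_le_iff₀ hs] at h3
  have h4 := hηpos s hs
  unfold nuBar
  linarith

/-- Since 1/s is monotone, comparison with the essential infimum is enough and connectedness plays
no role. The factor 11/10 is kept in the conclusion: it is the slack spent in `pressure_energy`. -/
theorem le_lamBar_mul (hΩo : IsOpen Ω) (hΩn : Ω.Nonempty) {lam : ℝ} (hlam : 0 ≤ lam)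
    {f : E d → ℝ} {c M : ℝ} (hc : 0 < c) (h1 : ∀ᵐ x ∂(vol Ω), c ≤ f x)
    (h2 : ∀ᵐ x ∂(vol Ω), f x ≤ M) {s : ℝ} (hs : rhoMin Ω f ≤ s) :
    11 / 10 * lam ≤ lamBar Ω lam f * s := by
  have := vol_ne_zero hΩo hΩn
  set L := (eLpNorm (fun x => 1 / f x) ∞ (vol Ω)).toReal with hL
  have hb : ∀ᵐ x ∂(vol Ω), |1 / f x| ≤ 1 / c := by
    filter_upwards [h1] with x hx
    rw [abs_div, abs_one, abs_of_pos (hc.trans_le hx)]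
    exact one_div_le_one_div_of_le hc hx
  have hL1 : ∀ᵐ x ∂(vol Ω), 1 / f x ≤ L := by
    filter_upwards [ae_abs_le_toReal_eLpNorm_top hb] with x hx
    exact (le_abs_self _).trans hx
  have hL0 : 0 < L := by
    obtain ⟨x, hx, hx'⟩ := (h1.and hL1).exists
    exact (one_div_pos.2 (hc.trans_le hx)).trans_le hx'
  have h3 : 1 / L ≤ rhoMin Ω f := by
    refine le_rhoMin ?_ h2
    filter_upwards [h1, hL1] with x hx hx'
    exact (one_div_le hL0 (hc.trans_le hx)).2 hx'
  have h4 : 1 ≤ L * s := by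
    have := (div_le_iff₀ hL0).1 (h3.trans hs)
    linarith
  unfold lamBar
  rw [← hL]
  have := mul_le_mul_of_nonneg_left h4 hlam
  linarith

variable {lam ν Λ τ γ : ℝ} {N : ℕ} {ρh : ℕ → E d → ℝ}

theorem sum_sq_wd_eq (f : E d → ℝ) (x : E d) : ∑ j, wd Ω j f x ^ 2 = gradNorm Ω f x ^ 2 := by
  rw [gradNorm, Real.sq_sqrt (Finset.sum_nonneg fun _ _ => sq_nonneg _)]

/-- The smallness conditions, at almost every point. -/
theorem SmallnessConditions.ae_bounds (h : SmallnessConditions Ω η lam ν Λ τ γ N ρh)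
    (hηpos : ∀ s, 0 < s → 0 < η s) (hlam : 0 < lam) (hν : 0 ≤ ν) (hτ : 0 < τ) (hγ : 0 < γ)
    {n : ℕ} (hn : n < N) {c : ℝ} (hc : 0 < c) (hr' : ∀ᵐ x ∂(vol Ω), c ≤ ρh n x)
    (hr : ∀ᵐ x ∂(vol Ω), c ≤ ρh (n + 1) x) : ∀ᵐ x ∂(vol Ω),
      τ * ν * ∑ j, wd Ω j (ρh (n + 1)) x ^ 2 ≤ γ ^ 2 * (ρh n x * η (ρh (n + 1) x)) ∧
      2 * τ * Λ ^ 2 * ∑ j, wd Ω j (ρh (n + 1)) x ^ 2 ≤ γ ^ 2 * (ρh n x * η (ρh (n + 1) x)) ∧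
      ν * (ρh (n + 1) x - ρh n x) ≤ η (ρh (n + 1) x) ∧
      Λ * (ρh (n + 1) x - ρh n x) ≤ lam := by
  have e1 : (1 : ℝ≥0∞) = ENNReal.ofReal 1 := by simp
  filter_upwards [hr, hr', ae_abs_le_of_eLpNorm_top_le hγ.le (h.grad_nu n hn),
    ae_abs_le_of_eLpNorm_top_le hγ.le (h.grad_lam n hn),
    ae_abs_le_of_eLpNorm_top_le zero_le_one ((h.incr_nu n hn).trans_eq e1),
    ae_abs_le_of_eLpNorm_top_le zero_le_one ((h.incr_lam n hn).trans_eq e1)] with x hx hx' k1 k2 k3 k4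
  have hη := hηpos _ (hc.trans_le hx)
  have hp : 0 < ρh n x * η (ρh (n + 1) x) := mul_pos (hc.trans_le hx') hη
  rw [sum_sq_wd_eq]
  refine ⟨?_, ?_, ?_, ?_⟩
  · have := pow_le_pow_left₀ (abs_nonneg _) k1 2
    rw [sq_abs, mul_pow, div_pow, Real.sq_sqrt (by positivity), Real.sq_sqrt hp.le, ← mul_div_assoc,
      div_le_iff₀ hp] at this
    exact this
  · have := pow_le_pow_left₀ (abs_nonneg _) k2 2
    rw [sq_abs, mul_pow, div_pow, mul_pow, mul_pow, Real.sq_sqrt hτ.le, Real.sq_sqrt hp.le,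
      Real.sq_sqrt zero_le_two, ← mul_div_assoc, div_le_iff₀ hp] at this
    linarith
  · have := (le_abs_self _).trans k3
    rw [div_le_iff₀ hη] at this
    linarith
  · have := (le_abs_self _).trans k4
    rw [div_le_iff₀ hlam] at this
    linarith

end Parameters

/-! ### The error functionals -/

section ErrorFunctionals

variable {d : ℕ} {Ω : Set (E d)}

theorem MemH10v.memLp_gradv {v : E d → E d} (hv : MemH10v Ω v) (i j : Fin d) :
    MemLp (gradv Ω v i j) 2 (vol Ω) := ((hv i).1.2 j).2

theorem memLp_strain {v : E d → E d} (hv : ∀ i j, MemLp (gradv Ω v i j) 2 (vol Ω)) (i j : Fin d) :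
    MemLp (strain Ω v i j) 2 (vol Ω) := by
  have := ((hv i j).add (hv j i)).const_mul (1 / 2)
  refine this.ae_eq (Eventually.of_forall fun x => ?_)
  simp only [strain, Pi.add_apply]
  ring

theorem memLp_dv {v : E d → E d} (hv : ∀ i j, MemLp (gradv Ω v i j) 2 (vol Ω)) :
    MemLp (dv Ω v) 2 (vol Ω) :=
  memLp_finsetSum Finset.univ fun i _ => hv i i

theorem integralEq_sqL2v {a : E d → ℝ} (ha : MemLp a ∞ (vol Ω)) (ha0 : ∀ᵐ x ∂(vol Ω), 0 ≤ a x)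
    {v : E d → E d} (hv : ∀ i, MemLp (fun x => v x i) 2 (vol Ω)) :
    IntegralEq (vol Ω) (fun x => a x * ∑ i, v x i ^ 2) (sqL2v Ω fun x => √(a x) • v x) := by
  refine (IntegralEq.of_integrable (Integrable.mul_top ha (integrable_finsetSum Finset.univ
    fun i _ => (hv i).integrable_sq))).congr_val (integral_congr_ae ?_)
  filter_upwards [ha0] with x hx
  rw [norm_smul, mul_pow, Real.norm_eq_abs, sq_abs, Real.sq_sqrt hx, EuclideanSpace.real_norm_sq_eq]

theorem integralEq_sqL2 {a w : E d → ℝ} (ha : MemLp a ∞ (vol Ω)) (ha0 : ∀ᵐ x ∂(vol Ω), 0 ≤ a x)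
    (hw : MemLp w 2 (vol Ω)) :
    IntegralEq (vol Ω) (fun x => a x * w x ^ 2) (sqL2 Ω fun x => √(a x) * w x) := by
  refine (IntegralEq.of_integrable (Integrable.mul_top ha hw.integrable_sq)).congr_val
    (integral_congr_ae ?_)
  filter_upwards [ha0] with x hx
  rw [mul_pow, Real.sq_sqrt hx]

theorem integralEq_sqL2m {a : E d → ℝ} {w : Fin d → Fin d → E d → ℝ} (ha : MemLp a ∞ (vol Ω))
    (ha0 : ∀ᵐ x ∂(vol Ω), 0 ≤ a x) (hw : ∀ i j, MemLp (w i j) 2 (vol Ω)) :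
    IntegralEq (vol Ω) (fun x => a x * ∑ i, ∑ j, w i j x ^ 2)
      (sqL2m Ω fun i j x => √(a x) * w i j x) := by
  refine (IntegralEq.of_integrable (Integrable.mul_top ha (integrable_finsetSum Finset.univ
    fun i _ => integrable_finsetSum Finset.univ fun j _ => (hw i j).integrable_sq))).congr_val
    (integral_congr_ae ?_)
  filter_upwards [ha0] with x hx
  simp only [mul_pow, Real.sq_sqrt hx, Finset.mul_sum]

theorem integralEq_errA {lam ν Λ τ : ℝ} {a q : E d → ℝ} {v : E d → E d} (ha : MemLp a ∞ (vol Ω))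
    (ha0 : ∀ᵐ x ∂(vol Ω), 0 ≤ a x) (hv : MemH10v Ω v) (hq : MemLp q 2 (vol Ω)) :
    IntegralEq (vol Ω) (fun x => a x * ∑ i, v x i ^ 2 + τ / lam * q x ^ 2
      + 2 * τ * ν * (a x * ∑ i, ∑ j, strain Ω v i j x ^ 2) + τ * Λ * (a x * dv Ω v x ^ 2))
      (errA Ω lam ν Λ τ a v q) :=
  (((integralEq_sqL2v ha ha0 fun i => (hv i).1.1).add
    ((IntegralEq.of_integrable hq.integrable_sq).const_mul _)).add
    ((integralEq_sqL2m ha ha0 (memLp_strain hv.memLp_gradv)).const_mul _)).add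
    ((integralEq_sqL2 ha ha0 (memLp_dv hv.memLp_gradv)).const_mul _)

theorem le_errA {lam ν Λ τ : ℝ} (hlam : 0 < lam) (hν : 0 ≤ ν) (hΛ : 0 ≤ Λ) (hτ : 0 < τ)
    (a q : E d → ℝ) (v : E d → E d) :
    0 ≤ errA Ω lam ν Λ τ a v q ∧ sqL2v Ω (fun x => √(a x) • v x) ≤ errA Ω lam ν Λ τ a v q ∧
      τ / lam * sqL2 Ω q ≤ errA Ω lam ν Λ τ a v q := by
  have h1 : 0 ≤ sqL2v Ω (fun x => √(a x) • v x) := integral_nonneg fun x => by positivity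
  have h2 : 0 ≤ τ / lam * sqL2 Ω q :=
    mul_nonneg (by positivity) (integral_nonneg fun x => by positivity)
  have h3 : 0 ≤ 2 * τ * ν * sqL2m Ω (fun i j x => √(a x) * strain Ω v i j x) :=
    mul_nonneg (by positivity) (integral_nonneg fun x => by positivity)
  have h4 : 0 ≤ τ * Λ * sqL2 Ω (fun x => √(a x) * dv Ω v x) :=
    mul_nonneg (by positivity) (integral_nonneg fun x => by positivity)
  unfold errA
  refine ⟨?_, ?_, ?_⟩ <;> linarith

theorem integral_sum_sq_le_errA {lam ν Λ τ : ℝ} (hlam : 0 < lam) (hν : 0 ≤ ν) (hΛ : 0 ≤ Λ)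
    (hτ : 0 < τ) {a q : E d → ℝ} {v : E d → E d} (ha : MemLp a ∞ (vol Ω)) {c : ℝ} (hc : 0 < c)
    (hac : ∀ᵐ x ∂(vol Ω), c ≤ a x) (hv : ∀ i, MemLp (fun x => v x i) 2 (vol Ω)) :
    ∫ x in Ω, ∑ i, v x i ^ 2 ≤ errA Ω lam ν Λ τ a v q / c := by
  rw [le_div_iff₀' hc]
  refine le_trans ?_ (le_errA hlam hν hΛ hτ a q v).2.1
  refine ((IntegralEq.of_integrable (integrable_finsetSum Finset.univ
    fun i _ => (hv i).integrable_sq)).const_mul c).mono (integralEq_sqL2v ha ?_ hv) ?_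
  · filter_upwards [hac] with x hx using hc.le.trans hx
  · filter_upwards [hac] with x hx
    exact mul_le_mul_of_nonneg_right hx (Finset.sum_nonneg fun i _ => sq_nonneg _)

end ErrorFunctionals

/-! ### The scheme in integral form -/

section Scheme

variable {d : ℕ} {Ω : Set (E d)}

theorem integrable_mul_four_four_two {f g h : E d → ℝ} (hf : MemLp f 4 (vol Ω))
    (hg : MemLp g 4 (vol Ω)) (hh : MemLp h 2 (vol Ω)) :
    Integrable (fun x => f x * g x * h x) (vol Ω) :=
  MemLp.integrable_mul_two (hg.mul' hf) hh

/-- Product rule for the field on which the implicit viscosity acts, M = m - ρuⁿ with m at the new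
time; the second summand is the source of the commutators. -/
theorem gradv_mul_sub (hΩo : IsOpen Ω) (hΩb : Bornology.IsBounded Ω) {a : E d → ℝ}
    (ha : MemW1 Ω ∞ a) {u u' M : E d → E d} (hu : MemH10v Ω u) (hu' : MemH10v Ω u')
    (hM : ∀ᵐ x ∂(vol Ω), M x = a x • (u x - u' x)) :
    ∀ᵐ x ∂(vol Ω), ∀ i j, gradv Ω M i j x
      = a x * (gradv Ω u i j x - gradv Ω u' i j x) + wd Ω j a x * (u x i - u' x i) := by
  refine ae_all_iff.2 fun i => ae_all_iff.2 fun j => ?_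
  have h1 := (((hu i).sub hΩo hΩb (hu' i)).hasWeakDeriv_mul hΩb ha j).congr_ae hΩo
    (f' := fun x => M x i) (by
      filter_upwards [hM] with x hx
      simp [hx])
  filter_upwards [h1.wd_eq hΩo, (hu i).1.wd_sub hΩo hΩb (hu' i).1 j] with x h2 h3
  simp only [gradv]
  rw [h2, h3]

theorem memLp_gradv_mul_sub (hΩo : IsOpen Ω) (hΩb : Bornology.IsBounded Ω) {a : E d → ℝ}
    (ha : MemW1 Ω ∞ a) {u u' M : E d → E d} (hu : MemH10v Ω u) (hu' : MemH10v Ω u')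
    (hM : ∀ᵐ x ∂(vol Ω), M x = a x • (u x - u' x)) (i j : Fin d) :
    MemLp (gradv Ω M i j) 2 (vol Ω) := by
  have h1 : MemLp (fun x => a x * (gradv Ω u i j x - gradv Ω u' i j x)) 2 (vol Ω) :=
    ((hu.memLp_gradv i j).sub (hu'.memLp_gradv i j)).mul' ha.1
  have h2 : MemLp (fun x => wd Ω j a x * (u x i - u' x i)) 2 (vol Ω) :=
    ((hu i).1.1.sub (hu' i).1.1).mul' (ha.2 j).2
  refine (h1.add h2).ae_eq ?_
  filter_upwards [gradv_mul_sub hΩo hΩb ha hu hu' hM] with x hx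
  exact (hx i j).symm

variable {η : ℝ → ℝ} {lam ν Λ τ : ℝ} {N : ℕ} {fh : ℕ → E d → E d} {ρi : E d → ℝ}
  {ui : E d → E d} {pi : E d → ℝ} {ρ : ℕ → E d → ℝ} {m u : ℕ → E d → E d} {p R : ℕ → E d → ℝ}

theorem IsScheme.momentum_eq (h : IsScheme Ω η lam ν Λ τ N fh ρi ui pi ρ m u p R) {c : ℝ}
    (hc : 0 < c) (hρ : ∀ n ≤ N, ∀ᵐ x ∂(vol Ω), c ≤ ρ n x) {n : ℕ} (hn : n ≤ N) :
    ∀ᵐ x ∂(vol Ω), m n x = ρ n x • u n x := by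
  rcases n with _ | n
  · filter_upwards [h.initial] with x hx
    rw [hx.2.2.1, hx.1, hx.2.1]
  · filter_upwards [h.step_velocity n hn, hρ _ hn] with x hx hx'
    rw [hx, smul_smul, mul_one_div_cancel (hc.trans_le hx').ne', one_smul]

theorem IsScheme.increment_eq (h : IsScheme Ω η lam ν Λ τ N fh ρi ui pi ρ m u p R) {c : ℝ}
    (hc : 0 < c) (hρ : ∀ n ≤ N, ∀ᵐ x ∂(vol Ω), c ≤ ρ n x) {n : ℕ} (hn : n < N) :
    ∀ᵐ x ∂(vol Ω), m (n + 1) x - ρ (n + 1) x • u n x = ρ (n + 1) x • (u (n + 1) x - u n x) := by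
  filter_upwards [h.momentum_eq hc hρ hn] with x hx
  rw [hx, smul_sub]

theorem IsScheme.memLp_residual (hΩb : Bornology.IsBounded Ω)
    (h : IsScheme Ω η lam ν Λ τ N fh ρi ui pi ρ m u p R) {n : ℕ} (hn : n < N) :
    MemLp (R (n + 1)) 2 (vol Ω) := by
  have := isFiniteMeasure_vol hΩb
  have h1 : MemLp (fun x => (ρ (n + 1) x - ρ n x) / τ) 2 (vol Ω) := by
    have := (((h.density_mem _ hn).1.sub (h.density_mem _ hn.le).1).const_mul τ⁻¹).mono_exponent
      (p := 2) le_top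
    refine this.ae_eq (Eventually.of_forall fun x => ?_)
    simp only [Pi.sub_apply]
    ring
  have h2 : MemLp (fun x => ∑ j, u n x j * wd Ω j (ρ n) x) 2 (vol Ω) :=
    memLp_finsetSum Finset.univ fun j _ =>
      ((h.density_mem _ hn.le).2 j).2.mul' (h.velocity_mem _ hn.le j).1.1
  exact (h1.add h2).ae_eq (h.step_density n hn)

/-- The momentum equation of the scheme, as the vanishing of a single integral. -/
theorem IsScheme.integralEq_momentum (hd : d = 2 ∨ d = 3) (hΩo : IsOpen Ω)
    (hΩb : Bornology.IsBounded Ω) (h : IsScheme Ω η lam ν Λ τ N fh ρi ui pi ρ m u p R) {c : ℝ}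
    (hc : 0 < c) (hρ : ∀ n ≤ N, ∀ᵐ x ∂(vol Ω), c ≤ ρ n x) {n : ℕ} (hn : n < N)
    (hη : MemLp (fun x => η (ρ (n + 1) x)) ∞ (vol Ω)) (hf : MemLp (fh (n + 1)) 2 (vol Ω))
    {v : E d → E d} (hv : MemH10v Ω v) :
    IntegralEq (vol Ω) (fun x => ∑ i, (m (n + 1) x i - m n x i) / τ * v x i
      + 2 * ν * ∑ i, ∑ j,
          strain Ω (fun y => m (n + 1) y - ρ (n + 1) y • u n y) i j x * strain Ω v i j x
      + 2 * ∑ i, ∑ j, η (ρ (n + 1) x) * strain Ω (u n) i j x * strain Ω v i j x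
      + Λ * (dv Ω (fun y => m (n + 1) y - ρ (n + 1) y • u n y) x * dv Ω v x)
      + lam * (dv Ω (u n) x * dv Ω v x)
      - p n x * dv Ω v x
      - ∑ i, ∑ j, ρ n x * u (n + 1) x i * u n x j * gradv Ω v i j x
      - 1 / 2 * ∑ i, ρ n x * u (n + 1) x i * dv Ω (u n) x * v x i
      - 1 / 2 * ∑ i, R (n + 1) x * u (n + 1) x i * v x i
      - ∑ i, fh (n + 1) x i * v x i) 0 := by
  have hm := h.momentum_mem _ hn
  have hm' := h.momentum_mem _ hn.le
  have hu := h.velocity_mem _ hn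
  have hu' := h.velocity_mem _ hn.le
  have hM := memLp_gradv_mul_sub hΩo hΩb (h.density_mem _ hn) hu hu' (h.increment_eq hc hρ hn)
  have hR := h.memLp_residual hΩb hn
  have hvv := hv.memLp_gradv
  have i1 : Integrable (fun x => ∑ i, (m (n + 1) x i - m n x i) / τ * v x i) (vol Ω) := by
    refine integrable_finsetSum _ fun i _ => ?_
    refine ((MemLp.integrable_mul_two ((hm i).1.1.sub (hm' i).1.1)
      (hv i).1.1).const_mul τ⁻¹).congr (Eventually.of_forall fun x => ?_)
    simp only [Pi.sub_apply]
    ring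
  have i2 : Integrable (fun x => ∑ i, ∑ j,
      strain Ω (fun y => m (n + 1) y - ρ (n + 1) y • u n y) i j x * strain Ω v i j x) (vol Ω) :=
    integrable_finsetSum _ fun i _ => integrable_finsetSum _ fun j _ =>
      MemLp.integrable_mul_two (memLp_strain hM i j) (memLp_strain hvv i j)
  have i3 : Integrable (fun x => ∑ i, ∑ j,
      η (ρ (n + 1) x) * strain Ω (u n) i j x * strain Ω v i j x) (vol Ω) := by
    refine integrable_finsetSum _ fun i _ => integrable_finsetSum _ fun j _ => ?_
    exact MemLp.integrable_mul_two ((memLp_strain hu'.memLp_gradv i j).mul' hη)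
      (memLp_strain hvv i j)
  have i4 := MemLp.integrable_mul_two (memLp_dv hM) (memLp_dv hvv)
  have i5 := MemLp.integrable_mul_two (memLp_dv hu'.memLp_gradv) (memLp_dv hvv)
  have i6 := MemLp.integrable_mul_two (h.pressure_mem _ hn.le) (memLp_dv hvv)
  have i7 : Integrable (fun x => ∑ i, ∑ j,
      ρ n x * u (n + 1) x i * u n x j * gradv Ω v i j x) (vol Ω) := by
    refine integrable_finsetSum _ fun i _ => integrable_finsetSum _ fun j _ => ?_
    have := Integrable.mul_top (h.density_mem _ hn.le).1 (integrable_mul_four_four_two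
      ((hu i).memLp_four hd hΩb) ((hu' j).memLp_four hd hΩb) (hvv i j))
    simpa only [mul_assoc] using this
  have i8 : Integrable (fun x => ∑ i, ρ n x * u (n + 1) x i * dv Ω (u n) x * v x i) (vol Ω) := by
    refine integrable_finsetSum _ fun i _ => ?_
    refine (Integrable.mul_top (h.density_mem _ hn.le).1 (integrable_mul_four_four_two
      ((hu i).memLp_four hd hΩb) ((hv i).memLp_four hd hΩb)
      (memLp_dv hu'.memLp_gradv))).congr (Eventually.of_forall fun x => ?_)
    ring
  have i9 : Integrable (fun x => ∑ i, R (n + 1) x * u (n + 1) x i * v x i) (vol Ω) := by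
    refine integrable_finsetSum _ fun i _ => ?_
    refine (integrable_mul_four_four_two ((hu i).memLp_four hd hΩb) ((hv i).memLp_four hd hΩb)
      hR).congr (Eventually.of_forall fun x => ?_)
    ring
  have i10 : Integrable (fun x => ∑ i, fh (n + 1) x i * v x i) (vol Ω) :=
    integrable_finsetSum _ fun i _ => MemLp.integrable_mul_two (memLp_apply hf i) (hv i).1.1
  have key := h.step_momentum n hn v hv
  refine ((((((((((IntegralEq.of_integrable i1).add
    ((IntegralEq.of_integrable i2).const_mul (2 * ν))).add
    ((IntegralEq.of_integrable i3).const_mul 2)).add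
    ((IntegralEq.of_integrable i4).const_mul Λ)).add
    ((IntegralEq.of_integrable i5).const_mul lam)).sub
    (IntegralEq.of_integrable i6)).sub (IntegralEq.of_integrable i7)).sub
    ((IntegralEq.of_integrable i8).const_mul (1 / 2))).sub
    ((IntegralEq.of_integrable i9).const_mul (1 / 2))).sub
    (IntegralEq.of_integrable i10)).congr_val (sub_eq_zero.2 key)

/-- The integral of `div(a (w · v) b)` vanishes, for fields that vanish on the boundary. -/
theorem integralEq_transport (hd : d = 2 ∨ d = 3) (hΩb : Bornology.IsBounded Ω) {a : E d → ℝ}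
    (ha : MemW1 Ω ∞ a) {b w v : E d → E d} (hb : MemH10v Ω b) (hw : MemH10v Ω w)
    (hv : MemH10v Ω v) :
    IntegralEq (vol Ω) (fun x => ∑ i, ∑ j, (a x * (b x j * w x i * gradv Ω v i j x
      + b x j * v x i * gradv Ω w i j x + w x i * v x i * gradv Ω b j j x)
      + wd Ω j a x * (b x j * w x i * v x i))) 0 := by
  refine (IntegralEq.sum (C := fun _ => 0) Finset.univ fun i _ =>
    (IntegralEq.sum (C := fun _ => 0) Finset.univ fun j _ => ?_).congr_val (by simp)).congr_val
    (by simp)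
  have := integral_deriv_mul_mul_mul hd hΩb ha (hb j) (hw i) (hv i) j
  exact ⟨this.1, this.2⟩

end Scheme

/-! ### One step of the scheme -/

section Step

variable {d : ℕ} {Ω : Set (E d)}

theorem errB_integralEq {η : ℝ → ℝ} {a : E d → ℝ} {v : E d → E d}
    (ha : MemLp (fun x => η (a x)) ∞ (vol Ω)) (ha0 : ∀ᵐ x ∂(vol Ω), 0 ≤ η (a x))
    (hv : MemH10v Ω v) :
    IntegralEq (vol Ω) (fun x => η (a x) * ∑ i, ∑ j, strain Ω v i j x ^ 2) (errB Ω η a v) :=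
  integralEq_sqL2m ha ha0 (memLp_strain hv.memLp_gradv)

/-- Integral of `energy_pointwise` with M = K. The zeros on the right are the values of the exact
weak form, the scheme and the two transport integrals, left unsimplified so that the integrand keeps
its shape. -/
theorem step_estimate (hd : d = 2 ∨ d = 3) (hΩo : IsOpen Ω) (hΩb : Bornology.IsBounded Ω)
    {T : ℝ} (hT : 0 < T) {η : ℝ → ℝ} {α : ℝ≥0} (hηL : LipschitzOnWith α η (Ioi 0))
    (hηpos : ∀ s, 0 < s → 0 < η s) {f : ℝ → L2v Ω} {ρ : ℝ → Linf Ω} {u W : ℝ → Linfv Ω}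
    {p : ℝ → Linf Ω} {K : ℝ} (hb : ExactBounds Ω T ρ u W p K)
    (hsol : IsExactSolution Ω T η ρ u p f)
    (hη : ∀ t ∈ Icc 0 T, MemLp (fun x => η (ρ t x)) ∞ (vol Ω))
    {c : ℝ} (hc : 0 < c) (hρc : ∀ t ∈ Icc 0 T, ∀ᵐ x ∂(vol Ω), c ≤ ρ t x)
    {κ : ℝ} (hκ0 : 0 ≤ κ)
    {lam ν Λ τ γ : ℝ} (hlam : 0 < lam) (hν : 0 ≤ ν) (hτ : 0 < τ) (hτT : τ ≤ T)
    (hγ : 0 < γ) (hγ1 : γ ^ 2 ≤ 1 / 4) (hγ2 : 64 * ν * γ ^ 2 ≤ 1)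
    {N : ℕ} {fh : ℕ → E d → E d} {ρi : E d → ℝ} {ui : E d → E d} {pi : E d → ℝ}
    {ρh : ℕ → E d → ℝ} {m uh : ℕ → E d → E d} {ph R : ℕ → E d → ℝ}
    (hs : IsScheme Ω η lam ν Λ τ N fh ρi ui pi ρh m uh ph R)
    (hsm : SmallnessConditions Ω η lam ν Λ τ γ N ρh)
    (hr : ∀ n ≤ N, ∀ᵐ x ∂(vol Ω), c ≤ ρh n x ∧ ρh n x ≤ K ∧ 1 ≤ κ * η (ρh n x)
      ∧ η (ρh n x) ≤ ν * ρh n x ∧ 11 / 10 * lam ≤ Λ * ρh n x)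
    {n : ℕ} (hn : n < N) {t t' : ℝ} (ht : t ∈ Icc 0 T) (ht' : t' ∈ Icc 0 T) (htt : t - t' = τ)
    (hfh : fh (n + 1) = f t) (hZ : Integrable (fun x => ∑ i, ∑ j,
      (strain Ω (u t) i j x - strain Ω (u t') i j x) ^ 2) (vol Ω)) :
    errA Ω lam ν Λ τ (ρh (n + 1)) (fun x => u t x - uh (n + 1) x) (fun x => p t x - ph (n + 1) x)
      + τ * errB Ω η (ρh (n + 1)) (fun x => u t x - uh (n + 1) x)
    ≤ errA Ω lam ν Λ τ (ρh n) (fun x => u t' x - uh n x) (fun x => p t' x - ph n x)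
      + 2 * τ * (0 - 0 - 0 + 1 / 2 * 0)
      + τ ^ 2 / lam * sqL2 Ω (fun x => p t x - ph (n + 1) x)
      + (2 + 24 * κ * K ^ 2 * K ^ 2 + 5 / 2 * K ^ 2 * K ^ 2 / lam + K ^ 2)
        * (τ * ∫ x in Ω, ∑ i, (u t x - uh (n + 1) x) i ^ 2)
      + inertiaConst K K * (τ * ∫ x in Ω, ∑ i, (u t' x - uh n x) i ^ 2)
      + (2 * inertiaConst K K + 1 + 1152 * κ * α ^ 2 * K ^ 2)
        * (τ * (sqL2 Ω (fun x => ρ t' x - ρh n x) + sqL2 Ω (fun x => ρ t x - ρh (n + 1) x)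
          + sqL2 Ω (R (n + 1))))
      + 128 * κ * ν ^ 2 * K ^ 2 * (τ * (∫ x in Ω, ∑ i, ∑ j,
        (strain Ω (u t) i j x - strain Ω (u t') i j x) ^ 2))
      + (vol Ω).real univ * ((2 * inertiaConst K K * T + 14 * K * K ^ 2 + 96 * κ * K ^ 2 * T
        + K ^ 2 / lam) * τ ^ 2) := by
  have := isFiniteMeasure_vol hΩb
  have hd3 : d ≤ 3 := by omega
  have habs : |t - t'| = τ := by rw [htt, abs_of_pos hτ]
  have hrc : ∀ n ≤ N, ∀ᵐ x ∂(vol Ω), c ≤ ρh n x := fun n hn => (hr n hn).mono fun x hx => hx.1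
  have hrK : ∀ n ≤ N, ∀ᵐ x ∂(vol Ω), ρh n x ≤ K := fun n hn => (hr n hn).mono fun x hx => hx.2.1
  have hr0 : ∀ n ≤ N, ∀ᵐ x ∂(vol Ω), 0 ≤ ρh n x :=
    fun n hn => (hrc n hn).mono fun x hx => hc.le.trans hx
  have hu := hs.velocity_mem _ hn
  have hu' := hs.velocity_mem _ hn.le
  have hU := hsol.boundary t ht
  have hU' := hsol.boundary t' ht'
  have he := hU.sub hΩo hΩb hu
  have he' := hU'.sub hΩo hΩb hu'
  have hηr := memLp_viscosity hηL (hs.density_mem _ hn).1 hc (hrc _ hn) (hrK _ hn)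
  have hη0 : ∀ᵐ x ∂(vol Ω), 0 ≤ η (ρh (n + 1) x) :=
    (hrc _ hn).mono fun x hx => (hηpos _ (hc.trans_le hx)).le
  have top_two : ∀ {g : E d → ℝ}, MemLp g ∞ (vol Ω) → MemLp g 2 (vol Ω) :=
    fun hg => hg.mono_exponent le_top
  have hq : MemLp (fun x => p t x - ph (n + 1) x) 2 (vol Ω) :=
    (top_two (Lp.memLp (p t))).sub (hs.pressure_mem _ hn)
  have hq' : MemLp (fun x => p t' x - ph n x) 2 (vol Ω) :=
    (top_two (Lp.memLp (p t'))).sub (hs.pressure_mem _ hn.le)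
  have hw : MemLp (fun x => ρ t x - ρh (n + 1) x) 2 (vol Ω) :=
    (top_two (Lp.memLp (ρ t))).sub (top_two (hs.density_mem _ hn).1)
  have hw' : MemLp (fun x => ρ t' x - ρh n x) 2 (vol Ω) :=
    (top_two (Lp.memLp (ρ t'))).sub (top_two (hs.density_mem _ hn.le).1)
  have hR := hs.memLp_residual hΩb hn
  have sum_sq : ∀ {v : E d → E d}, MemH10v Ω v →
      IntegralEq (vol Ω) (fun x => ∑ i, v x i ^ 2) (∫ x in Ω, ∑ i, v x i ^ 2) := fun hv =>
    IntegralEq.of_integrable (integrable_finsetSum _ fun i _ => (hv i).1.1.integrable_sq)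
  have sq : ∀ {g : E d → ℝ}, MemLp g 2 (vol Ω) →
      IntegralEq (vol Ω) (fun x => g x ^ 2) (sqL2 Ω g) := fun hg =>
    IntegralEq.of_integrable hg.integrable_sq
  have left := (integralEq_errA (lam := lam) (ν := ν) (Λ := Λ) (τ := τ) (hs.density_mem _ hn).1
    (hr0 _ hn) he hq).add ((errB_integralEq hηr hη0 he).const_mul τ)
  have exact_form := hb.weak_form hΩb hT hsol hη ht he
  have scheme_form := hs.integralEq_momentum hd hΩo hΩb hc hrc hn hηr
    (by rw [hfh]; exact Lp.memLp (f t)) he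
  -- Integral of the right side of `energy_pointwise`, assembled in the same order. Both transport
  -- identities carry the weight ρⁿ and the velocity uⁿ; the transported products are u(t)·e and
  -- |e|².
  have right := ((((((((integralEq_errA (lam := lam) (ν := ν) (Λ := Λ) (τ := τ)
      (hs.density_mem _ hn.le).1 (hr0 _ hn.le) he' hq').add
    (((((IntegralEq.mk exact_form.1 exact_form.2).sub scheme_form).sub
      (integralEq_transport hd hΩb (hs.density_mem _ hn.le) hu' hU he)).add
      ((integralEq_transport hd hΩb (hs.density_mem _ hn.le) hu' he he).const_mul
        (1 / 2))).const_mul (2 * τ))).add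
    ((sq hq).const_mul (τ ^ 2 / lam))).add
    (((sum_sq he).const_mul τ).const_mul
      (2 + 24 * κ * K ^ 2 * K ^ 2 + 5 / 2 * K ^ 2 * K ^ 2 / lam + K ^ 2))).add
    (((sum_sq he').const_mul τ).const_mul (inertiaConst K K))).add
    (((((sq hw').add (sq hw)).add (sq hR)).const_mul τ).const_mul
      (2 * inertiaConst K K + 1 + 1152 * κ * α ^ 2 * K ^ 2))).add
    (((IntegralEq.of_integrable hZ).const_mul τ).const_mul
      (128 * κ * ν ^ 2 * K ^ 2))).add
    ((IntegralEq.of_integrable (integrable_const ((2 * inertiaConst K K * T + 14 * K * K ^ 2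
      + 96 * κ * K ^ 2 * T + K ^ 2 / lam) * τ ^ 2))).congr_val
        (by rw [integral_const, smul_eq_mul])))
  refine left.mono right ?_
  filter_upwards [hr _ hn, hr _ hn.le, hsm.ae_bounds hηpos hlam hν hτ hγ hn hc (hrc _ hn.le) (hrc _ hn),
    hs.momentum_eq hc hrc hn, hs.momentum_eq hc hrc hn.le,
    hU.gradv_sub hΩo hΩb hu, hU'.gradv_sub hΩo hΩb hu',
    gradv_mul_sub hΩo hΩb (hs.density_mem _ hn) hu hu' (hs.increment_eq hc hrc hn),
    hsol.incompressible t ht, hsol.incompressible t' ht', hs.step_density n hn,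
    hs.step_pressure n hn, hb.rho_lip t ht t' ht', hb.p_lip t ht t' ht', hρc t ht,
    hb.u_bd t ht, hb.u_lip t ht t' ht', hb.W_bd t ht, hb.u_taylor t' ht' t ht,
    ae_all_iff.2 fun i => ae_all_iff.2 fun j => hb.grad_bd t ht i j]
    with x k1 k1' k2 km km' kg kg' kM kd kd' kρ kp kρl kpl kρc ku kul kW kV kG
  refine (energy_pointwise (T := T) (γ := γ) (W := fun i => W t x i) (κ := κ)
    (U := fun i => u t x i) (U' := fun i => u t' x i)
    (e := fun i => (u t x - uh (n + 1) x) i) (e' := fun i => (u t' x - uh n x) i)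
    (u := fun i => uh (n + 1) x i) (u' := fun i => uh n x i)
    (m := fun i => m (n + 1) x i) (m' := fun i => m n x i)
    (f := fun i => fh (n + 1) x i)
    (g := fun j => wd Ω j (ρh (n + 1)) x) (g' := fun j => wd Ω j (ρh n) x)
    (G := fun i j => gradv Ω (fun y => u t y - uh (n + 1) y) i j x)
    (G' := fun i j => gradv Ω (fun y => u t' y - uh n y) i j x)
    (GU := fun i j => gradv Ω (u t) i j x) (GU' := fun i j => gradv Ω (u t') i j x)
    (Gu := fun i j => gradv Ω (uh (n + 1)) i j x) (Gu' := fun i j => gradv Ω (uh n) i j x)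
    (GM := fun i j => gradv Ω (fun y => m (n + 1) y - ρh (n + 1) y • uh n y) i j x)
    (s := ρ t x) (s' := ρ t' x) (r := ρh (n + 1) x) (r' := ρh n x) (η₁ := η (ρ t x))
    (h := η (ρh (n + 1) x)) (P := p t x) (P' := p t' x) (p := ph (n + 1) x) (p' := ph n x)
    (R := R (n + 1) x) (K := K) (M := K) (α := α)
    hd3 hτ hτT hν hlam (hηpos _ (hc.trans_le k1.1)) (hc.le.trans k1'.1) k1'.2.1 k1.2.1 k1.2.2.1
    hκ0 hb.nonneg hγ1 hγ2 k1.2.2.2.1 k2.2.2.1 k1.2.2.2.2 k2.2.2.2 k2.1 k2.2.1 ?_ ?_ ?_ ?_ ?_ ?_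
    kM kd kd' kρ kp (by rwa [habs] at kρl) (by rwa [habs] at kpl) ?_ ?_ ?_ ?_ ?_ kG).trans
    (le_of_eq ?_)
  · intro i
    simp
  · intro i
    simp
  · intro i
    simp [km]
  · intro i
    simp [km']
  · intro i j
    rw [kg i j]
    ring
  · intro i j
    rw [kg' i j]
    ring
  · have := hηL.dist_le_mul _ (hc.trans_le kρc) _ (hc.trans_le k1.1)
    rwa [Real.dist_eq, Real.dist_eq] at this
  · rw [← EuclideanSpace.real_norm_sq_eq]
    exact pow_le_pow_left₀ (norm_nonneg _) ku 2
  · have h1 : ∑ i, (u t x i - u t' x i) ^ 2 = ‖u t x - u t' x‖ ^ 2 := by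
      rw [EuclideanSpace.real_norm_sq_eq]
      rfl
    rw [h1]
    rw [habs] at kul
    exact pow_le_pow_left₀ (norm_nonneg _) kul 2
  · exact fun i => abs_apply_le_of_norm_le kW i
  · intro i
    rw [abs_sub_comm t' t, habs] at kV
    have := abs_apply_le_of_norm_le kV i
    rw [← abs_neg] at this
    refine le_of_eq_of_le (congrArg _ ?_) this
    have e1 : t' - t = -τ := by linarith
    simp [e1]
    ring
  · rw [hfh]
    rfl

end Step

/-! ### From the step estimate to a single constant -/

/-- Velocity norms are at most A/c by the lower density bound, the pressure term is τ·(τ/λ)Q ≤ τA₁,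
and the strain increment D ≤ Zτ contributes only τ². The constant is the sum of all contributions,
so it dominates each coefficient. -/
theorem error_recursion {τ c lam V Z c₁ c₂ c₃ c₄ c₅ A₁ A₀ B S₁ S₀ R E₁ E₀ Q D : ℝ} (hτ : 0 < τ)
    (hc : 0 < c) (hV : 0 ≤ V) (hZ : 0 ≤ Z)
    (h₁ : 0 ≤ c₁) (h₂ : 0 ≤ c₂) (h₃ : 0 ≤ c₃) (h₄ : 0 ≤ c₄) (h₅ : 0 ≤ c₅) (hA₁ : 0 ≤ A₁)
    (hA₀ : 0 ≤ A₀) (hS₁ : 0 ≤ S₁) (hS₀ : 0 ≤ S₀) (hR : 0 ≤ R) (hE₁ : E₁ ≤ A₁ / c)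
    (hE₀ : E₀ ≤ A₀ / c) (hQ : τ / lam * Q ≤ A₁) (hD : D ≤ Z * τ)
    (h : A₁ + τ * B ≤ A₀ + 2 * τ * (0 - 0 - 0 + 1 / 2 * 0) + τ ^ 2 / lam * Q + c₁ * (τ * E₁)
      + c₂ * (τ * E₀) + c₃ * (τ * (S₀ + S₁ + R)) + c₄ * (τ * D) + V * (c₅ * τ ^ 2)) :
    (1 - (1 + c₁ / c + c₂ / c + c₃ + c₄ * Z + V * c₅) * τ) * A₁ + τ * B
      ≤ (1 + (1 + c₁ / c + c₂ / c + c₃ + c₄ * Z + V * c₅) * τ) * A₀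
        + (1 + c₁ / c + c₂ / c + c₃ + c₄ * Z + V * c₅) * τ ^ 2
        + (1 + c₁ / c + c₂ / c + c₃ + c₄ * Z + V * c₅) * τ * (S₁ + S₀ + R) := by
  have d₁ : 0 ≤ c₁ / c := by positivity
  have d₂ : 0 ≤ c₂ / c := by positivity
  have p₁ : 0 ≤ (c₂ / c + c₃ + c₄ * Z + V * c₅) * (τ * A₁) := by positivity
  have p₂ : 0 ≤ (1 + c₁ / c + c₃ + c₄ * Z + V * c₅) * (τ * A₀) := by positivity
  have p₃ : 0 ≤ (1 + c₁ / c + c₂ / c + c₄ * Z + V * c₅) * (τ * (S₁ + S₀ + R)) := by positivity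
  have p₄ : 0 ≤ (1 + c₁ / c + c₂ / c + c₃) * τ ^ 2 := by positivity
  have b₁ : c₁ * (τ * E₁) ≤ c₁ / c * (τ * A₁) :=
    (mul_le_mul_of_nonneg_left (mul_le_mul_of_nonneg_left hE₁ hτ.le) h₁).trans_eq (by ring)
  have b₂ : c₂ * (τ * E₀) ≤ c₂ / c * (τ * A₀) :=
    (mul_le_mul_of_nonneg_left (mul_le_mul_of_nonneg_left hE₀ hτ.le) h₂).trans_eq (by ring)
  have b₃ : τ ^ 2 / lam * Q ≤ τ * A₁ :=
    (mul_le_mul_of_nonneg_left hQ hτ.le).trans_eq' (by ring)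
  have b₄ : c₄ * (τ * D) ≤ c₄ * Z * τ ^ 2 :=
    (mul_le_mul_of_nonneg_left (mul_le_mul_of_nonneg_left hD hτ.le) h₄).trans_eq (by ring)
  linarith

end VarDensityNS

open VarDensityNS in
theorem theorem2 (d : ℕ) (hd : d = 2 ∨ d = 3)
    (Ω : Set (E d)) (hΩo : IsOpen Ω) (hΩb : Bornology.IsBounded Ω) (hΩc : IsConnected Ω)
    (T : ℝ) (hT : 0 < T)
    -- the dynamical viscosity, a positive Lipschitz function of the (positive) density
    (η : ℝ → ℝ) (α : ℝ≥0) (hηL : LipschitzOnWith α η (Set.Ioi 0)) (hηpos : ∀ s, 0 < s → 0 < η s)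
    -- the source term, bounded in time with values in `L²`
    (f : ℝ → L2v Ω) (hf : ∃ K : ℝ, ∀ t ∈ Set.Icc 0 T, ‖f t‖ ≤ K)
    -- the exact solution
    (ρ : ℝ → Linf Ω) (u : ℝ → Linfv Ω) (p : ℝ → Linf Ω)
    (hsol : IsExactSolution Ω T η ρ u p f) (hreg : IsRegular Ω T ρ u p)
    -- the parameters
    (lam : ℝ) (hlam : 0 < lam)
    (γ : ℝ) (hγ : 0 < γ) (hγ2 : γ ^ 2 ≤ min (1 / 4) (1 / (64 * nuBar Ω η (ρ 0)))) :
    ∃ C : ℝ, 0 < C ∧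
      ∀ (N : ℕ) (τ : ℝ), 0 < τ → N * τ = T →
      ∀ (ρh : ℕ → E d → ℝ) (mh uh : ℕ → E d → E d) (ph Rh : ℕ → E d → ℝ),
        IsScheme Ω η lam (nuBar Ω η (ρ 0)) (lamBar Ω lam (ρ 0)) τ N (fun n => f (n * τ))
          (ρ 0) (u 0) (p 0) ρh mh uh ph Rh →
        MinMax Ω N (ρ 0) ρh →
        SmallnessConditions Ω η lam (nuBar Ω η (ρ 0)) (lamBar Ω lam (ρ 0)) τ γ N ρh →
        ∀ n < N,
          (1 - C * τ) * errA Ω lam (nuBar Ω η (ρ 0)) (lamBar Ω lam (ρ 0)) τ (ρh (n + 1))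
              (fun x => u ((n + 1 : ℕ) * τ) x - uh (n + 1) x)
              (fun x => p ((n + 1 : ℕ) * τ) x - ph (n + 1) x)
            + τ * errB Ω η (ρh (n + 1)) (fun x => u ((n + 1 : ℕ) * τ) x - uh (n + 1) x)
          ≤ (1 + C * τ) * errA Ω lam (nuBar Ω η (ρ 0)) (lamBar Ω lam (ρ 0)) τ (ρh n)
              (fun x => u (n * τ) x - uh n x) (fun x => p (n * τ) x - ph n x)
            + C * τ ^ 2
            + C * τ * (sqL2 Ω (fun x => ρ ((n + 1 : ℕ) * τ) x - ρh (n + 1) x)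
                + sqL2 Ω (fun x => ρ (n * τ) x - ρh n x)
                + sqL2 Ω (Rh (n + 1))) := by
  have hne := vol_ne_zero hΩo hΩc.nonempty
  have := isFiniteMeasure_vol hΩb
  obtain ⟨c, hc, hρc⟩ := hsol.density_pos
  obtain ⟨W, K, hb⟩ := hreg.exists_bounds
  obtain ⟨B, hB⟩ := hf
  have h0T : (0 : ℝ) ∈ Icc 0 T := ⟨le_rfl, hT.le⟩
  have hρK : ∀ t ∈ Icc 0 T, ∀ᵐ x ∂(vol Ω), ρ t x ≤ K := fun t ht =>
    (hb.rho_bd t ht).mono fun x hx => (le_abs_self _).trans hx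
  have hcK : c ≤ K := by
    obtain ⟨x, h1, h2⟩ := ((hρc 0 h0T).and (hρK 0 h0T)).exists
    exact h1.trans h2
  obtain ⟨h₀, hh₀, hηlb⟩ := exists_viscosity_lower_bound hηL hηpos hc hcK
  have hη : ∀ t ∈ Icc 0 T, MemLp (fun x => η (ρ t x)) ∞ (vol Ω) := fun t ht =>
    memLp_viscosity hηL (Lp.memLp (ρ t)) hc (hρc t ht) (hρK t ht)
  obtain ⟨Z, hZ0, hZ⟩ := hb.strain_increment hΩo hΩb hT hsol hη hηL hh₀
    (fun t ht => ((hρc t ht).and (hρK t ht)).mono fun x hx => hηlb _ hx.1 hx.2) hB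
  have hK := hb.nonneg
  set ν := nuBar Ω η (ρ 0) with hνdef
  set Λ := lamBar Ω lam (ρ 0) with hΛdef
  have hν : 0 ≤ ν := nuBar_nonneg η (ρ 0)
  have hΛ : 0 ≤ Λ := lamBar_nonneg hlam.le (ρ 0)
  have hγ1 : γ ^ 2 ≤ 1 / 4 := hγ2.trans (min_le_left _ _)
  have hγν : 64 * ν * γ ^ 2 ≤ 1 := by
    -- For ν = 0 the quotient 1/(64ν) takes its default value 0, but the claim is trivial.
    rcases hν.eq_or_lt with h | h
    · rw [← h]
      norm_num
    · have := hγ2.trans (min_le_right _ _)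
      rw [le_div_iff₀ (by positivity)] at this
      linarith
  have hκ0 : 0 ≤ 1 / h₀ := by positivity
  have hI := inertiaConst_nonneg K K
  -- The constants involve only the data and the exact solution and are fixed before N, τ and the
  -- discrete fields; κ is taken as 1/h₀.
  set c₁ := 2 + 24 * (1 / h₀) * K ^ 2 * K ^ 2 + 5 / 2 * K ^ 2 * K ^ 2 / lam + K ^ 2 with hc₁
  set c₂ := inertiaConst K K with hc₂
  set c₃ := 2 * c₂ + 1 + 1152 * (1 / h₀) * α ^ 2 * K ^ 2 with hc₃
  set c₄ := 128 * (1 / h₀) * ν ^ 2 * K ^ 2 with hc₄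
  set c₅ := 2 * c₂ * T + 14 * K * K ^ 2 + 96 * (1 / h₀) * K ^ 2 * T + K ^ 2 / lam with hc₅
  have hc₁0 : 0 ≤ c₁ := by positivity
  have hc₃0 : 0 ≤ c₃ := by positivity
  have hc₄0 : 0 ≤ c₄ := by positivity
  have hc₅0 : 0 ≤ c₅ := by positivity
  have hV : 0 ≤ (vol Ω).real univ := measureReal_nonneg
  refine ⟨1 + c₁ / c + c₂ / c + c₃ + c₄ * Z + (vol Ω).real univ * c₅, by positivity, ?_⟩
  intro N τ hτ hNτ ρh mh uh ph Rh hs hmm hsm n hn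
  have hn' : n + 1 ≤ N := hn
  have hN1 : ((n + 1 : ℕ) : ℝ) ≤ N := by exact_mod_cast hn'
  have ht : ((n + 1 : ℕ) : ℝ) * τ ∈ Icc 0 T :=
    ⟨by positivity, hNτ ▸ mul_le_mul_of_nonneg_right hN1 hτ.le⟩
  have ht' : (n : ℝ) * τ ∈ Icc 0 T := by
    refine ⟨by positivity, le_trans ?_ ht.2⟩
    push_cast
    nlinarith
  have htt : ((n + 1 : ℕ) : ℝ) * τ - n * τ = τ := by
    push_cast
    ring
  have hτT : τ ≤ T := by
    have := ht'.1
    have := ht.2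
    linarith
  -- Spatial regularity of the initial density is not part of the regularity of the exact solution;
  -- it is inherited from the first discrete density, which coincides with it almost everywhere.
  have hρ0 : MemW1 Ω ∞ (ρ 0) := (hs.density_mem 0 (Nat.zero_le _)).congr_ae hΩo
    (hs.initial.mono fun x hx => hx.1)
  have hr : ∀ n ≤ N, ∀ᵐ x ∂(vol Ω), c ≤ ρh n x ∧ ρh n x ≤ K ∧ 1 ≤ 1 / h₀ * η (ρh n x)
      ∧ η (ρh n x) ≤ ν * ρh n x ∧ 11 / 10 * lam ≤ Λ * ρh n x := by
    intro n hn
    filter_upwards [hmm n hn] with x hx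
    have k1 := (le_rhoMin (hρc 0 h0T) (hρK 0 h0T)).trans hx.1
    have k2 := hx.2.trans (rhoMax_le (hρc 0 h0T) (hρK 0 h0T))
    refine ⟨k1, k2, ?_, viscosity_le_nuBar_mul hΩo hΩb hΩc hηL hηpos hρ0 hc (hρc 0 h0T)
      (hρK 0 h0T) hx.1 hx.2, le_lamBar_mul hΩo hΩc.nonempty hlam.le hc (hρc 0 h0T) (hρK 0 h0T) hx.1⟩
    rw [one_div_mul_eq_div, le_div_iff₀ hh₀, one_mul]
    exact hηlb _ k1 k2
  have step := step_estimate hd hΩo hΩb hT hηL hηpos hb hsol hη hc hρc hκ0 hlam hν hτ hτT hγ hγ1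
    hγν hs hsm hr hn ht ht' htt rfl (hZ _ ht _ ht').1
  rw [← hc₁, ← hc₂, ← hc₃, ← hc₄, ← hc₅] at step
  have z := (hZ _ ht _ ht').2
  rw [htt, abs_of_pos hτ] at z
  have hρtop : ∀ n ≤ N, MemLp (ρh n) ∞ (vol Ω) := fun n hn => (hs.density_mem n hn).1
  have hlow : ∀ n ≤ N, ∀ᵐ x ∂(vol Ω), c ≤ ρh n x := fun n hn => (hr n hn).mono fun x hx => hx.1
  have he := (hsol.boundary _ ht).sub hΩo hΩb (hs.velocity_mem _ hn')
  have he' := (hsol.boundary _ ht').sub hΩo hΩb (hs.velocity_mem _ hn.le)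
  have E₁ := integral_sum_sq_le_errA (q := fun x => p ((n + 1 : ℕ) * τ) x - ph (n + 1) x)
    hlam hν hΛ hτ (hρtop _ hn') hc (hlow _ hn') (fun i => (he i).1.1)
  have E₀ := integral_sum_sq_le_errA (q := fun x => p (n * τ) x - ph n x)
    hlam hν hΛ hτ (hρtop _ hn.le) hc (hlow _ hn.le) (fun i => (he' i).1.1)
  have Q := (le_errA hlam hν hΛ hτ (Ω := Ω) (ρh (n + 1))
    (fun x => p ((n + 1 : ℕ) * τ) x - ph (n + 1) x)
    (fun x => u ((n + 1 : ℕ) * τ) x - uh (n + 1) x)).2.2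
  have A₁ := (le_errA hlam hν hΛ hτ (Ω := Ω) (ρh (n + 1))
    (fun x => p ((n + 1 : ℕ) * τ) x - ph (n + 1) x)
    (fun x => u ((n + 1 : ℕ) * τ) x - uh (n + 1) x)).1
  have A₀ := (le_errA hlam hν hΛ hτ (Ω := Ω) (ρh n) (fun x => p (n * τ) x - ph n x)
    (fun x => u (n * τ) x - uh n x)).1
  have S₁ : 0 ≤ sqL2 Ω (fun x => ρ ((n + 1 : ℕ) * τ) x - ρh (n + 1) x) :=
    integral_nonneg fun x => sq_nonneg _
  have S₀ : 0 ≤ sqL2 Ω (fun x => ρ (n * τ) x - ρh n x) := integral_nonneg fun x => sq_nonneg _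
  have SR : 0 ≤ sqL2 Ω (Rh (n + 1)) := integral_nonneg fun x => sq_nonneg _
  exact error_recursion hτ hc hV hZ0 hc₁0 hI hc₃0 hc₄0 hc₅0 A₁ A₀ S₁ S₀ SR E₁ E₀ Q z step
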